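/- Consider finite two-player zero-sum extensive-form games between a maximizer $\blacktriangle$, a minimizer $\blacktriangledown$ and Nature, possibly of imperfect recall, in which Nature's probabilities and the payoffs are rational. A game is *timeable* if all nodes of an information set have the same depth. A player has *perfect recall* if, for each of its information sets, all nodes of the set have the same sequence of earlier information sets and actions of that player. A *behavioral strategy* of a player chooses an action independently at each of its information sets $I$, according to a probability distribution over the actions available at $I$. Let $\hat{\mathcal X}$ and $\hat{\mathcal Y}$ be the sets of behavioral strategies of $\blacktriangle$ and $\blacktriangledown$. The *behavioral max-min value* of a game is $$\operatorname{val}(G)=\max_{x\in\hat{\mathcal X}}\ \min_{y\in\hat{\mathcal Y}}\ \sum_{z} u(z)\,p(z)\,x(z)\,y(z),$$ where $z$ ranges over the terminal nodes, $u(z)$ is the payoff of $\blacktriangle$, and $p(z)$, $x(z)$, $y(z)$ are the probabilities that Nature, $\blacktriangle$ and $\blacktriangledown$, respectively, play all of their actions on the path from the root to $z$. BehavioralMaxMin is the following promise problem. The input is a timeable game $G$ (its whole game tree), a rational threshold $v$ and a rational error $\varepsilon>0$, with all rational numbers written as fractions in binary. Accept if $\operatorname{val}(G)\ge v$, and reject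 if $\operatorname{val}(G)<v-\varepsilon$. **Theorem.** BehavioralMaxMin is in $\Sigma_2^{\mathsf P}$. Restricted to games in which $\blacktriangledown$ has perfect recall, it is in $\mathsf{NP}$. Here a promise problem is said to be in a class $\mathcal C$ of languages if some language in $\mathcal C$ contains all inputs that must be accepted and none that must be rejected. -/

import Mathlib

/-! ### Two-player zero-sum extensive-form games -/

namespace EFG

/-- The two strategic players: the maximizer and the minimizer. -/
inductive Player : Type
  | maximizer
  | minimizer
  deriving DecidableEq

/-- Finite rooted game trees with rational data. A node is terminal (carrying the payoff `u` of the
maximizer, the minimizer receiving `-u`), or a chance node at which Nature plays action `a` with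
probability `p a`, or a decision node of player `i` that lies in the `I`-th information set of `i`.
The actions available at a non-terminal node with `k` children are numbered `0, …, k - 1`. -/
inductive GameTree : Type
  | terminal (u : ℚ)
  | chance (k : ℕ) (p : Fin k → ℚ) (child : Fin k → GameTree)
  | decision (i : Player) (I : ℕ) (k : ℕ) (child : Fin k → GameTree)

/-- One step of a history: Nature plays action `a`, which has probability `p`, or player `i` plays
action `a` at the information set `I`. -/
inductive Step : Type
  | chance (a : ℕ) (p : ℚ)
  | decision (i : Player) (I : ℕ) (a : ℕ)

/-- A node of a game tree: the path from the root to it, and the subtree hanging at it. -/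
structure History : Type where
  path : List Step
  subtree : GameTree

/-- The list of all nodes of the tree; every node occurs exactly once. -/
def GameTree.histories : GameTree → List History
  | .terminal u => [⟨[], .terminal u⟩]
  | .chance k p c => ⟨[], .chance k p c⟩ ::
      (List.finRange k).flatMap fun a =>
        (c a).histories.map fun h => ⟨Step.chance a (p a) :: h.path, h.subtree⟩
  | .decision i I k c => ⟨[], .decision i I k c⟩ ::
      (List.finRange k).flatMap fun a =>
        (c a).histories.map fun h => ⟨Step.decision i I a :: h.path, h.subtree⟩

/-- `h` is a node of `t` that lies in the information set `I` of player `i` and has `k` actions. -/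
def GameTree.MemInfoset (t : GameTree) (i : Player) (I k : ℕ) (h : History) : Prop :=
  h ∈ t.histories ∧ ∃ c, h.subtree = .decision i I k c

/-- The sequence `σ_i` of player `i` along a path: the ordered list of pairs of information sets
reached and actions played there by `i`. -/
def sequence (i : Player) (path : List Step) : List (ℕ × ℕ) :=
  path.filterMap fun s => match s with
    | .chance _ _ => none
    | .decision j I a => if j = i then some (I, a) else none

/-- The probability that Nature plays all of its actions on a path. -/
def chanceProb (path : List Step) : ℚ :=
  (path.map fun s => match s with
    | .chance _ p => p
    | .decision _ _ _ => 1).prod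

/-- The terminal nodes, each with its path and its payoff. -/
def GameTree.terminals (t : GameTree) : List (List Step × ℚ) :=
  t.histories.filterMap fun h => match h.subtree with
    | .terminal u => some (h.path, u)
    | _ => none

/-- A two-player zero-sum extensive-form game, possibly of imperfect recall. -/
structure Game : Type where
  tree : GameTree
  /-- Nature plays a probability distribution at every chance node. -/
  chance_distribution : ∀ h ∈ tree.histories, ∀ k p c, h.subtree = .chance k p c →
    (∀ a, 0 ≤ p a) ∧ ∑ a, p a = 1
  /-- Some action is available at every decision node. -/
  actions_nonempty : ∀ i I k h, tree.MemInfoset i I k h → 0 < k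
  /-- All nodes of an information set have the same actions. -/
  infoset_actions : ∀ i I k k' h h', tree.MemInfoset i I k h → tree.MemInfoset i I k' h' → k = k'

/-- All nodes of an information set have the same depth. -/
def Game.Timeable (G : Game) : Prop :=
  ∀ i I k k' h h', G.tree.MemInfoset i I k h → G.tree.MemInfoset i I k' h' →
    h.path.length = h'.path.length

/-- Player `i` has the same sequence at all nodes of each of its information sets. -/
def Game.PerfectRecall (G : Game) (i : Player) : Prop :=
  ∀ I k k' h h', G.tree.MemInfoset i I k h → G.tree.MemInfoset i I k' h' →
    sequence i h.path = sequence i h'.path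

/-- The behavioral strategies of player `i`: a probability distribution `x I` over the available
actions, for every information set `I` of `i` (the other values of `x` play no role). -/
def Game.Behavioral (G : Game) (i : Player) : Type :=
  {x : ℕ → ℕ → ℝ // ∀ I k h, G.tree.MemInfoset i I k h →
    (∀ a < k, 0 ≤ x I a) ∧ ∑ a ∈ Finset.range k, x I a = 1}

/-- The realization form of a behavioral strategy of player `i`: the probability that it plays all
actions of `i` on the path. -/
def realization (i : Player) (x : ℕ → ℕ → ℝ) (path : List Step) : ℝ :=
  ((sequence i path).map fun s => x s.1 s.2).prod

/-- The expected payoff of the maximizer, `∑ z, u z * p z * x z * y z` over the terminal nodes. -/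
noncomputable def Game.expectedUtility (G : Game) (x : G.Behavioral .maximizer)
    (y : G.Behavioral .minimizer) : ℝ :=
  (G.tree.terminals.map fun z =>
    (z.2 : ℝ) * (chanceProb z.1 : ℝ) * realization .maximizer x.1 z.1 *
      realization .minimizer y.1 z.1).sum

/-- The behavioral max-min value of a game. -/
noncomputable def Game.behavioralMaxMinValue (G : Game) : ℝ :=
  ⨆ x : G.Behavioral .maximizer, ⨅ y : G.Behavioral .minimizer, G.expectedUtility x y

/-! ### Encoding of games as strings -/

/-- The alphabet in which games are written down. -/
inductive Sym : Type
  | zero | one | minus | slash | semicolon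
  | terminal | chance | maximizer | minimizer | close

/-- Natural numbers in binary, least significant bit first. -/
def encodeNat (n : ℕ) : List Sym :=
  n.bits.map fun b => if b then .one else .zero

/-- Rational numbers as reduced fractions in binary, with an end marker. -/
def encodeRat (q : ℚ) : List Sym :=
  (if q < 0 then [.minus] else []) ++ encodeNat q.num.natAbs ++ [.slash] ++ encodeNat q.den ++
    [.semicolon]

/-- Game trees in prefix notation. -/
def GameTree.encode : GameTree → List Sym
  | .terminal u => .terminal :: encodeRat u
  | .chance k p c => .chance ::
      ((List.finRange k).flatMap fun a => encodeRat (p a) ++ (c a).encode) ++ [.close]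
  | .decision i I k c => (match i with | .maximizer => .maximizer | .minimizer => .minimizer) ::
      encodeNat I ++ ((List.finRange k).flatMap fun a => (c a).encode) ++ [.close]

/-- An input of the problem: a timeable game, a threshold value `v` and an error `ε > 0`. -/
structure Input : Type where
  game : Game
  timeable : game.Timeable
  v : ℚ
  ε : ℚ
  ε_pos : 0 < ε

/-- The string that represents an input. -/
def Input.encode (J : Input) : List Sym :=
  J.game.tree.encode ++ encodeRat J.v ++ encodeRat J.ε

end EFG

/-! ### Complexity classes, over polynomial-time Turing machines -/

namespace Complexity

/-- The pair of two strings, as a string over the disjoint union of the alphabets. -/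
def pair {Γ Δ : Type} (x : List Γ) (y : List Δ) : List (Γ ⊕ Δ) :=
  x.map Sum.inl ++ y.map Sum.inr

/-- A Turing machine decides the predicate `f` in time polynomial in the length of `enc a`. -/
def PolyTimeDecidable {α Γ : Type} (enc : α → List Γ) (f : α → Bool) : Prop :=
  Nonempty (Turing.TM2ComputableInPolyTime enc Computability.encodeBool f)

/-- The class NP of languages over the alphabet `Γ`: polynomially long certificates, verified in
polynomial time. -/
def NP (Γ : Type) : Set (Language Γ) :=
  {L | ∃ (q : Polynomial ℕ) (V : List Γ × List Bool → Bool),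
    PolyTimeDecidable (fun a => pair a.1 a.2) V ∧
    ∀ x, x ∈ L ↔ ∃ w : List Bool, w.length ≤ q.eval x.length ∧ V (x, w) = true}

/-- The second level `Σ₂ᴾ` of the polynomial hierarchy, for languages over the alphabet `Γ`: an
existential and then a universal quantifier over polynomially long strings, in front of a
polynomial-time predicate. -/
def Sigma2P (Γ : Type) : Set (Language Γ) :=
  {L | ∃ (q : Polynomial ℕ) (V : List Γ × List Bool × List Bool → Bool),
    PolyTimeDecidable (fun a => pair (pair a.1 a.2.1) a.2.2) V ∧
    ∀ x, x ∈ L ↔ ∃ w : List Bool, w.length ≤ q.eval x.length ∧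
      ∀ u : List Bool, u.length ≤ q.eval x.length → V (x, w, u) = true}

/-- A promise problem: the strings to be accepted and the strings to be rejected. -/
structure PromiseProblem (Γ : Type) : Type where
  yes : Language Γ
  no : Language Γ

/-- A promise problem is in the class `C` if some language of `C` contains all yes-instances and no
no-instance. -/
def PromiseProblem.IsIn {Γ : Type} (P : PromiseProblem Γ) (C : Set (Language Γ)) : Prop :=
  ∃ L ∈ C, (∀ x ∈ P.yes, x ∈ L) ∧ ∀ x ∈ P.no, x ∉ L

end Complexity

namespace EFG

/-- The approximate behavioral max-min value problem on the inputs whose game satisfies `R`: accept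
if the value is at least `v`, reject if it is less than `v - ε`. -/
def behavioralMaxMin (R : Game → Prop) : Complexity.PromiseProblem Sym where
  yes := {s | ∃ J : Input, R J.game ∧ J.encode = s ∧
    (J.v : ℝ) ≤ J.game.behavioralMaxMinValue}
  no := {s | ∃ J : Input, R J.game ∧ J.encode = s ∧
    J.game.behavioralMaxMinValue < (J.v : ℝ) - (J.ε : ℝ)}

end EFG

/-! The verifiers evaluate the game exactly at rational strategies. So two things matter: how short
such strategies may be, and how a best answer of the minimizer is certified. Let `n` be the length
of the input. Changing every probability by at most `δ` changes the expected payoff by at most `δ`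
times the largest absolute payoff times the number of edges (`GameTree.abs_utility_sub_le`). The
latter two are at most `2 ^ n`, and `ε` is at least `2 ^ (-n)`, so rounding to `4 * n + 2` bits
costs at most `ε / 4` (`Game.abs_utility_round_sub_le`). For Σ₂ᴾ one guesses a rounded strategy of
the maximizer, quantifies over all short strategies of the minimizer, and asks for a payoff of at
least `v - ε / 2`; the promise gap leaves room for rounding on both sides.

For NP the certificate also contains a pure answer of the minimizer. It is tested for local
optimality: for each information set and action, deviating there must not lower the payoff, where
the minimizer plays uniformly at all smaller depths. Under perfect recall the minimizer contributes
the same factor to the reach probabilities of all nodes of an information set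
(`GameTree.counterfactual_eq_prod_mul`). Uniform play makes this factor positive, so the outcome of
the test carries over to any other earlier play. Turning the answer into a competitor depth by
depth, starting at the root, therefore never lowers the payoff, and the answer is a best response
(`Game.utility_le_of_locally_optimal`). Backward induction over the depths produces a pure answer
that passes the test (`GameTree.exists_locally_optimal`).

It remains to run the verifiers on a Turing machine in polynomial time. The class `PolyFun` of
functions on data coded by binary trees is closed under composition, pairing, case distinction, and
iteration with polynomially bounded intermediate results. Its members are computed by structured
programs on stacks, which compile to machines (`polyTimeDecidable_of_polyFun`). A game is evaluated
in one pass over its prefix code, with a stack of unfinished nodes and with unreduced fractions,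
whose lengths add up and so remain polynomial (`polyFun_evaluate`). On the code of a tree the pass
yields the expected payoff (`foldl_encode`, `GameTree.toReal_value`). Strings that encode no input
lie outside the promise and need not be recognised. -/

/-! ### Structured programs over finitely many stacks -/

namespace StackProgram

open Turing Function

/-- Structured programs acting on stacks with alphabets `Γ k` and a register of type `σ`. -/
inductive Prog {K : Type} (Γ : K → Type) (σ : Type) : Type
  | load (f : σ → σ)
  | push (k : K) (f : σ → Γ k)
  | pop (k : K) (f : σ → Option (Γ k) → σ)
  | seq (p q : Prog Γ σ)
  | ite (c : σ → Bool) (p q : Prog Γ σ)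
  | while (c : σ → Bool) (p : Prog Γ σ)

variable {K : Type} {Γ : K → Type} {σ : Type}

/-- `Exec p v S v' S' t`: started in register `v` and stacks `S`, the program `p` ends in `v'` and
`S'` within `t` steps. -/
inductive Exec [DecidableEq K] : Prog Γ σ → σ → (∀ k, List (Γ k)) → σ → (∀ k, List (Γ k)) → ℕ → Prop
  | load {f v S} : Exec (.load f) v S (f v) S 1
  | push {k f v S} : Exec (.push k f) v S v (update S k (f v :: S k)) 1
  | pop {k f v S} : Exec (.pop k f) v S (f v (S k).head?) (update S k (S k).tail) 1
  | seq {p q v S v' S' v'' S'' t t'} : Exec p v S v' S' t → Exec q v' S' v'' S'' t' →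
      Exec (.seq p q) v S v'' S'' (t + t')
  | ite_true {c p q v S v' S' t} : c v = true → Exec p v S v' S' t →
      Exec (.ite c p q) v S v' S' (t + 1)
  | ite_false {c p q v S v' S' t} : c v = false → Exec q v S v' S' t →
      Exec (.ite c p q) v S v' S' (t + 1)
  | while_true {c p v S v' S' v'' S'' t t'} : c v = true → Exec p v S v' S' t →
      Exec (.while c p) v' S' v'' S'' t' → Exec (.while c p) v S v'' S'' (t + t' + 1)
  | while_false {c p v S} : c v = false → Exec (.while c p) v S v S 1
  | mono {p v S v' S' t t'} : Exec p v S v' S' t → t ≤ t' → Exec p v S v' S' t'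

/-- The labels of the compiled program. -/
def Prog.Label : Prog Γ σ → Type
  | .load _ => Unit
  | .push _ _ => Unit
  | .pop _ _ => Unit
  | .seq p q => p.Label ⊕ q.Label
  | .ite _ p q => Option (p.Label ⊕ q.Label)
  | .while _ p => Option p.Label

noncomputable instance Prog.fintypeLabel : (p : Prog Γ σ) → Fintype p.Label
  | .load _ => inferInstanceAs (Fintype Unit)
  | .push _ _ => inferInstanceAs (Fintype Unit)
  | .pop _ _ => inferInstanceAs (Fintype Unit)
  | .seq p q =>
    haveI := p.fintypeLabel
    haveI := q.fintypeLabel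
    inferInstanceAs (Fintype (p.Label ⊕ q.Label))
  | .ite _ p q =>
    haveI := p.fintypeLabel
    haveI := q.fintypeLabel
    inferInstanceAs (Fintype (Option (p.Label ⊕ q.Label)))
  | .while _ p =>
    haveI := p.fintypeLabel
    inferInstanceAs (Fintype (Option p.Label))

/-- The label at which the compiled program starts. -/
def Prog.entry : (p : Prog Γ σ) → p.Label
  | .load _ => ()
  | .push _ _ => ()
  | .pop _ _ => ()
  | .seq p _ => Sum.inl p.entry
  | .ite _ _ _ => none
  | .while _ _ => none

/-- The compiled program, with labels embedded by `e` and leaving at the label `x`. -/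
def Prog.compile {Λ : Type} : (p : Prog Γ σ) → (p.Label → Λ) → Λ → p.Label → TM2.Stmt Γ Λ σ
  | .load f, _, x, _ => .load f (.goto fun _ => x)
  | .push k f, _, x, _ => .push k f (.goto fun _ => x)
  | .pop k f, _, x, _ => .pop k f (.goto fun _ => x)
  | .seq p q, e, _, .inl l => p.compile (fun l => e (.inl l)) (e (.inr q.entry)) l
  | .seq _ q, e, x, .inr l => q.compile (fun l => e (.inr l)) x l
  | .ite c p q, e, _, none =>
      .branch c (.goto fun _ => e (some (.inl p.entry))) (.goto fun _ => e (some (.inr q.entry)))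
  | .ite _ p _, e, x, some (.inl l) => p.compile (fun l => e (some (.inl l))) x l
  | .ite _ _ q, e, x, some (.inr l) => q.compile (fun l => e (some (.inr l))) x l
  | .while c p, e, x, none => .branch c (.goto fun _ => e (some p.entry)) (.goto fun _ => x)
  | .while _ p, e, _, some l => p.compile (fun l => e (some l)) (e none) l

/-- `M` reaches the second configuration from the first one within `t` steps. -/
def ReachesIn [DecidableEq K] {Λ : Type} (M : Λ → TM2.Stmt Γ Λ σ) (a b : TM2.Cfg Γ Λ σ) (t : ℕ) :
    Prop :=
  ∃ n ≤ t, (flip bind (TM2.step M))^[n] (some a) = some b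

theorem ReachesIn.trans [DecidableEq K] {Λ : Type} {M : Λ → TM2.Stmt Γ Λ σ}
    {a b c : TM2.Cfg Γ Λ σ} {t t' : ℕ} (h : ReachesIn M a b t) (h' : ReachesIn M b c t') :
    ReachesIn M a c (t + t') := by
  obtain ⟨n, hn, h⟩ := h
  obtain ⟨n', hn', h'⟩ := h'
  exact ⟨n' + n, by omega, by rw [iterate_add_apply, h, h']⟩

theorem ReachesIn.single [DecidableEq K] {Λ : Type} {M : Λ → TM2.Stmt Γ Λ σ}
    {a b : TM2.Cfg Γ Λ σ} (h : TM2.step M a = some b) : ReachesIn M a b 1 :=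
  ⟨1, le_rfl, h⟩

theorem ReachesIn.mono [DecidableEq K] {Λ : Type} {M : Λ → TM2.Stmt Γ Λ σ}
    {a b : TM2.Cfg Γ Λ σ} {t t' : ℕ} (h : ReachesIn M a b t) (ht : t ≤ t') : ReachesIn M a b t' :=
  let ⟨n, hn, h⟩ := h; ⟨n, hn.trans ht, h⟩

/-- Induction on the execution: a basic command or a test is one step of the machine, and sequencing
is free. The embedding `e` and the exit `x` stay general in the induction because the labels of a
subprogram sit inside those of the whole, and because the body of a loop exits to the test of that
loop. -/
theorem Exec.reachesIn [DecidableEq K] {p : Prog Γ σ} {v v' : σ} {S S' : ∀ k, List (Γ k)} {t : ℕ}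
    (h : Exec p v S v' S' t) : ∀ {Λ : Type} {M : Λ → TM2.Stmt Γ Λ σ} {e : p.Label → Λ} {x : Λ},
    (∀ l, M (e l) = p.compile e x l) → ReachesIn M ⟨some (e p.entry), v, S⟩ ⟨some x, v', S'⟩ t := by
  induction h with
  | load | push | pop =>
    intro Λ M e x hM
    apply ReachesIn.single
    rw [TM2.step, hM]
    simp [Prog.compile]
  | seq _ _ ih ih' =>
    intro Λ M e x hM
    exact (ih (e := fun l => e (.inl l)) fun l => hM (.inl l)).trans
      (ih' (e := fun l => e (.inr l)) fun l => hM (.inr l))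
  | ite_true hc _ ih =>
    intro Λ M e x hM
    refine ((ReachesIn.single ?_).trans
      (ih (e := fun l => e (some (.inl l))) fun l => hM (some (.inl l)))).mono (by omega)
    rw [TM2.step, hM]
    simp [Prog.compile, Prog.entry, hc]
  | ite_false hc _ ih =>
    intro Λ M e x hM
    refine ((ReachesIn.single ?_).trans
      (ih (e := fun l => e (some (.inr l))) fun l => hM (some (.inr l)))).mono (by omega)
    rw [TM2.step, hM]
    simp [Prog.compile, Prog.entry, hc]
  | while_true hc _ _ ih ih' =>
    intro Λ M e x hM
    refine ((ReachesIn.single ?_).trans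
      ((ih (e := fun l => e (some l)) fun l => hM (some l)).trans (ih' hM))).mono (by omega)
    rw [TM2.step, hM]
    simp [Prog.compile, Prog.entry, hc]
  | while_false hc =>
    intro Λ M e x hM
    apply ReachesIn.single
    rw [TM2.step, hM]
    simp [Prog.compile, Prog.entry, hc]
  | mono _ ht ih =>
    intro Λ M e x hM
    exact (ih hM).mono ht

/-- The Turing machine that runs a structured program and halts. -/
noncomputable def Prog.machine [DecidableEq K] [Fintype K] [Fintype σ] (p : Prog Γ σ) (v : σ)
    (k₀ k₁ : K) [Fintype (Γ k₀)] : FinTM2 where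
  k₀ := k₀
  k₁ := k₁
  Γ := Γ
  Λ := Option p.Label
  main := some p.entry
  σ := σ
  initialState := v
  m := fun l => match l with
    | none => .halt
    | some l => p.compile some none l

end StackProgram

namespace StackProgram

open Turing Function

/-! ### Binary trees as data, and polynomial-time functions on them -/

/-- Binary trees, the data on which polynomial-time functions operate. -/
inductive Data : Type
  | leaf
  | node (l r : Data)
  deriving DecidableEq

namespace Data

/-- The prefix code of a tree. -/
def code : Data → List Bool
  | leaf => [false]
  | node l r => true :: (l.code ++ r.code)

/-- The number of nodes of a tree. -/
def size : Data → ℕ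
  | leaf => 1
  | node l r => l.size + r.size + 1

theorem length_code : (d : Data) → d.code.length = d.size
  | leaf => rfl
  | node l r => by simp [code, size, length_code l, length_code r]

theorem size_pos (d : Data) : 0 < d.size := by cases d <;> simp [size]

/-- The length of the right spine. -/
def spine : Data → ℕ
  | leaf => 0
  | node _ r => r.spine + 1

theorem spine_lt_size : (d : Data) → d.spine < d.size
  | leaf => by simp [spine, size]
  | node l r => by have := spine_lt_size r; simp [spine, size]; omega

/-- The left subtree. -/
def fst : Data → Data
  | leaf => leaf
  | node l _ => l

/-- The right subtree. -/
def snd : Data → Data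
  | leaf => leaf
  | node _ r => r

/-- Whether the tree is not a single leaf. -/
def isNode : Data → Bool
  | leaf => false
  | node _ _ => true

theorem code_eq_cons (d : Data) : ∃ l, d.code = d.isNode :: l := by
  cases d <;> simp [code, isNode]

end Data

/-- The stacks of the machine: a stack of trees, three auxiliary stacks, and two for the input. -/
inductive Stack : Type
  | main | aux | buf | cnt | inp | tmp
  deriving DecidableEq

instance : Fintype Stack :=
  ⟨{.main, .aux, .buf, .cnt, .inp, .tmp}, fun k => by cases k <;> simp⟩

/-- The stack alphabets, for input alphabet `A`. -/
abbrev Alphabet (A : Type) : Stack → Type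
  | .main => Bool
  | .aux => Bool
  | .buf => Bool
  | .cnt => Bool
  | .inp => A
  | .tmp => A

/-- The register: a Boolean just read, a stored Boolean, and an input symbol just read. -/
abbrev Register (A : Type) : Type := Option Bool × Bool × Option A

variable {A : Type}

/-- Stack contents. -/
def mem (m a b n : List Bool) (i t : List A) : ∀ k, List (Alphabet A k)
  | .main => m
  | .aux => a
  | .buf => b
  | .cnt => n
  | .inp => i
  | .tmp => t

section mem
variable (m a b n x : List Bool) (i t y : List A)

@[simp] theorem mem_main : mem m a b n i t .main = m := rfl
@[simp] theorem mem_aux : mem m a b n i t .aux = a := rfl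
@[simp] theorem mem_buf : mem m a b n i t .buf = b := rfl
@[simp] theorem mem_cnt : mem m a b n i t .cnt = n := rfl
@[simp] theorem mem_inp : mem m a b n i t .inp = i := rfl
@[simp] theorem mem_tmp : mem m a b n i t .tmp = t := rfl

@[simp] theorem update_main : update (mem m a b n i t) .main x = mem x a b n i t := by
  funext k; cases k <;> rfl
@[simp] theorem update_aux : update (mem m a b n i t) .aux x = mem m x b n i t := by
  funext k; cases k <;> rfl
@[simp] theorem update_buf : update (mem m a b n i t) .buf x = mem m a x n i t := by
  funext k; cases k <;> rfl
@[simp] theorem update_cnt : update (mem m a b n i t) .cnt x = mem m a b x i t := by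
  funext k; cases k <;> rfl
@[simp] theorem update_inp : update (mem m a b n i t) .inp y = mem m a b n y t := by
  funext k; cases k <;> rfl
@[simp] theorem update_tmp : update (mem m a b n i t) .tmp y = mem m a b n i y := by
  funext k; cases k <;> rfl

end mem

/-- Programs of the machine. -/
abbrev Program (A : Type) : Type := Prog (Alphabet A) (Register A)

/-! ### Elementary loops that move words between stacks -/

namespace Program

/-- Pop a Boolean from `main`, `aux`, `buf` or `cnt` into the register. -/
def popMain : Program A := .pop .main fun v x => (x, v.2)
def popAux : Program A := .pop .aux fun v x => (x, v.2)
def popBuf : Program A := .pop .buf fun v x => (x, v.2)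
def popCnt : Program A := .pop .cnt fun v x => (x, v.2)

/-- Push the Boolean in the register. -/
def pushMain : Program A := .push .main fun v => v.1.getD false
def pushAux : Program A := .push .aux fun v => v.1.getD false
def pushBuf : Program A := .push .buf fun v => v.1.getD false

/-- Push `true` on `cnt`. -/
def pushCnt : Program A := .push .cnt fun _ => true

section basic
variable {w : Register A} {m a b n : List Bool} {i t : List A}

theorem exec_popMain : Exec popMain w (mem m a b n i t) (m.head?, w.2) (mem m.tail a b n i t) 1 := by
  simpa [popMain] using Exec.pop (k := .main) (f := fun (v : Register A) x => (x, v.2)) (v := w) (S := mem m a b n i t)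

theorem exec_pushMain : Exec pushMain w (mem m a b n i t) w (mem (w.1.getD false :: m) a b n i t) 1 := by
  simpa [pushMain] using Exec.push (k := .main) (f := fun v : Register A => v.1.getD false) (v := w)
    (S := mem m a b n i t)

theorem exec_popAux : Exec popAux w (mem m a b n i t) (a.head?, w.2) (mem m a.tail b n i t) 1 := by
  simpa [popAux] using Exec.pop (k := .aux) (f := fun (v : Register A) x => (x, v.2)) (v := w) (S := mem m a b n i t)

theorem exec_pushAux : Exec pushAux w (mem m a b n i t) w (mem m (w.1.getD false :: a) b n i t) 1 := by
  simpa [pushAux] using Exec.push (k := .aux) (f := fun v : Register A => v.1.getD false) (v := w)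
    (S := mem m a b n i t)

theorem exec_popBuf : Exec popBuf w (mem m a b n i t) (b.head?, w.2) (mem m a b.tail n i t) 1 := by
  simpa [popBuf] using Exec.pop (k := .buf) (f := fun (v : Register A) x => (x, v.2)) (v := w) (S := mem m a b n i t)

theorem exec_pushBuf : Exec pushBuf w (mem m a b n i t) w (mem m a (w.1.getD false :: b) n i t) 1 := by
  simpa [pushBuf] using Exec.push (k := .buf) (f := fun v : Register A => v.1.getD false) (v := w)
    (S := mem m a b n i t)

theorem exec_popCnt : Exec popCnt w (mem m a b n i t) (n.head?, w.2) (mem m a b n.tail i t) 1 := by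
  simpa [popCnt] using Exec.pop (k := .cnt) (f := fun (v : Register A) x => (x, v.2)) (v := w) (S := mem m a b n i t)

theorem exec_pushCnt : Exec pushCnt w (mem m a b n i t) w (mem m a b (true :: n) i t) 1 := by
  simpa [pushCnt] using Exec.push (k := .cnt) (f := fun _ : Register A => true) (v := w)
    (S := mem m a b n i t)

end basic

/-- Repeat while the last pop was successful. -/
def whileSome (p : Program A) : Program A := .while (fun v => v.1.isSome) p

/-- Empty the stack `aux`. -/
def clearAux : Program A := .seq popAux (whileSome popAux)

/-- Move `aux` to `main`, reversing it. -/
def auxToMain : Program A := .seq popAux (whileSome (.seq pushMain popAux))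

/-- Move `buf` to `aux`, reversing it. -/
def bufToAux : Program A := .seq popBuf (whileSome (.seq pushAux popBuf))

/-- Move `aux` to `buf`, reversing it. -/
def auxToBuf : Program A := .seq popAux (whileSome (.seq pushBuf popAux))

/-- Move `aux` to `main` and `buf`, reversing it. -/
def auxToBoth : Program A := .seq popAux (whileSome (.seq pushMain (.seq pushBuf popAux)))

/-- Move the code of a tree from `main` to `aux`, reversing it. -/
def takeLoop : Program A :=
  whileSome (.seq popMain (.seq pushAux (.seq
    (.ite (fun v => v.1 = some true)
      (.seq pushCnt pushCnt) (.load id))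
    popCnt)))

/-- Move the topmost tree from `main` to `aux`, reversing its code. -/
def take : Program A := .seq (.load fun v => (some true, v.2)) takeLoop

section loops
variable {v : Bool × Option A} {w : Register A} {m a b n : List Bool} {i t : List A}

theorem exec_clearAux : Exec clearAux w (mem m a b n i t) (none, w.2) (mem m [] b n i t)
    (2 * a.length + 2) := by
  -- When the test of the loop is reached, the top symbol has already been popped into the register.
  -- Hence the invariant has `a.head?` in the register and `a.tail` on the stack, with `none` as the
  -- signal of exhaustion. The loops below follow the same pattern.
  have loop : ∀ a : List Bool, Exec (whileSome popAux) (a.head?, w.2) (mem m a.tail b n i t)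
      (none, w.2) (mem m [] b n i t) (2 * a.length + 1) := by
    intro a
    induction a with
    | nil => exact .mono (.while_false rfl) (by simp)
    | cons x a ih =>
      exact .mono (.while_true rfl exec_popAux ih) (by simp; omega)
  exact .mono (.seq exec_popAux (loop a)) (by omega)

theorem exec_auxToMain : Exec auxToMain w (mem m a b n i t) (none, w.2)
    (mem (a.reverse ++ m) [] b n i t) (3 * a.length + 2) := by
  have loop : ∀ a m : List Bool, Exec (whileSome (.seq pushMain popAux)) (a.head?, w.2)
      (mem m a.tail b n i t) (none, w.2) (mem (a.reverse ++ m) [] b n i t) (3 * a.length + 1) := by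
    intro a
    induction a with
    | nil => exact fun m => .mono (.while_false rfl) (by simp)
    | cons x a ih =>
      intro m
      have := ih (x :: m)
      simp only [List.reverse_cons, List.append_assoc, List.singleton_append]
      exact .mono (.while_true rfl (.seq exec_pushMain
        exec_popAux) this) (by simp; omega)
  exact .mono (.seq exec_popAux (loop a m)) (by omega)

theorem exec_bufToAux : Exec bufToAux w (mem m a b n i t) (none, w.2)
    (mem m (b.reverse ++ a) [] n i t) (3 * b.length + 2) := by
  have loop : ∀ b a : List Bool, Exec (whileSome (.seq pushAux popBuf)) (b.head?, w.2)
      (mem m a b.tail n i t) (none, w.2) (mem m (b.reverse ++ a) [] n i t) (3 * b.length + 1) := by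
    intro b
    induction b with
    | nil => exact fun m => .mono (.while_false rfl) (by simp)
    | cons x b ih =>
      intro a
      have := ih (x :: a)
      simp only [List.reverse_cons, List.append_assoc, List.singleton_append]
      exact .mono (.while_true rfl (.seq exec_pushAux
        exec_popBuf) this) (by simp; omega)
  exact .mono (.seq exec_popBuf (loop b a)) (by omega)

theorem exec_auxToBuf : Exec auxToBuf w (mem m a b n i t) (none, w.2)
    (mem m [] (a.reverse ++ b) n i t) (3 * a.length + 2) := by
  have loop : ∀ a b : List Bool, Exec (whileSome (.seq pushBuf popAux)) (a.head?, w.2)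
      (mem m a.tail b n i t) (none, w.2) (mem m [] (a.reverse ++ b) n i t) (3 * a.length + 1) := by
    intro a
    induction a with
    | nil => exact fun m => .mono (.while_false rfl) (by simp)
    | cons x a ih =>
      intro b
      have := ih (x :: b)
      simp only [List.reverse_cons, List.append_assoc, List.singleton_append]
      exact .mono (.while_true rfl (.seq exec_pushBuf
        exec_popAux) this) (by simp; omega)
  exact .mono (.seq exec_popAux (loop a b)) (by omega)

theorem exec_auxToBoth : Exec auxToBoth w (mem m a b n i t) (none, w.2)
    (mem (a.reverse ++ m) [] (a.reverse ++ b) n i t) (4 * a.length + 2) := by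
  have loop : ∀ a m b : List Bool, Exec (whileSome (.seq pushMain (.seq pushBuf popAux)))
      (a.head?, w.2) (mem m a.tail b n i t) (none, w.2)
      (mem (a.reverse ++ m) [] (a.reverse ++ b) n i t) (4 * a.length + 1) := by
    intro a
    induction a with
    | nil => exact fun m b => .mono (.while_false rfl) (by simp)
    | cons x a ih =>
      intro m b
      have := ih (x :: m) (x :: b)
      simp only [List.reverse_cons, List.append_assoc, List.singleton_append]
      exact .mono (.while_true rfl (.seq exec_pushMain
        (.seq exec_pushBuf exec_popAux)) this) (by simp; omega)
  exact .mono (.seq exec_popAux (loop a m b)) (by omega)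

/-- The register and the stack `cnt` together count the trees still to be moved: a node symbol
replaces one pending tree by two, a leaf symbol settles one. The statement is in continuation form,
extending a given run `h`, because in the node case the loop passes from the left to the right
subtree without being left. -/
theorem exec_takeLoop (d : Data) : ∀ {m a n w' S' T x},
    Exec takeLoop (n.head?, v) (mem m (d.code.reverse ++ a) b n.tail i t) w' S' T →
    Exec takeLoop (some x, v) (mem (d.code ++ m) a b n i t) w' S' (T + 8 * d.size) := by
  induction d with
  | leaf =>
    intro m a n w' S' T x h
    refine .mono (.while_true rfl (.seq exec_popMain (.seq exec_pushAux
      (.seq (.ite_false (by simp [Data.code]) .load) exec_popCnt))) h) ?_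
    simp [Data.size]; omega
  | node l r ihl ihr =>
    intro m a n w' S' T x h
    have h2 := ihr (m := m) (a := l.code.reverse ++ true :: a) (n := n) (w' := w') (S' := S')
      (T := T) (x := true) (by simpa [Data.code] using h)
    have h1 := ihl (m := r.code ++ m) (a := true :: a) (n := true :: n) (x := true) h2
    rw [← List.append_assoc] at h1
    exact .mono (.while_true rfl (.seq exec_popMain (.seq exec_pushAux
      (.seq (.ite_true (by simp [Data.code]) (.seq exec_pushCnt exec_pushCnt)) exec_popCnt))) h1)
      (by simp [Data.size]; omega)

theorem exec_take (d : Data) : Exec take w (mem (d.code ++ m) a b [] i t) (none, w.2)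
    (mem m (d.code.reverse ++ a) b [] i t) (8 * d.size + 2) :=
  .mono (.seq .load (exec_takeLoop d (n := []) (.while_false rfl))) (by omega)

end loops

end Program

end StackProgram

/-! ### Programs acting on the trees at the top of the main stack -/

namespace StackProgram

open Turing Function

theorem eval_le_eval_of_le (p : Polynomial ℕ) {m n : ℕ} (h : m ≤ n) : p.eval m ≤ p.eval n := by
  rw [Polynomial.eval_eq_sum_range, Polynomial.eval_eq_sum_range]
  gcongr

namespace Program

variable {A : Type}

/-- `p` turns the contents `m` of the main stack into `m'` within `t` steps; the other stacks are
empty before and after. -/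
def Runs (p : Program A) (m m' : List Bool) (t : ℕ) : Prop :=
  ∀ w, ∃ w', Exec p w (mem m [] [] [] [] []) w' (mem m' [] [] [] [] []) t

theorem Runs.seq {p q : Program A} {m m' m'' : List Bool} {t t' : ℕ} (h : Runs p m m' t)
    (h' : Runs q m' m'' t') : Runs (.seq p q) m m'' (t + t') := fun w =>
  let ⟨w', e⟩ := h w
  let ⟨w'', e'⟩ := h' w'
  ⟨w'', .seq e e'⟩

theorem Runs.mono {p : Program A} {m m' : List Bool} {t t' : ℕ} (h : Runs p m m' t) (ht : t ≤ t') :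
    Runs p m m' t' := fun w => let ⟨w', e⟩ := h w; ⟨w', .mono e ht⟩

/-- Do nothing. -/
def skip : Program A := .load id

theorem runs_skip {m : List Bool} : Runs (A := A) skip m m 1 := fun _ => ⟨_, .load⟩

/-- Push a fixed Boolean on the main stack. -/
def pushBit (b : Bool) : Program A := .push .main fun _ => b

theorem runs_pushBit {b : Bool} {m : List Bool} : Runs (A := A) (pushBit b) m (b :: m) 1 :=
  fun w => ⟨w, by
    simpa [pushBit] using Exec.push (k := Stack.main) (f := fun _ : Register A => b) (v := w)
      (S := mem m [] [] [] [] [])⟩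

/-- Remove the top tree. -/
def drop : Program A := .seq take clearAux

theorem exec_drop {d : Data} {m : List Bool} {w : Register A} :
    Exec drop w (mem (d.code ++ m) [] [] [] [] []) (none, w.2) (mem m [] [] [] [] [])
      (10 * d.size + 4) :=
  .mono (.seq (exec_take d) exec_clearAux) (by simp [d.length_code]; omega)

theorem runs_drop {d : Data} {m : List Bool} :
    Runs (A := A) drop (d.code ++ m) m (10 * d.size + 4) := fun _ => ⟨_, exec_drop⟩

/-- Store the top symbol. -/
def storeTag : Program A :=
  .seq (.pop .main fun v x => (v.1, x.getD false, v.2.2)) (.push .main fun v => v.2.1)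

theorem exec_storeTag {b : Bool} {m : List Bool} {w : Register A} :
    Exec storeTag w (mem (b :: m) [] [] [] [] []) (w.1, b, w.2.2) (mem (b :: m) [] [] [] [] []) 2 := by
  have h1 := Exec.pop (k := Stack.main)
    (f := fun (v : Register A) (x : Option Bool) => ((v.1, x.getD false, v.2.2) : Register A))
    (Γ := Alphabet A) (v := w) (S := mem (b :: m) [] [] [] [] [])
  have h2 := Exec.push (k := Stack.main) (Γ := Alphabet A)
    (f := fun v : Register A => v.2.1) (v := (w.1, b, w.2.2))
    (S := mem m [] [] [] [] [])
  simp only [update_main, mem_main, List.head?_cons, List.tail_cons, Option.getD_some] at h1 h2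
  exact .seq h1 h2

/-- Remove the top tree and store whether it is a node. -/
def dropTag : Program A := .seq storeTag drop

/-- The tag is kept in the second component of the register, which the moves between stacks do not
touch. It therefore survives the removal of the tree and can steer a later branch. -/
theorem exec_dropTag {d : Data} {m : List Bool} {w : Register A} :
    Exec dropTag w (mem (d.code ++ m) [] [] [] [] []) (none, d.isNode, w.2.2)
      (mem m [] [] [] [] []) (10 * d.size + 6) := by
  obtain ⟨l, hl⟩ := d.code_eq_cons
  have h := exec_drop (d := d) (m := m) (w := (w.1, d.isNode, w.2.2))
  refine .mono (.seq (S' := mem (d.code ++ m) [] [] [] [] []) (t := 2) ?_ h) (by omega)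
  rw [hl]
  exact exec_storeTag

/-- Duplicate the top tree. -/
def dup : Program A := .seq take (.seq auxToBoth (.seq bufToAux auxToMain))

theorem runs_dup {d : Data} {m : List Bool} :
    Runs (A := A) dup (d.code ++ m) (d.code ++ (d.code ++ m)) (18 * d.size + 8) := fun w => by
  have h := Exec.seq (exec_take (w := w) (m := m) (a := []) (b := []) (i := []) (t := []) d)
    (.seq exec_auxToBoth (.seq exec_bufToAux exec_auxToMain))
  simp only [List.append_nil, List.reverse_reverse, List.length_reverse, d.length_code] at h
  exact ⟨_, .mono h (by omega)⟩

/-- Exchange the two top trees. -/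
def swap : Program A := .seq take (.seq auxToBuf (.seq take (.seq bufToAux auxToMain)))

theorem runs_swap {c d : Data} {m : List Bool} :
    Runs (A := A) swap (c.code ++ (d.code ++ m)) (d.code ++ (c.code ++ m))
      (17 * c.size + 11 * d.size + 10) := fun w => by
  have h := Exec.seq (exec_take (w := w) (m := d.code ++ m) (a := []) (b := []) (i := []) (t := [])
    c) (.seq exec_auxToBuf (.seq (exec_take (m := m) d) (.seq exec_bufToAux exec_auxToMain)))
  simp only [List.append_nil, List.reverse_reverse, List.reverse_append, List.length_append,
    List.length_reverse, c.length_code, d.length_code, List.append_assoc] at h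
  exact ⟨_, .mono h (by omega)⟩

/-- Replace the top tree by its left subtree. -/
def toFst : Program A :=
  .seq popMain (.ite (fun v => v.1 = some true) (.seq swap drop) (pushBit false))

theorem runs_toFst {d : Data} {m : List Bool} :
    Runs (A := A) toFst (d.code ++ m) (d.fst.code ++ m) (30 * d.size + 20) := fun w => by
  cases d with
  | leaf =>
    obtain ⟨w', h⟩ := runs_pushBit (A := A) (b := false) (m := m) (some false, w.2)
    exact ⟨w', .mono (.seq exec_popMain (.ite_false (by simp [Data.code]) h)) (by omega)⟩
  | node l r =>
    obtain ⟨w', h⟩ := (runs_swap (A := A) (c := l) (d := r) (m := m)).seq runs_drop (some true, w.2)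
    rw [← List.append_assoc] at h
    exact ⟨w', .mono (.seq exec_popMain (.ite_true (by simp [Data.code]) h))
      (by simp only [Data.size]; omega)⟩

/-- Replace the top tree by its right subtree. -/
def toSnd : Program A :=
  .seq popMain (.ite (fun v => v.1 = some true) drop (pushBit false))

theorem runs_toSnd {d : Data} {m : List Bool} :
    Runs (A := A) toSnd (d.code ++ m) (d.snd.code ++ m) (30 * d.size + 20) := fun w => by
  cases d with
  | leaf =>
    obtain ⟨w', h⟩ := runs_pushBit (A := A) (b := false) (m := m) (some false, w.2)
    exact ⟨w', .mono (.seq exec_popMain (.ite_false (by simp [Data.code]) h)) (by omega)⟩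
  | node l r =>
    obtain ⟨w', h⟩ := runs_drop (A := A) (d := l) (m := r.code ++ m) (some true, w.2)
    rw [← List.append_assoc] at h
    exact ⟨w', .mono (.seq exec_popMain (.ite_true (by simp [Data.code]) h))
      (by simp only [Data.size]; omega)⟩

/-- The loop of `iterate`; the tag of the counter is in the register. -/
def iterateLoop (p : Program A) : Program A :=
  .while (fun v => v.1 = some true) (.seq (.seq drop (.seq swap (.seq p swap))) popMain)

/-- Run `p` on the right subtree as often as the left one has nodes on its right spine. -/
def iterate (p : Program A) : Program A :=
  .seq popMain (.ite (fun v => v.1 = some true) (.seq popMain (iterateLoop p)) (pushBit false))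

/-- The tag of the counter `f` is already in the register, so only `f.code.tail` is on the stack. A
round removes the left subtree of the counter, exchanges the rest with the argument, runs `p` and
exchanges back. The arguments are given as a sequence `X` so that the induction on `f` can shift it
by one; `N` makes the cost of the exchanges uniform. -/
theorem exec_iterateLoop {p : Program A} {T N : ℕ} : ∀ {f : Data} {X : ℕ → Data}
    (_ : ∀ j < f.spine, ∀ m, Runs p ((X j).code ++ m) ((X (j + 1)).code ++ m) T)
    (_ : ∀ j ≤ f.spine, (X j).size ≤ N) {m : List Bool} (w : Register A),
    ∃ w', Exec (iterateLoop p) (some f.isNode, w.2)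
      (mem (f.code.tail ++ ((X 0).code ++ m)) [] [] [] [] []) w'
      (mem ((X f.spine).code ++ m) [] [] [] [] [])
      (f.spine * (T + 30 * N + 40 * f.size + 40) + 1) := by
  intro f
  induction f with
  | leaf =>
    intro X _ _ m w
    exact ⟨_, .mono (.while_false (by simp [Data.isNode])) (by omega)⟩
  | node e f _ ih =>
    intro X hp hN m w
    obtain ⟨w₁, h₁⟩ := ((runs_drop (A := A) (d := e) (m := f.code ++ ((X 0).code ++ m))).seq
      (runs_swap.seq ((hp 0 (by simp [Data.spine]) _).seq runs_swap))) (some true, w.2)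
    obtain ⟨w₂, h₂⟩ := ih (X := fun j => X (j + 1))
      (fun j hj m => hp (j + 1) (by simp [Data.spine]; omega) m)
      (fun j hj => hN (j + 1) (by simp [Data.spine]; omega)) (m := m) w₁
    have h0 := hN 0 (by omega)
    have h1 := hN 1 (by simp [Data.spine])
    simp only [zero_add] at h1 h₁
    obtain ⟨l, hl⟩ := f.code_eq_cons
    rw [← List.append_assoc] at h₁
    have h₃ := exec_popMain (w := w₁) (m := f.code ++ ((X 1).code ++ m)) (a := []) (b := [])
      (n := []) (i := []) (t := [])
    refine ⟨w₂, .mono (.while_true (t' := f.spine * (T + 30 * N + 40 * f.size + 40) + 1)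
      (by simp [Data.isNode]) (.seq h₁ h₃) ?_) ?_⟩
    · simp only [hl, List.cons_append, List.head?_cons, List.tail_cons, Data.spine] at h₂ ⊢
      exact h₂
    · have h : T + 30 * N + 40 * f.size + 40 ≤ T + 30 * N + 40 * (e.size + f.size + 1) + 40 := by
        omega
      have := Nat.mul_le_mul_left f.spine h
      simp only [Data.size, Data.spine]
      linarith

theorem runs_iterate {p : Program A} {T N : ℕ} {f : Data} {X : ℕ → Data}
    (hp : ∀ j < f.spine, ∀ m, Runs p ((X j).code ++ m) ((X (j + 1)).code ++ m) T)
    (hN : ∀ j ≤ f.spine, (X j).size ≤ N) {m : List Bool} :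
    Runs (iterate p) ((Data.node f (X 0)).code ++ m) ((X f.spine).code ++ m)
      (f.spine * (T + 30 * N + 40 * f.size + 40) + 4) := fun w => by
  obtain ⟨l, hl⟩ := f.code_eq_cons
  obtain ⟨w', h⟩ := exec_iterateLoop hp hN (m := m) w
  have h₃ := exec_popMain (w := ((some true, w.2) : Register A)) (m := f.code ++ ((X 0).code ++ m))
    (a := []) (b := []) (n := []) (i := []) (t := [])
  rw [show (f.code ++ ((X 0).code ++ m)).head? = some f.isNode by simp [hl],
    show (f.code ++ ((X 0).code ++ m)).tail = f.code.tail ++ ((X 0).code ++ m) by simp [hl]] at h₃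
  have h₄ := h₃.seq h
  rw [← List.append_assoc] at h₄
  exact ⟨w', .mono (.seq exec_popMain (.ite_true (by simp [Data.code]) h₄)) (by omega)⟩

end Program

/-! ### Polynomial-time functions -/

/-- Types whose elements are coded as trees. -/
class Enc (α : Type) where
  /-- The tree that codes an element. -/
  enc : α → Data

/-- The size of the code of an element. -/
def esize {α : Type} [Enc α] (a : α) : ℕ := (Enc.enc a).size

instance : Enc Data := ⟨id⟩

instance {α β : Type} [Enc α] [Enc β] : Enc (α × β) := ⟨fun p => .node (Enc.enc p.1) (Enc.enc p.2)⟩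

/-- A list of trees, as a tree. -/
def Data.ofList : List Data → Data
  | [] => .leaf
  | d :: l => .node d (ofList l)

/-- A Boolean, as a tree. -/
def Data.ofBool : Bool → Data
  | false => .leaf
  | true => .node .leaf .leaf

instance {α : Type} [Enc α] : Enc (List α) := ⟨fun l => Data.ofList (l.map Enc.enc)⟩

instance : Enc Bool := ⟨Data.ofBool⟩

theorem spine_enc_list {α : Type} [Enc α] (l : List α) : (Enc.enc l).spine = l.length := by
  induction l with
  | nil => rfl
  | cons a l ih => simpa [Enc.enc, Data.ofList, Data.spine] using ih

theorem isNode_enc_bool (b : Bool) : (Enc.enc b).isNode = b := by cases b <;> rfl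

theorem esize_pos {α : Type} [Enc α] (a : α) : 0 < esize a := Data.size_pos _

@[simp] theorem esize_prod {α β : Type} [Enc α] [Enc β] (p : α × β) :
    esize p = esize p.1 + esize p.2 + 1 := rfl

@[simp] theorem esize_nil {α : Type} [Enc α] : esize ([] : List α) = 1 := rfl

@[simp] theorem esize_cons {α : Type} [Enc α] (a : α) (l : List α) :
    esize (a :: l) = esize a + esize l + 1 := rfl

theorem length_lt_esize {α : Type} [Enc α] (l : List α) : l.length < esize l := by
  rw [← spine_enc_list]; exact Data.spine_lt_size _

/-- `f` is computed in polynomial time, on top of a stack of trees. -/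
@[fun_prop]
def PolyFun {α β : Type} [Enc α] [Enc β] (f : α → β) : Prop :=
  ∀ A : Type, ∃ (p : Program A) (q : Polynomial ℕ), ∀ a,
    esize (f a) ≤ q.eval (esize a) ∧
      ∀ m, p.Runs ((Enc.enc a).code ++ m) ((Enc.enc (f a)).code ++ m) (q.eval (esize a))

namespace PolyFun

variable {α β γ δ : Type} [Enc α] [Enc β] [Enc γ] [Enc δ]

theorem of_enc_eq {f : α → β} (h : ∀ a, Enc.enc (f a) = Enc.enc a) : PolyFun f := fun _ =>
  ⟨Program.skip, .X, fun a => ⟨by simp [esize, h], fun _ => by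
    rw [h]; simpa using Program.runs_skip.mono (by have := esize_pos a; omega)⟩⟩

/-- `PolyFun` sees a function only through the codes of its values. Many closure properties below
follow by exhibiting a known function with the same codes, possibly into another type. -/
theorem congr_enc {f : α → β} (hf : PolyFun f) {g : α → γ} (h : ∀ a, Enc.enc (g a) = Enc.enc (f a)) :
    PolyFun g := fun A => by
  obtain ⟨p, q, hp⟩ := hf A
  refine ⟨p, q, fun a => ?_⟩
  have := hp a
  unfold esize at *
  rwa [h]

@[fun_prop]
protected theorem id : PolyFun fun a : α => a := of_enc_eq fun _ => rfl

theorem leaf : PolyFun fun _ : α => Data.leaf := fun _ =>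
  ⟨.seq Program.drop (Program.pushBit false), 10 * .X + 5, fun d => ⟨by
    simp [Data.size, esize, Enc.enc], fun _ => by
    exact (Program.runs_drop.seq Program.runs_pushBit).mono (by simp [esize])⟩⟩

theorem dataFst : PolyFun Data.fst := fun _ =>
  ⟨Program.toFst, 30 * .X + 20, fun d => ⟨by
    cases d <;> simp [Data.size, Data.fst, esize, Enc.enc]; omega, fun _ => by
    exact Program.runs_toFst.mono (by simp [esize, Enc.enc])⟩⟩

theorem dataSnd : PolyFun Data.snd := fun _ =>
  ⟨Program.toSnd, 30 * .X + 20, fun d => ⟨by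
    cases d <;> simp [Data.size, Data.snd, esize, Enc.enc]; omega, fun _ => by
    exact Program.runs_toSnd.mono (by simp [esize, Enc.enc])⟩⟩

-- The size bound in `PolyFun` is needed here: the time of `g` is a polynomial in the size of `f a`,
-- which has to be bounded in terms of `a`. Polynomials over `ℕ` are monotone, so the bounds
-- compose.
@[fun_prop]
theorem comp {g : β → γ} {f : α → β} (hg : PolyFun g) (hf : PolyFun f) :
    PolyFun fun a => g (f a) := fun A => by
  obtain ⟨p, P, hp⟩ := hf A
  obtain ⟨q, Q, hq⟩ := hg A
  refine ⟨.seq p q, P + Q.comp P, fun d => ⟨?_, fun m => ?_⟩⟩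
  · have := eval_le_eval_of_le Q (hp d).1
    have := (hq (f d)).1
    simp only [Polynomial.eval_add, Polynomial.eval_comp]
    omega
  · have := eval_le_eval_of_le Q (hp d).1
    refine (((hp d).2 m).seq ((hq (f d)).2 m)).mono ?_
    simp only [Polynomial.eval_add, Polynomial.eval_comp]
    omega

@[fun_prop]
theorem prodMk {f : α → β} {g : α → γ} (hf : PolyFun f) (hg : PolyFun g) :
    PolyFun fun a => (f a, g a) := fun A => by
  obtain ⟨p, P, hp⟩ := hf A
  obtain ⟨q, Q, hq⟩ := hg A
  refine ⟨.seq Program.dup (.seq p (.seq Program.swap (.seq q (.seq Program.swap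
    (Program.pushBit true))))), 40 * .X + 30 * P + 30 * Q + 100, fun d => ⟨?_, fun m => ?_⟩⟩
  · have := (hp d).1
    have := (hq d).1
    simp
    omega
  · have h1 := (hp d).1
    have h2 := (hq d).1
    have h := Program.runs_dup.seq (((hp d).2 _).seq (Program.runs_swap.seq (((hq d).2 _).seq
      (Program.runs_swap.seq (Program.runs_pushBit (A := A) (b := true)
        (m := (Enc.enc (f d)).code ++ ((Enc.enc (g d)).code ++ m)))))))
    rw [← List.append_assoc (Enc.enc (f d)).code] at h
    refine Program.Runs.mono h ?_
    simp [esize] at *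
    omega

/-- Subtypes inherit the code, so that either branch of a case distinction may be a function treated
only where its case holds. -/
instance {p : α → Prop} : Enc {a // p a} := ⟨fun a => Enc.enc a.1⟩

/-- A function that is polynomial-time on either part of a case distinction. -/
theorem glue {c : α → γ} {f : α → β} (hc : PolyFun c)
    (hf : PolyFun fun a : {a // (Enc.enc (c a)).isNode = true} => f a.1)
    (hg : PolyFun fun a : {a // (Enc.enc (c a)).isNode = false} => f a.1) : PolyFun f := fun A => by
  obtain ⟨p, P, hp⟩ := hc A
  obtain ⟨q, Q, hq⟩ := hf A
  obtain ⟨r, R, hr⟩ := hg A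
  refine ⟨.seq Program.dup (.seq p (.seq Program.dropTag (.ite (fun v => v.2.1) q r))),
    20 * .X + 20 * P + Q + R + 100, fun d => ?_⟩
  have h1 := (hp d).1
  cases h : (Enc.enc (c d)).isNode with
  | true =>
    have hd := hq ⟨d, h⟩
    refine ⟨?_, fun m w => ?_⟩
    · refine hd.1.trans ?_
      simp [esize, Enc.enc]
      omega
    · obtain ⟨w₁, h₁⟩ := Program.runs_dup (d := Enc.enc d) (m := m) w
      obtain ⟨w₂, h₂⟩ := (hp d).2 ((Enc.enc d).code ++ m) w₁
      have h₃ := Program.exec_dropTag (d := Enc.enc (c d)) (m := (Enc.enc d).code ++ m) (w := w₂)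
      obtain ⟨w₄, h₄⟩ := hd.2 m (none, (Enc.enc (c d)).isNode, w₂.2.2)
      refine ⟨w₄, .mono (.seq h₁ (.seq h₂ (.seq h₃ (.ite_true h h₄)))) ?_⟩
      simp [esize, Enc.enc] at *
      omega
  | false =>
    have hd := hr ⟨d, h⟩
    refine ⟨?_, fun m w => ?_⟩
    · refine hd.1.trans ?_
      simp [esize, Enc.enc]
      omega
    · obtain ⟨w₁, h₁⟩ := Program.runs_dup (d := Enc.enc d) (m := m) w
      obtain ⟨w₂, h₂⟩ := (hp d).2 ((Enc.enc d).code ++ m) w₁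
      have h₃ := Program.exec_dropTag (d := Enc.enc (c d)) (m := (Enc.enc d).code ++ m) (w := w₂)
      obtain ⟨w₄, h₄⟩ := hd.2 m (none, (Enc.enc (c d)).isNode, w₂.2.2)
      refine ⟨w₄, .mono (.seq h₁ (.seq h₂ (.seq h₃ (.ite_false h h₄)))) ?_⟩
      simp [esize, Enc.enc] at *
      omega

/-- `f` is iterated on the value of `h`, as often as `g` has elements. -/
theorem iterate {f : β → β} {g : α → List γ} {h : α → β} (hf : PolyFun f) (hg : PolyFun g)
    (hh : PolyFun h) (B : Polynomial ℕ)
    (hB : ∀ a, ∀ j ≤ (g a).length, esize (f^[j] (h a)) ≤ B.eval (esize a)) :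
    PolyFun fun a => f^[(g a).length] (h a) := fun A => by
  obtain ⟨p, P, hp⟩ := hf A
  obtain ⟨r, R, hr⟩ := hg.prodMk hh A
  obtain ⟨q, Q, hq⟩ := hg A
  refine ⟨.seq r (Program.iterate p), R + B + (Q * (P.comp B + 30 * B + 40 * Q + 40) + 4),
    fun d => ⟨?_, fun m => ?_⟩⟩
  · have := hB d _ le_rfl
    simp only [Polynomial.eval_add]
    omega
  · have hrun : Program.Runs (Program.iterate p)
        ((Data.node (Enc.enc (g d)) (Enc.enc (h d))).code ++ m)
        ((Enc.enc (f^[(g d).length] (h d))).code ++ m) ((g d).length *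
          (P.eval (B.eval (esize d)) + 30 * B.eval (esize d) + 40 * esize (g d) + 40) + 4) := by
      have := Program.runs_iterate (p := p) (T := P.eval (B.eval (esize d)))
        (N := B.eval (esize d)) (m := m) (X := fun j => Enc.enc (f^[j] (h d)))
        (f := Enc.enc (g d))
        (fun j hj m => by
          rw [spine_enc_list] at hj
          have := (hp (f^[j] (h d))).2 m
          rw [← iterate_succ_apply' f j] at this
          exact this.mono (eval_le_eval_of_le P (hB d j hj.le)))
        (fun j hj => hB d j (by rwa [spine_enc_list] at hj))
      simp only [spine_enc_list] at this
      exact this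
    refine Program.Runs.mono (((hr d).2 m).seq hrun) ?_
    have h1 := (hq d).1
    have h2 : (g d).length ≤ Q.eval (esize d) := (length_lt_esize _).le.trans h1
    simp only [Polynomial.eval_add, Polynomial.eval_mul, Polynomial.eval_comp,
      Polynomial.eval_ofNat]
    have : (g d).length *
          (P.eval (B.eval (esize d)) + 30 * B.eval (esize d) + 40 * esize (g d) + 40) ≤
        Q.eval (esize d) *
          (P.eval (B.eval (esize d)) + 30 * B.eval (esize d) + 40 * Q.eval (esize d) + 40) := by
      gcongr
    omega

end PolyFun
end StackProgram

namespace StackProgram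

open Turing Function

/-! ### From polynomial-time functions to Turing machines -/

namespace Program

variable {A : Type}

/-- Pop an input symbol from `inp` or `tmp` into the register. -/
def popInp : Program A := .pop .inp fun v x => (v.1, v.2.1, x)
def popTmp : Program A := .pop .tmp fun v x => (v.1, v.2.1, x)

section
variable {w : Register A} {m a b n : List Bool} {i t : List A}

theorem exec_popInp : Exec popInp w (mem m a b n i t) (w.1, w.2.1, i.head?)
    (mem m a b n i.tail t) 1 := by
  simpa [popInp] using Exec.pop (k := .inp) (f := fun (v : Register A) x => (v.1, v.2.1, x))
    (v := w) (S := mem m a b n i t)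

theorem exec_popTmp : Exec popTmp w (mem m a b n i t) (w.1, w.2.1, t.head?)
    (mem m a b n i t.tail) 1 := by
  simpa [popTmp] using Exec.pop (k := .tmp) (f := fun (v : Register A) x => (v.1, v.2.1, x))
    (v := w) (S := mem m a b n i t)

theorem exec_pushBit {x : Bool} : Exec (pushBit x) w (mem m a b n i t) w
    (mem (x :: m) a b n i t) 1 := by
  simpa [pushBit] using Exec.push (k := .main) (f := fun _ : Register A => x) (v := w)
    (S := mem m a b n i t)

/-- Push a fixed list on the main stack. -/
def pushList : List Bool → Program A
  | [] => skip
  | x :: l => .seq (pushList l) (pushBit x)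

theorem exec_pushList (l : List Bool) : Exec (pushList l) w (mem m a b n i t) w
    (mem (l ++ m) a b n i t) (l.length + 1) := by
  induction l with
  | nil => exact .load
  | cons x l ih => exact .seq ih exec_pushBit

open Classical in
/-- Push the code of the symbol in the register, which is an element of the list. -/
noncomputable def emit (c : A → Data) : List A → Program A
  | [] => skip
  | x :: l => .ite (fun v => v.2.2 = some x) (pushList (c x).code) (emit c l)

theorem exec_emit (c : A → Data) {x : A} {N : ℕ} (hN : ∀ x, (c x).size ≤ N) : ∀ l, x ∈ l →
    w.2.2 = some x → Exec (emit c l) w (mem m a b n i t) w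
      (mem ((c x).code ++ m) a b n i t) (l.length + N + 1) := by
  intro l
  induction l with
  | nil => simp
  | cons y l ih =>
    intro hx hw
    by_cases h : x = y
    · subst h
      refine .mono (.ite_true (by simpa using hw) (exec_pushList _)) ?_
      have := hN x
      simp only [Data.length_code, List.length_cons]
      omega
    · refine .mono (.ite_false (by simpa [hw] using h) (ih (by simpa [h] using hx) hw)) ?_
      simp

/-- Push the symbol in the register on `tmp`. -/
def pushTmp [Inhabited A] : Program A := .push .tmp fun v => v.2.2.getD default

theorem exec_pushTmp [Inhabited A] : Exec pushTmp w (mem m a b n i t) w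
    (mem m a b n i (w.2.2.getD default :: t)) 1 := by
  simpa [pushTmp] using Exec.push (k := .tmp) (f := fun v : Register A => v.2.2.getD default)
    (v := w) (S := mem m a b n i t)

/-- Move the input to `tmp`, reversing it. -/
def reverseInput [Inhabited A] : Program A :=
  .seq popInp (.while (fun v => v.2.2.isSome) (.seq pushTmp popInp))

theorem exec_reverseInput [Inhabited A] : Exec reverseInput w (mem m a b n i t)
    (w.1, w.2.1, none) (mem m a b n [] (i.reverse ++ t)) (3 * i.length + 2) := by
  have loop : ∀ i t : List A, Exec (.while (fun v => v.2.2.isSome) (.seq pushTmp popInp))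
      (w.1, w.2.1, i.head?) (mem m a b n i.tail t) (w.1, w.2.1, none)
      (mem m a b n [] (i.reverse ++ t)) (3 * i.length + 1) := by
    intro i
    induction i with
    | nil => exact fun t => .mono (.while_false rfl) (by simp)
    | cons x i ih =>
      intro t
      have := ih (x :: t)
      simp only [List.reverse_cons, List.append_assoc, List.singleton_append]
      exact .mono (.while_true rfl (.seq exec_pushTmp exec_popInp) this) (by simp; omega)
  exact .mono (.seq exec_popInp (loop i t)) (by omega)

/-- Turn the symbols on `tmp` into a list of trees. -/
noncomputable def loadInput [Fintype A] (c : A → Data) : Program A :=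
  .seq (pushBit false) (.seq popTmp (.while (fun v => v.2.2.isSome)
    (.seq (emit c Finset.univ.toList) (.seq (pushBit true) popTmp))))

theorem exec_loadInput [Fintype A] (c : A → Data) {N : ℕ} (hN : ∀ x, (c x).size ≤ N) :
    Exec (loadInput c) w (mem m a b n i t) (w.1, w.2.1, none)
      (mem ((Data.ofList (t.reverse.map c)).code ++ m) a b n i [])
      ((Fintype.card A + N + 5) * t.length + 3) := by
  have loop : ∀ (t : List A) (l : List A), Exec (.while (fun v => v.2.2.isSome)
      (.seq (emit c Finset.univ.toList) (.seq (pushBit true) popTmp))) (w.1, w.2.1, t.head?)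
      (mem ((Data.ofList (l.map c)).code ++ m) a b n i t.tail) (w.1, w.2.1, none)
      (mem ((Data.ofList ((t.reverse ++ l).map c)).code ++ m) a b n i [])
      ((Fintype.card A + N + 5) * t.length + 1) := by
    intro t
    induction t with
    | nil => exact fun t => .mono (.while_false rfl) (by simp)
    | cons x t ih =>
      intro l
      have := ih (x :: l)
      simp only [List.reverse_cons, List.append_assoc, List.singleton_append]
      simp only [List.map_cons, Data.ofList, Data.code] at this
      simp only [List.cons_append, List.append_assoc] at this
      refine .mono (.while_true rfl (.seq (exec_emit c hN _ (x := x) (by simp) rfl)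
        (.seq exec_pushBit exec_popTmp)) this) ?_
      simp only [Finset.length_toList, Finset.card_univ, List.length_cons]
      linarith
  have hl := loop t []
  rw [List.append_nil] at hl
  exact .mono (.seq exec_pushBit (.seq exec_popTmp hl)) (by omega)

/-- Turn a Boolean coded as a tree into a single symbol. -/
def unloadOutput : Program A :=
  .seq popMain (.ite (fun v => v.1 = some true)
    (.seq popMain (.seq popMain (pushBit true))) (pushBit false))

theorem exec_unloadOutput {x : Bool} : ∃ w', Exec unloadOutput w
    (mem (Data.ofBool x).code a b n i t) w' (mem [x] a b n i t) 6 := by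
  cases x with
  | false => exact ⟨_, .mono (.seq exec_popMain (.ite_false (by simp [Data.ofBool, Data.code])
      exec_pushBit)) (by omega)⟩
  | true => exact ⟨_, .mono (.seq exec_popMain (.ite_true (by simp [Data.ofBool, Data.code])
      (.seq exec_popMain (.seq exec_popMain exec_pushBit)))) (by omega)⟩

end

end Program

theorem Data.size_ofList_map_le {A : Type} {c : A → Data} {N : ℕ} (hN : ∀ x, (c x).size ≤ N)
    (l : List A) : (ofList (l.map c)).size ≤ (N + 1) * l.length + 1 := by
  induction l with
  | nil => simp [ofList, size]
  | cons x l ih =>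
    have := hN x
    simp only [List.map_cons, ofList, size, List.length_cons]
    linarith

open Program in
/-- Predicates on strings computed by polynomial-time functions are decided by
polynomial-time Turing machines. -/
theorem polyTimeDecidable_of_polyFun {α A : Type} [Fintype A] [Inhabited A] [Enc A]
    {enc : α → List A} {f : α → Bool} {F : List A → Bool} (hF : PolyFun F) (h : ∀ a, F (enc a) = f a) :
    Complexity.PolyTimeDecidable enc f := by
  obtain ⟨p, P, hp⟩ := hF A
  obtain ⟨N, hN⟩ : ∃ N, ∀ x : A, (Enc.enc x).size ≤ N :=
    ⟨Finset.univ.sup fun x => esize x, fun x => Finset.le_sup (f := fun x : A => esize x)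
      (Finset.mem_univ x)⟩
  let w₀ : Register A := (none, false, none)
  -- Loading conses symbols in the order in which they leave `tmp`, hence the preliminary reversal.
  -- The final command restores the initial register, as the halting configuration prescribes.
  let prog : Program A := .seq reverseInput (.seq (loadInput Enc.enc) (.seq p (.seq unloadOutput
    (.load fun _ => w₀))))
  let Q : Polynomial ℕ := P.comp ((N + 1 : ℕ) * .X + 1) + (Fintype.card A + N + 8 : ℕ) * .X + 20
  -- One step of the budget is kept for the final `halt`.
  have key : ∀ l : List A, ∀ x : Bool, F l = x →
      Exec prog w₀ (mem [] [] [] [] l []) w₀ (mem [x] [] [] [] [] []) (Q.eval l.length - 1) := by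
    intro l x hx
    have h₁ := exec_reverseInput (w := w₀) (m := []) (a := []) (b := []) (n := []) (i := l) (t := [])
    have h₂ := exec_loadInput (w := w₀) (m := []) (a := []) (b := []) (n := []) (i := [])
      (t := l.reverse ++ []) Enc.enc hN
    obtain ⟨w₃, h₃⟩ := (hp l).2 [] w₀
    obtain ⟨w₄, h₄⟩ := exec_unloadOutput (w := w₃) (a := []) (b := []) (n := []) (i := ([] : List A))
      (t := []) (x := x)
    simp only [List.append_nil, List.reverse_reverse, hx] at h₁ h₂ h₃
    change Exec p w₀ (mem (Data.ofList (l.map Enc.enc)).code [] [] [] [] []) w₃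
      (mem (Data.ofBool x).code [] [] [] [] []) _ at h₃
    refine .mono (.seq h₁ (.seq h₂ (.seq h₃ (.seq h₄ .load)))) ?_
    have : P.eval (esize l) ≤ _ := eval_le_eval_of_le P (Data.size_ofList_map_le hN l)
    simp [Q]
    linarith
  refine ⟨⟨⟨prog.machine w₀ .inp .main, Equiv.refl _, Equiv.refl _⟩, Q, fun a => ?_⟩⟩
  let M := prog.machine w₀ .inp .main
  have hr : ReachesIn M.m ⟨some (some prog.entry), w₀, mem [] [] [] [] (enc a) []⟩
      ⟨none, w₀, mem [f a] [] [] [] [] []⟩ (Q.eval (enc a).length) := by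
    have h₁ := (key (enc a) (f a) (h a)).reachesIn (M := M.m) (e := some) (x := none) fun _ => rfl
    refine (h₁.trans (ReachesIn.single (b := ⟨none, w₀, _⟩) rfl)).mono ?_
    simp [Q]
  have hi : initList M (enc a) = ⟨some (some prog.entry), w₀, mem [] [] [] [] (enc a) []⟩ := by
    unfold initList
    congr
    funext k
    cases k <;> rfl
  have ho : haltList M [f a] = ⟨none, w₀, mem [f a] [] [] [] [] []⟩ := by
    unfold haltList
    congr
    funext k
    cases k <;> rfl
  -- The machine receives its input through the equivalence of alphabets, so literally as `List.map
  -- id (enc a)`.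
  have : ∀ l : List A, l = enc a →
      Nonempty (TM2OutputsInTime M l (some [f a]) (Q.eval (enc a).length)) := by
    rintro _ rfl
    obtain ⟨n, hn, hr⟩ := hr
    refine ⟨⟨⟨n, ?_⟩, hn⟩⟩
    rw [hi, Option.map_some, ho]
    exact hr
  exact (this (List.map id (enc a)) (List.map_id _)).some

end StackProgram

namespace StackProgram

/-! ### A library of polynomial-time functions -/

instance {α : Type} [Enc α] : Enc (Option α) :=
  ⟨fun o => match o with | none => .leaf | some a => .node .leaf (Enc.enc a)⟩

/-- Case distinction on lists. -/
def listCases {α β : Type} (l : List α) (n : β) (c : α → List α → β) : β :=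
  match l with
  | [] => n
  | a :: t => c a t

/-- Case distinction on options. -/
def optionCases {α β : Type} (o : Option α) (n : β) (c : α → β) : β :=
  match o with
  | none => n
  | some a => c a

namespace PolyFun

variable {α β γ δ : Type} [Enc α] [Enc β] [Enc γ] [Enc δ]

theorem exists_esize_le {f : α → β} (hf : PolyFun f) :
    ∃ q : Polynomial ℕ, ∀ a, esize (f a) ≤ q.eval (esize a) :=
  let ⟨_, q, hq⟩ := hf Unit
  ⟨q, fun a => (hq a).1⟩

theorem val {p : α → Prop} : PolyFun fun a : {a // p a} => a.1 := of_enc_eq fun _ => rfl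

theorem enc : PolyFun fun a : α => Enc.enc a := of_enc_eq fun _ => rfl

theorem node {f g : α → Data} (hf : PolyFun f) (hg : PolyFun g) :
    PolyFun fun a => Data.node (f a) (g a) := (hf.prodMk hg).congr_enc fun _ => rfl

@[fun_prop]
theorem const (b : β) : PolyFun fun _ : α => b := by
  have h : ∀ d : Data, PolyFun fun _ : α => d := fun d => by
    induction d with
    | leaf => exact leaf
    | node l r hl hr => exact hl.node hr
  exact (h (Enc.enc b)).congr_enc fun _ => rfl

@[fun_prop]
theorem fst : PolyFun fun p : α × β => p.1 := (dataFst.comp enc).congr_enc fun _ => rfl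

@[fun_prop]
theorem snd : PolyFun fun p : α × β => p.2 := (dataSnd.comp enc).congr_enc fun _ => rfl

@[fun_prop]
theorem cond {c : α → Bool} {f g : α → β} (hc : PolyFun c) (hf : PolyFun f) (hg : PolyFun g) :
    PolyFun fun a => bif c a then f a else g a :=
  glue hc ((hf.comp val).congr_enc fun ⟨a, ha⟩ => by rw [isNode_enc_bool] at ha; simp [ha])
    ((hg.comp val).congr_enc fun ⟨a, ha⟩ => by rw [isNode_enc_bool] at ha; simp [ha])

@[fun_prop]
theorem and {f g : α → Bool} (hf : PolyFun f) (hg : PolyFun g) : PolyFun fun a => f a && g a :=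
  (hf.cond hg (const false)).congr_enc fun a => by cases f a <;> rfl

@[fun_prop]
theorem or {f g : α → Bool} (hf : PolyFun f) (hg : PolyFun g) : PolyFun fun a => f a || g a :=
  (hf.cond (const true) hg).congr_enc fun a => by cases f a <;> rfl

@[fun_prop]
theorem not {f : α → Bool} (hf : PolyFun f) : PolyFun fun a => !f a :=
  (hf.cond (const false) (const true)).congr_enc fun a => by cases f a <;> rfl

@[fun_prop]
theorem cons {f : α → β} {g : α → List β} (hf : PolyFun f) (hg : PolyFun g) :
    PolyFun fun a => f a :: g a := (hf.prodMk hg).congr_enc fun _ => rfl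

@[fun_prop]
theorem tail : PolyFun fun l : List β => l.tail :=
  (dataSnd.comp enc).congr_enc fun l => by cases l <;> rfl

@[fun_prop]
theorem some {f : α → β} (hf : PolyFun f) : PolyFun fun a => Option.some (f a) :=
  ((const Data.leaf).prodMk hf).congr_enc fun _ => rfl

theorem isNode : PolyFun Data.isNode :=
  glue (c := id) PolyFun.id
    ((const true).congr_enc fun a => by rw [show a.1.isNode = true from a.2])
    ((const false).congr_enc fun a => by rw [show a.1.isNode = false from a.2])

@[fun_prop]
theorem isEmpty : PolyFun fun l : List β => l.isEmpty :=
  (isNode.comp enc).not.congr_enc fun l => by cases l <;> rfl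

@[fun_prop]
theorem listCases {l : α → List β} {n : α → γ} {c : α → β → List β → γ} (hl : PolyFun l)
    (hn : PolyFun n) (hc : PolyFun fun p : α × β × List β => c p.1 p.2.1 p.2.2) :
    PolyFun fun a => listCases (l a) (n a) (c a) := by
  refine glue hl ?_ ((hn.comp val).congr_enc fun ⟨a, ha⟩ => ?_)
  · have h : ∀ a : {a // (Enc.enc (l a)).isNode = true}, l a.1 ≠ [] := by
      rintro ⟨a, ha⟩ h
      simp [h, Enc.enc, Data.ofList, Data.isNode] at ha
    -- The code of a nonempty list is the code of the pair of its head and tail, so nothing has to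
    -- be computed.
    have ht : PolyFun fun a : {a // (Enc.enc (l a)).isNode = true} =>
        ((l a.1).head (h a), (l a.1).tail) := (hl.comp val).congr_enc fun a => by
      obtain ⟨x, t, hx⟩ := List.exists_cons_of_ne_nil (h a)
      simp only [hx, List.head_cons, List.tail_cons]
      rfl
    refine (hc.comp (val.prodMk ht)).congr_enc fun a => ?_
    obtain ⟨x, t, hx⟩ := List.exists_cons_of_ne_nil (h a)
    simp only [hx, List.head_cons, List.tail_cons, StackProgram.listCases]
  · cases h : l a with
    | nil => simp [StackProgram.listCases]
    | cons x t => simp [h, Enc.enc, Data.ofList, Data.isNode] at ha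

@[fun_prop]
theorem optionCases {o : α → Option β} {n : α → γ} {c : α → β → γ} (ho : PolyFun o)
    (hn : PolyFun n) (hc : PolyFun fun p : α × β => c p.1 p.2) :
    PolyFun fun a => optionCases (o a) (n a) (c a) := by
  refine glue ho ?_ ((hn.comp val).congr_enc fun ⟨a, ha⟩ => ?_)
  · have h : ∀ a : {a // (Enc.enc (o a)).isNode = true}, (o a.1).isSome := by
      rintro ⟨a, ha⟩
      cases h : o a <;> simp [h, Enc.enc, Data.isNode] at ha ⊢
    have ht : PolyFun fun a : {a // (Enc.enc (o a)).isNode = true} => (o a.1).get (h a) :=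
      (dataSnd.comp (enc.comp (ho.comp val))).congr_enc fun a => by
        obtain ⟨x, hx⟩ := Option.isSome_iff_exists.1 (h a)
        simp only [hx, Option.get_some]
        rfl
    refine (hc.comp (val.prodMk ht)).congr_enc fun a => ?_
    obtain ⟨x, hx⟩ := Option.isSome_iff_exists.1 (h a)
    simp only [hx, Option.get_some, StackProgram.optionCases]
  · cases h : o a with
    | none => simp [StackProgram.optionCases]
    | some x => simp [h, Enc.enc, Data.isNode] at ha

/-- Folds are polynomial-time if the intermediate results are polynomially bounded. -/
theorem foldl {l : α → List β} {s : α → γ} {f : α → γ → β → γ} (hl : PolyFun l) (hs : PolyFun s)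
    (hf : PolyFun fun p : α × γ × β => f p.1 p.2.1 p.2.2) (B : Polynomial ℕ)
    (hB : ∀ a l', l' <+: l a → esize (l'.foldl (f a) (s a)) ≤ B.eval (esize a)) :
    PolyFun fun a => (l a).foldl (f a) (s a) := by
  obtain ⟨L, hL⟩ := hl.exists_esize_le
  -- The iterated state carries the parameter, the rest of the list and the accumulator; the list
  -- itself serves as the counter.
  let F : α × List β × γ → α × List β × γ := fun p =>
    StackProgram.listCases p.2.1 p fun b t => (p.1, t, f p.1 p.2.2 b)
  have hF : PolyFun F := by
    refine listCases (by fun_prop) (by fun_prop) ?_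
    have : PolyFun fun p : (α × List β × γ) × β × List β => f p.1.1 p.1.2.2 p.2.1 :=
      hf.comp (f := fun p : (α × List β × γ) × β × List β => (p.1.1, p.1.2.2, p.2.1)) (by fun_prop)
    fun_prop
  have iter : ∀ a j, F^[j] (a, l a, s a) =
      (a, (l a).drop j, ((l a).take j).foldl (f a) (s a)) := by
    intro a j
    induction j with
    | zero => simp
    | succ j ih =>
      rw [Function.iterate_succ_apply', ih]
      by_cases hj : j < (l a).length
      · have h : (l a).take (j + 1) = (l a).take j ++ [(l a)[j]] := by simp
        rw [h, List.foldl_append]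
        simp only [F]
        rw [List.drop_eq_getElem_cons hj]
        rfl
      · simp [F, StackProgram.listCases, List.drop_eq_nil_of_le (not_lt.1 hj),
          List.drop_eq_nil_of_le (show (l a).length ≤ j + 1 by omega),
          List.take_of_length_le (not_lt.1 hj),
          List.take_of_length_le (show (l a).length ≤ j + 1 by omega)]
  have hdrop : ∀ (l : List β) j, esize (l.drop j) ≤ esize l := by
    intro l
    induction l with
    | nil => simp
    | cons b l ih =>
      intro j
      cases j with
      | zero => simp
      | succ j => have := ih j; simp; omega
  have h := iterate hF hl (h := fun a => (a, l a, s a)) (by fun_prop) (.X + L + B + 2)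
    (fun a j _ => by
      rw [iter]
      have h1 := hdrop (l a) j
      have h2 := hB a _ ((l a).take_prefix j)
      have h3 := hL a
      simp
      omega)
  refine (snd.comp (snd.comp h)).congr_enc fun a => ?_
  rw [iter, List.take_length]

end PolyFun
end StackProgram

/-! ### Size estimates and list functions in polynomial time -/

namespace StackProgram

theorem esize_le_of_mem {α : Type} [Enc α] {a : α} {l : List α} (h : a ∈ l) :
    esize a < esize l := by
  induction l with
  | nil => simp at h
  | cons b l ih =>
    rcases List.mem_cons.1 h with rfl | h
    · simp only [esize_cons]; omega
    · have := ih h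
      simp; omega

theorem esize_list_eq {α : Type} [Enc α] (l : List α) :
    esize l = (l.map fun a => esize a + 1).sum + 1 := by
  induction l with
  | nil => rfl
  | cons a l ih => simp [ih]; omega

theorem esize_list_le {α : Type} [Enc α] {l : List α} {N : ℕ} (h : ∀ a ∈ l, esize a ≤ N) :
    esize l ≤ l.length * (N + 1) + 1 := by
  rw [esize_list_eq]
  have := List.sum_le_card_nsmul (l.map fun a => esize a + 1) (N + 1) (by
    simpa using fun a ha => h a ha)
  simpa using this

theorem esize_append {α : Type} [Enc α] (l l' : List α) :
    esize (l ++ l') + 1 = esize l + esize l' := by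
  simp only [esize_list_eq, List.map_append, List.sum_append]
  omega

@[simp] theorem esize_reverse {α : Type} [Enc α] (l : List α) : esize l.reverse = esize l := by
  simp only [esize_list_eq, List.map_reverse, List.sum_reverse]

theorem esize_le_of_prefix {α : Type} [Enc α] {l l' : List α} (h : l <+: l') :
    esize l ≤ esize l' := by
  obtain ⟨t, rfl⟩ := h
  have := esize_append l t
  have := esize_pos t
  omega

theorem esize_bool_le (b : Bool) : esize b ≤ 3 := by cases b <;> decide

theorem foldl_cons_option {β γ : Type} {f : β → Option γ} (l : List β) (s : List γ) :
    l.foldl (fun s b => optionCases (f b) s fun c => c :: s) s =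
      (l.filterMap f).reverse ++ s := by
  induction l generalizing s with
  | nil => rfl
  | cons b l ih =>
    rw [List.foldl_cons, ih]
    cases h : f b <;> simp [h, optionCases]

namespace PolyFun

variable {α β γ δ : Type} [Enc α] [Enc β] [Enc γ] [Enc δ]

@[fun_prop]
theorem reverse : PolyFun fun l : List β => l.reverse := by
  refine (foldl (l := fun l : List β => l) (s := fun _ => ([] : List β)) (f := fun _ s b => b :: s)
    (by fun_prop) (by fun_prop) (by fun_prop) .X fun a l' h => ?_).congr_enc fun a => ?_
  · rw [List.foldl_flip_cons_eq_append', List.append_nil, esize_reverse, Polynomial.eval_X]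
    exact esize_le_of_prefix h
  · rw [List.foldl_flip_cons_eq_append', List.append_nil]

@[fun_prop]
theorem filterMap {l : α → List β} {f : α → β → Option γ} (hl : PolyFun l)
    (hf : PolyFun fun p : α × β => f p.1 p.2) : PolyFun fun a => (l a).filterMap (f a) := by
  obtain ⟨L, hL⟩ := hl.exists_esize_le
  obtain ⟨Q, hQ⟩ := hf.exists_esize_le
  have hstep : PolyFun fun p : α × List γ × β =>
      StackProgram.optionCases (f p.1 p.2.2) p.2.1 fun c => c :: p.2.1 := by
    have : PolyFun fun p : α × List γ × β => f p.1 p.2.2 :=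
      hf.comp (f := fun p : α × List γ × β => (p.1, p.2.2)) (by fun_prop)
    fun_prop
  -- At most `L` values are kept, and each is bounded by `Q` at the size of a pair of the parameter
  -- and a list entry.
  refine (reverse.comp (foldl hl (s := fun _ => ([] : List γ))
    (f := fun a s b => StackProgram.optionCases (f a b) s fun c => c :: s) (by fun_prop) hstep
    (L * (Q.comp (.X + L + 1) + 1) + 1) fun a l' h => ?_)).congr_enc fun a => ?_
  · rw [foldl_cons_option, List.append_nil, esize_reverse]
    refine (esize_list_le (N := Q.eval (esize a + L.eval (esize a) + 1)) fun c hc => ?_).trans ?_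
    · obtain ⟨b, hb, hc⟩ := List.mem_filterMap.1 hc
      have h1 := hQ (a, b)
      have h2 : esize c ≤ esize (f a b) := by
        rw [hc]; simp [esize, Enc.enc, Data.size]; omega
      refine h2.trans (h1.trans (eval_le_eval_of_le Q ?_))
      have := esize_le_of_mem (h.mem hb)
      have := hL a
      simp
      omega
    · have h1 : (l'.filterMap (f a)).length ≤ L.eval (esize a) :=
        (List.length_filterMap_le _ _).trans
          (h.length_le.trans ((length_lt_esize _).le.trans (hL a)))
      simp only [Polynomial.eval_add, Polynomial.eval_mul, Polynomial.eval_comp,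
        Polynomial.eval_X, Polynomial.eval_one]
      gcongr
  · rw [foldl_cons_option, List.append_nil, List.reverse_reverse]

@[fun_prop]
theorem map {l : α → List β} {f : α → β → γ} (hl : PolyFun l)
    (hf : PolyFun fun p : α × β => f p.1 p.2) : PolyFun fun a => (l a).map (f a) :=
  (filterMap hl (f := fun a b => Option.some (f a b)) (by fun_prop)).congr_enc fun a => by
    rw [List.filterMap_eq_map']

@[fun_prop]
theorem all {l : α → List β} {f : α → β → Bool} (hl : PolyFun l)
    (hf : PolyFun fun p : α × β => f p.1 p.2) : PolyFun fun a => (l a).all (f a) := by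
  have hstep : PolyFun fun p : α × Bool × β => p.2.1 && f p.1 p.2.2 := by
    have : PolyFun fun p : α × Bool × β => f p.1 p.2.2 :=
      hf.comp (f := fun p : α × Bool × β => (p.1, p.2.2)) (by fun_prop)
    fun_prop
  refine (foldl hl (const true) (f := fun a s b => s && f a b) hstep 3
    fun a l' h => by simpa using esize_bool_le _).congr_enc fun a => ?_
  have h : ∀ (l : List β) s, l.foldl (fun s b => s && f a b) s = (s && l.all (f a)) := by
    intro l
    induction l with
    | nil => simp
    | cons b l ih => intro s; simp [ih, Bool.and_assoc]
  rw [h, Bool.true_and]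

@[fun_prop]
theorem append {f g : α → List β} (hf : PolyFun f) (hg : PolyFun g) :
    PolyFun fun a => f a ++ g a := by
  obtain ⟨P, hP⟩ := hf.exists_esize_le
  obtain ⟨Q, hQ⟩ := hg.exists_esize_le
  refine (foldl (reverse.comp hf) hg (f := fun _ s b => b :: s) (by fun_prop) (P + Q)
    fun a l' h => ?_).congr_enc fun a => ?_
  · rw [List.foldl_flip_cons_eq_append']
    have h1 := esize_append l'.reverse (g a)
    have h2 := esize_le_of_prefix h
    have h3 := hP a
    have h4 := hQ a
    simp at *
    omega
  · rw [List.foldl_flip_cons_eq_append', List.reverse_reverse]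

/-- Induction on the fixed tree: equality with a node is a test of the tag and of both subtrees, so
the program grows with `d₀` only. -/
theorem eqData (d₀ : Data) : PolyFun fun d : Data => decide (d = d₀) := by
  induction d₀ with
  | leaf => exact isNode.not.congr_enc fun d => by cases d <;> rfl
  | node l r hl hr =>
    have h1 := hl.comp dataFst
    have h2 := hr.comp dataSnd
    refine (isNode.and (h1.and h2)).congr_enc fun d => ?_
    congr 1
    rw [Bool.eq_iff_iff]
    cases d with
    | leaf => simp [Data.isNode]
    | node a b =>
      simp only [Data.isNode, Data.fst, Data.snd, Bool.true_and, Bool.and_eq_true,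
        decide_eq_true_eq, Data.node.injEq]
      exact ⟨fun h => ⟨decide_eq_true h.1, decide_eq_true h.2⟩,
        fun h => ⟨of_decide_eq_true h.1, of_decide_eq_true h.2⟩⟩

/-- Functions are polynomial-time if they are after fixing an argument from a finite type. -/
theorem finite_cases {κ : Type} [Finite κ] [Enc κ] (hκ : Function.Injective (Enc.enc : κ → Data))
    {f : κ → α → β} (hf : ∀ k, PolyFun (f k)) {k : α → κ} (hk : PolyFun k) :
    PolyFun fun a => f (k a) a := by
  have := Fintype.ofFinite κ
  rcases isEmpty_or_nonempty κ with h | ⟨⟨k₀⟩⟩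
  · exact (const Data.leaf).congr_enc fun a => h.elim (k a)
  have h : ∀ l : List κ, ∃ g : α → β, PolyFun g ∧ ∀ a, k a ∈ l → g a = f (k a) a := by
    intro l
    induction l with
    | nil => exact ⟨_, hf k₀, by simp⟩
    | cons x l ih =>
      obtain ⟨g, hg, h⟩ := ih
      refine ⟨_, ((eqData (Enc.enc x)).comp (enc.comp hk)).cond (hf x) hg, fun a ha => ?_⟩
      by_cases hx : k a = x
      · simp [hx]
      · simpa [hκ.eq_iff, hx] using h a (by simpa [hx] using ha)
  obtain ⟨g, hg, h⟩ := h Finset.univ.toList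
  exact hg.congr_enc fun a => by rw [h a (by simp)]

theorem of_finite {κ : Type} [Finite κ] [Enc κ] (hκ : Function.Injective (Enc.enc : κ → Data))
    (f : κ → β) : PolyFun f :=
  finite_cases hκ (f := fun k _ => f k) (fun k => const (f k)) PolyFun.id

end PolyFun

/-- An encoding of a finite type. -/
@[reducible]
noncomputable def Enc.ofFinite (κ : Type) [Finite κ] : Enc κ :=
  ⟨fun k => Enc.enc (List.replicate (Finite.equivFin κ k : ℕ) true)⟩

theorem Enc.injective_ofFinite (κ : Type) [Finite κ] :
    Function.Injective (Enc.ofFinite κ).enc := by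
  intro k k' h
  have h := congrArg Data.spine h
  change (Enc.enc (List.replicate _ true)).spine = (Enc.enc (List.replicate _ true)).spine at h
  simp only [spine_enc_list, List.length_replicate] at h
  exact (Finite.equivFin κ).injective (Fin.ext h)

end StackProgram

namespace StackProgram

/-! ### Binary arithmetic in polynomial time -/

/-- The number with given binary digits, least significant first. -/
def ofBits (l : List Bool) : ℕ := l.foldr (fun b n => 2 * n + b.toNat) 0

@[simp] theorem ofBits_nil : ofBits [] = 0 := rfl

@[simp] theorem ofBits_cons (b : Bool) (l : List Bool) :
    ofBits (b :: l) = 2 * ofBits l + b.toNat := rfl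

theorem ofBits_append (l l' : List Bool) :
    ofBits (l ++ l') = ofBits l + 2 ^ l.length * ofBits l' := by
  induction l with
  | nil => simp
  | cons b l ih => simp [ih, pow_succ]; ring

theorem ofBits_lt (l : List Bool) : ofBits l < 2 ^ l.length := by
  induction l with
  | nil => simp
  | cons b l ih =>
    have : b.toNat ≤ 1 := by cases b <;> simp
    simp [pow_succ]
    omega

@[simp] theorem ofBits_bits (n : ℕ) : ofBits n.bits = n := by
  induction n using Nat.binaryRec' with
  | zero => simp
  | bit b n h ih =>
    rw [Nat.bits_append_bit n b h, ofBits_cons, ih, Nat.bit_val]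

/-- Remove the leading zeros of a binary number. -/
def normalize (l : List Bool) : List Bool :=
  l.reverse.foldl (fun s b => bif b || !s.isEmpty then b :: s else []) []

theorem normalize_cons (b : Bool) (l : List Bool) : normalize (b :: l) =
    bif b || !(normalize l).isEmpty then b :: normalize l else [] := by
  simp [normalize]

/-- Numbers are coded by their canonical digits. Arithmetic may thus produce digit lists with
leading zeros and strip them at the end. -/
theorem bits_ofBits (l : List Bool) : (ofBits l).bits = normalize l := by
  induction l with
  | nil => simp [normalize]
  | cons b l ih =>
    rw [normalize_cons, ← ih, ofBits_cons, ← Nat.bit_val]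
    by_cases h : ofBits l = 0 → b = true
    · rw [Nat.bits_append_bit _ _ h]
      cases b with
      | true => simp
      | false =>
        have h : ofBits l ≠ 0 := by simpa using h
        have : (ofBits l).bits ≠ [] := fun h0 => h (by rw [← ofBits_bits (ofBits l), h0]; rfl)
        simp [List.isEmpty_eq_false_iff.2 this]
    · obtain ⟨h, hb⟩ : ofBits l = 0 ∧ b = false := by simpa using h
      simp [h, hb]

instance : Enc ℕ := ⟨fun n => Enc.enc n.bits⟩

theorem esize_nat (n : ℕ) : esize n = esize n.bits := rfl

theorem size_lt_esize (n : ℕ) : n.size < esize n := by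
  rw [← Nat.size_eq_bits_len]; exact length_lt_esize _

theorem esize_le_size (n : ℕ) : esize n ≤ 4 * n.size + 1 := by
  rw [← Nat.size_eq_bits_len, esize_nat]
  have := esize_list_le (l := n.bits) (N := 3) fun b _ => esize_bool_le b
  omega

theorem size_add_le (m n : ℕ) : (m + n).size ≤ max m.size n.size + 1 := by
  rw [Nat.size_le, pow_succ]
  have h1 := (Nat.lt_size_self m).trans_le
    (Nat.pow_le_pow_right two_pos (le_max_left m.size n.size))
  have h2 := (Nat.lt_size_self n).trans_le
    (Nat.pow_le_pow_right two_pos (le_max_right m.size n.size))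
  omega

theorem size_mul_le (m n : ℕ) : (m * n).size ≤ m.size + n.size := by
  rw [Nat.size_le, pow_add]
  exact Nat.mul_lt_mul'' (Nat.lt_size_self m) (Nat.lt_size_self n)

namespace PolyFun

variable {α β : Type} [Enc α] [Enc β]

theorem normalize : PolyFun normalize := by
  refine (foldl (reverse.comp PolyFun.id) (const []) (f := fun _ (s : List Bool) (b : Bool) =>
    bif b || !s.isEmpty then b :: s else []) (by fun_prop) (4 * .X + 1) fun a l' h => ?_)
  have h1 : ∀ (l s : List Bool),
      (l.foldl (fun s b => bif b || !s.isEmpty then b :: s else []) s).length ≤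
        l.length + s.length := by
    intro l
    induction l with
    | nil => simp
    | cons b l ih =>
      intro s
      refine (ih _).trans ?_
      change l.length + (bif b || !s.isEmpty then b :: s else []).length ≤ _
      generalize (b || !s.isEmpty) = c
      cases c <;> simp <;> omega
  refine (esize_list_le fun b _ => esize_bool_le b).trans ?_
  have h2 := h1 l' []
  have h3 := h.length_le
  have h4 := length_lt_esize a
  simp at *
  omega

@[fun_prop]
theorem ofBits : PolyFun ofBits := normalize.congr_enc fun l => by
  rw [← bits_ofBits]; rfl

@[fun_prop]
theorem bits : PolyFun Nat.bits := of_enc_eq fun _ => rfl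

@[fun_prop]
theorem xor {f g : α → Bool} (hf : PolyFun f) (hg : PolyFun g) : PolyFun fun a => f a ^^ g a :=
  (hf.cond hg.not hg).congr_enc fun a => by cases f a <;> cases g a <;> rfl

end PolyFun

theorem esize_bits_le (l : List Bool) : esize l ≤ 4 * l.length + 1 :=
  (esize_list_le fun b _ => esize_bool_le b).trans (by omega)

/-- One step of binary addition, on the rest of both summands, the carry, and the digits of the
result in reverse. -/
def addStep (s : List Bool × List Bool × Bool × List Bool) :
    List Bool × List Bool × Bool × List Bool :=
  let a := listCases s.1 false fun b _ => b
  let b := listCases s.2.1 false fun b _ => b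
  (s.1.tail, s.2.1.tail, (a && b) || (s.2.2.1 && (a ^^ b)), (a ^^ b ^^ s.2.2.1) :: s.2.2.2)

/-- The invariant of a full adder; a summand that has run out contributes the digit `false`. -/
theorem exists_addStep_eq (s : List Bool × List Bool × Bool × List Bool) : ∃ c b,
    addStep s = (s.1.tail, s.2.1.tail, c, b :: s.2.2.2) ∧
      2 * (ofBits s.1.tail + ofBits s.2.1.tail + c.toNat) + b.toNat =
        ofBits s.1 + ofBits s.2.1 + s.2.2.1.toNat := by
  obtain ⟨x, y, c, o⟩ := s
  refine ⟨_, _, rfl, ?_⟩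
  rcases x with _ | ⟨a, x⟩ <;> rcases y with _ | ⟨b, y⟩ <;> cases c <;>
    simp [listCases] <;> (try cases a) <;> (try cases b) <;> simp <;> omega

theorem addStep_iterate (x y : List Bool) (j : ℕ) :
    ∃ c o, addStep^[j] (x, y, false, []) = (x.drop j, y.drop j, c, o) ∧ o.length = j ∧
      ofBits o.reverse + 2 ^ j * (ofBits (x.drop j) + ofBits (y.drop j) + c.toNat) =
        ofBits x + ofBits y := by
  induction j with
  | zero => exact ⟨false, [], by simp⟩
  | succ j ih =>
    obtain ⟨c, o, h, ho, hs⟩ := ih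
    obtain ⟨c', b, h', hi⟩ := exists_addStep_eq (x.drop j, y.drop j, c, o)
    refine ⟨c', b :: o, ?_, by simp [ho], ?_⟩
    · rw [Function.iterate_succ_apply', h, h']
      simp
    · simp only [List.tail_drop] at hi
      rw [List.reverse_cons, ofBits_append, ← hs, ← hi]
      simp [ho, pow_succ]
      ring

/-- One step of binary comparison, on the rest of both numbers and the result for the digits
read. -/
def leStep (s : List Bool × List Bool × Bool) : List Bool × List Bool × Bool :=
  let a := listCases s.1 false fun b _ => b
  let b := listCases s.2.1 false fun b _ => b
  (s.1.tail, s.2.1.tail, bif a ^^ b then b else s.2.2)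

/-- The digits come least significant first, so a later difference overrides the verdict so far. The
invariant therefore compares the unread digits first and consults the verdict only if these are
equal. -/
theorem exists_leStep_eq (s : List Bool × List Bool × Bool) : ∃ r,
    leStep s = (s.1.tail, s.2.1.tail, r) ∧
      (ofBits s.1.tail < ofBits s.2.1.tail ∨ ofBits s.1.tail = ofBits s.2.1.tail ∧ r = true ↔
        ofBits s.1 < ofBits s.2.1 ∨ ofBits s.1 = ofBits s.2.1 ∧ s.2.2 = true) := by
  obtain ⟨x, y, c⟩ := s
  refine ⟨_, rfl, ?_⟩
  rcases x with _ | ⟨a, x⟩ <;> rcases y with _ | ⟨b, y⟩ <;> cases c <;>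
    simp [listCases] <;> (try cases a) <;> (try cases b) <;> simp <;> omega

theorem leStep_iterate (x y : List Bool) (j : ℕ) :
    ∃ r, leStep^[j] (x, y, true) = (x.drop j, y.drop j, r) ∧
      (ofBits (x.drop j) < ofBits (y.drop j) ∨ ofBits (x.drop j) = ofBits (y.drop j) ∧ r = true ↔
        ofBits x ≤ ofBits y) := by
  induction j with
  | zero => exact ⟨true, by simp [le_iff_lt_or_eq]⟩
  | succ j ih =>
    obtain ⟨c, h, hs⟩ := ih
    obtain ⟨c', h', hi⟩ := exists_leStep_eq (x.drop j, y.drop j, c)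
    refine ⟨c', ?_, ?_⟩
    · rw [Function.iterate_succ_apply', h, h']
      simp
    · simp only [List.tail_drop] at hi
      rw [hi, hs]

namespace PolyFun

variable {α β : Type} [Enc α] [Enc β]

theorem addBits : PolyFun fun p : List Bool × List Bool =>
    StackProgram.ofBits p.1 + StackProgram.ofBits p.2 := by
  have hstep : PolyFun addStep := by
    unfold addStep
    fun_prop
  -- The number of rounds exceeds the length of either summand by at least one, so all digits are
  -- consumed and the sum is too small to leave a carry.
  have h := iterate hstep (g := fun p : List Bool × List Bool => false :: (p.1 ++ p.2))
    (h := fun p : List Bool × List Bool => (p.1, p.2, false, ([] : List Bool))) (by fun_prop)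
    (by fun_prop) (12 * .X + 20) (fun p j hj => ?_)
  · refine (ofBits.comp (reverse.comp (snd.comp (snd.comp (snd.comp h))))).congr_enc fun p => ?_
    obtain ⟨c, o, h, ho, hs⟩ := addStep_iterate p.1 p.2 (p.1.length + p.2.length + 1)
    simp only [List.length_cons, List.length_append, h]
    rw [List.drop_eq_nil_of_le (by omega), List.drop_eq_nil_of_le (by omega)] at hs
    cases c with
    | false => simp [← hs]
    | true =>
      have h1 := (ofBits_lt p.1).trans_le (Nat.pow_le_pow_right two_pos
        (show p.1.length ≤ p.1.length + p.2.length by omega))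
      have h2 := (ofBits_lt p.2).trans_le (Nat.pow_le_pow_right two_pos
        (show p.2.length ≤ p.1.length + p.2.length by omega))
      simp [pow_succ] at hs
      omega
  · obtain ⟨c, o, h, ho, -⟩ := addStep_iterate p.1 p.2 j
    have h1 := esize_bits_le (p.1.drop j)
    have h2 := esize_bits_le (p.2.drop j)
    have h3 := esize_bits_le o
    have h4 := esize_bool_le c
    have h5 := length_lt_esize p.1
    have h6 := length_lt_esize p.2
    rw [h]
    simp at *
    omega

@[fun_prop]
theorem add {f g : α → ℕ} (hf : PolyFun f) (hg : PolyFun g) : PolyFun fun a => f a + g a :=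
  (addBits.comp ((bits.comp hf).prodMk (bits.comp hg))).congr_enc fun a => by simp

theorem leBits : PolyFun fun p : List Bool × List Bool =>
    Nat.ble (StackProgram.ofBits p.1) (StackProgram.ofBits p.2) := by
  have hstep : PolyFun leStep := by
    unfold leStep
    fun_prop
  have h := iterate hstep (g := fun p : List Bool × List Bool => p.1 ++ p.2)
    (h := fun p : List Bool × List Bool => (p.1, p.2, true)) (by fun_prop)
    (by fun_prop) (8 * .X + 20) (fun p j hj => ?_)
  · refine (snd.comp (snd.comp h)).congr_enc fun p => ?_
    obtain ⟨c, h, hs⟩ := leStep_iterate p.1 p.2 (p.1.length + p.2.length)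
    simp only [List.length_append, h]
    rw [List.drop_eq_nil_of_le (by omega), List.drop_eq_nil_of_le (by omega)] at hs
    congr 1
    rw [Bool.eq_iff_iff, Nat.ble_eq, ← hs]
    simp
  · obtain ⟨c, h, -⟩ := leStep_iterate p.1 p.2 j
    have h1 := esize_bits_le (p.1.drop j)
    have h2 := esize_bits_le (p.2.drop j)
    have h4 := esize_bool_le c
    have h5 := length_lt_esize p.1
    have h6 := length_lt_esize p.2
    rw [h]
    simp at *
    omega

@[fun_prop]
theorem ble {f g : α → ℕ} (hf : PolyFun f) (hg : PolyFun g) :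
    PolyFun fun a => Nat.ble (f a) (g a) :=
  (leBits.comp ((bits.comp hf).prodMk (bits.comp hg))).congr_enc fun a => by simp

@[fun_prop]
theorem beq {f g : α → ℕ} (hf : PolyFun f) (hg : PolyFun g) :
    PolyFun fun a => Nat.beq (f a) (g a) :=
  ((hf.ble hg).and (hg.ble hf)).congr_enc fun a => by
    congr 1
    rw [Bool.eq_iff_iff, Nat.beq_eq, Bool.and_eq_true, Nat.ble_eq, Nat.ble_eq, le_antisymm_iff]

/-- Double and add: after `j` digits the first component is `2 ^ j * x`. -/
theorem mul_foldl (l : List Bool) (x s : ℕ) :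
    l.foldl (fun s b => (s.1 + s.1, bif b then s.2 + s.1 else s.2)) (x, s) =
      (2 ^ l.length * x, s + StackProgram.ofBits l * x) := by
  induction l generalizing x s with
  | nil => simp
  | cons b l ih =>
    rw [List.foldl_cons, ih]
    cases b <;> simp [pow_succ] <;> constructor <;> ring

@[fun_prop]
theorem mul {f g : α → ℕ} (hf : PolyFun f) (hg : PolyFun g) : PolyFun fun a => f a * g a := by
  suffices h : PolyFun fun p : ℕ × ℕ => p.1 * p.2 from h.comp (hf.prodMk hg)
  have h := foldl (l := fun p : ℕ × ℕ => p.1.bits) (s := fun p : ℕ × ℕ => (p.2, 0))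
    (f := fun _ (s : ℕ × ℕ) (b : Bool) => (s.1 + s.1, bif b then s.2 + s.1 else s.2))
    (by fun_prop) (by fun_prop) (by fun_prop) (8 * .X + 20) fun p l' hl => ?_
  · refine (snd.comp h).congr_enc fun p => ?_
    rw [mul_foldl]
    simp
  · rw [mul_foldl]
    have hl := hl.length_le
    rw [Nat.size_eq_bits_len] at hl
    have h1 := size_lt_esize p.1
    have h2 := size_lt_esize p.2
    have h3 := esize_le_size (2 ^ l'.length * p.2)
    have h4 := esize_le_size (0 + StackProgram.ofBits l' * p.2)
    have h5 := size_mul_le (2 ^ l'.length) p.2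
    have h6 := size_mul_le (StackProgram.ofBits l') p.2
    have h7 := Nat.size_le.2 (ofBits_lt l')
    have h8 : (2 ^ l'.length).size ≤ l'.length + 1 := Nat.size_pow.le
    simp at *
    omega

@[fun_prop]
theorem length {l : α → List β} (hl : PolyFun l) : PolyFun fun a => (l a).length := by
  have h := foldl hl (s := fun _ => (0 : ℕ)) (f := fun _ (s : ℕ) _ => s + 1) (by fun_prop)
    (by fun_prop)
  obtain ⟨L, hL⟩ := hl.exists_esize_le
  have hlen : ∀ (l : List β) s, l.foldl (fun s _ => s + 1) s = s + l.length := by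
    intro l
    induction l with
    | nil => simp
    | cons b l ih => intro s; simp [ih]; omega
  refine (h (4 * L + 1) fun a l' hl' => ?_).congr_enc fun a => ?_
  · rw [hlen]
    have h1 := esize_le_size (0 + l'.length)
    have h2 : (0 + l'.length).size ≤ 0 + l'.length := Nat.size_le.2 Nat.lt_two_pow_self
    have h3 := hl'.length_le
    have h4 := length_lt_esize (l a)
    have h5 := hL a
    simp at *
    omega
  · rw [hlen, Nat.zero_add]

end PolyFun
end StackProgram

namespace StackProgram

/-! ### Decoding trees and tables -/

/-- One step of the parser of prefix codes, which reads the code from right to left. -/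
def parseStep (s : List Data) (b : Bool) : List Data :=
  bif b then listCases s s fun x t => listCases t s fun y t => .node x y :: t else .leaf :: s

/-- The tree with a given prefix code. -/
def parse (l : List Bool) : Data :=
  listCases (l.reverse.foldl parseStep []) .leaf fun d _ => d

/-- Read from right to left, a node symbol comes after the codes of both subtrees, which then are
the two topmost trees, the left one above the right one. -/
theorem foldl_parseStep_code (d : Data) (s : List Data) :
    d.code.reverse.foldl parseStep s = d :: s := by
  induction d generalizing s with
  | leaf => rfl
  | node l r hl hr =>
    simp [Data.code, List.foldl_append, hl, hr, -List.foldl_reverse]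
    rfl

@[simp] theorem parse_code (d : Data) : parse d.code = d := by
  rw [parse, foldl_parseStep_code, listCases]

namespace Data

/-- The list coded by a tree. -/
def toList : Data → List Data
  | leaf => []
  | node a t => a :: t.toList

theorem enc_toList (d : Data) : Enc.enc d.toList = d := by
  induction d with
  | leaf => rfl
  | node a t _ ih => exact congrArg (node a) ih

theorem toList_enc {α : Type} [Enc α] (l : List α) : (Enc.enc l).toList = l.map Enc.enc := by
  induction l with
  | nil => rfl
  | cons a l ih => exact congrArg (Enc.enc a :: ·) ih

/-- The number coded by a tree. -/
def toNat (d : Data) : ℕ := ofBits (d.toList.map isNode)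

@[simp] theorem toNat_enc (n : ℕ) : (Enc.enc n).toNat = n := by
  have h : (Enc.enc n).toList = n.bits.map Enc.enc := toList_enc n.bits
  have hb : isNode ∘ (Enc.enc : Bool → Data) = id := funext isNode_enc_bool
  rw [toNat, h, List.map_map, hb, List.map_id, ofBits_bits]

end Data

/-- Tables of weights, indexed by depth, information set and action. -/
abbrev Table : Type := List ((ℕ × ℕ × ℕ) × ℕ)

/-- The table coded by a tree. -/
def Data.toTable (d : Data) : Table :=
  d.toList.map fun r => ((r.fst.fst.toNat, r.fst.snd.fst.toNat, r.fst.snd.snd.toNat), r.snd.toNat)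

@[simp] theorem Data.toTable_enc (T : Table) : (Enc.enc T).toTable = T := by
  rw [toTable, toList_enc, List.map_map]
  refine (List.map_congr_left fun r _ => ?_).trans (List.map_id T)
  obtain ⟨⟨d, I, a⟩, w⟩ := r
  simp only [Function.comp_apply, id]
  congr
  all_goals exact Data.toNat_enc _

/-- The last entry of a table with a given index, or `0`. -/
def lookup (T : Table) (d I a : ℕ) : ℕ :=
  T.foldl (fun s e => bif Nat.beq e.1.1 d && (Nat.beq e.1.2.1 I && Nat.beq e.1.2.2 a) then e.2
    else s) 0

theorem lookup_induction {P : ℕ → Prop} {T : Table} {d I a : ℕ} (h0 : P 0)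
    (h : ∀ w, ((d, I, a), w) ∈ T → P w) : P (lookup T d I a) := by
  have : ∀ (l : Table) s, P s → (∀ w, ((d, I, a), w) ∈ l → P w) →
      P (l.foldl (fun s e => bif Nat.beq e.1.1 d && (Nat.beq e.1.2.1 I && Nat.beq e.1.2.2 a) then e.2
        else s) s) := by
    intro l
    induction l with
    | nil => intro s hs _; exact hs
    | cons e l ih =>
      intro s hs hl
      rw [List.foldl_cons]
      refine ih _ ?_ fun w hw => hl w (List.mem_cons_of_mem _ hw)
      cases hc : Nat.beq e.1.1 d && (Nat.beq e.1.2.1 I && Nat.beq e.1.2.2 a) with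
      | false => exact hs
      | true =>
        obtain ⟨⟨d', I', a'⟩, w⟩ := e
        simp only [Bool.and_eq_true, Nat.beq_eq] at hc
        obtain ⟨rfl, rfl, rfl⟩ := hc
        exact hl w (by simp)
  exact this T 0 h0 h

/-- Keys may be repeated in a table. All that is needed is that the value found belongs to some
entry with the same key, since in the tables built later the weight is a function of the key. -/
theorem exists_mem_lookup {T : Table} {d I a w : ℕ} (h : ((d, I, a), w) ∈ T) :
    ((d, I, a), lookup T d I a) ∈ T := by
  have : ∀ (l : Table) s, (((d, I, a), s) ∈ T ∨ ∃ w, ((d, I, a), w) ∈ l) → l ⊆ T →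
      ((d, I, a), l.foldl (fun s e => bif Nat.beq e.1.1 d && (Nat.beq e.1.2.1 I &&
        Nat.beq e.1.2.2 a) then e.2 else s) s) ∈ T := by
    intro l
    induction l with
    | nil => intro s hs _; simpa using hs
    | cons e l ih =>
      intro s hs hl
      rw [List.foldl_cons]
      refine ih _ ?_ fun w hw => hl (List.mem_cons_of_mem _ hw)
      obtain ⟨⟨d', I', a'⟩, w'⟩ := e
      by_cases hc : d' = d ∧ I' = I ∧ a' = a
      · obtain ⟨rfl, rfl, rfl⟩ := hc
        refine Or.inl ?_
        simpa using hl (List.mem_cons_self ..)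
      · have hc' : (Nat.beq d' d && (Nat.beq I' I && Nat.beq a' a)) = false := by
          rw [Bool.eq_false_iff]
          simpa using hc
        simp only [hc', cond_false]
        refine hs.imp_right fun ⟨w, hw⟩ => ⟨w, ?_⟩
        rcases List.mem_cons.1 hw with h | h
        · simp only [Prod.mk.injEq] at h
          exact absurd ⟨h.1.1.symm, h.1.2.1.symm, h.1.2.2.symm⟩ hc
        · exact h
  exact this T 0 (Or.inr ⟨w, h⟩) (List.Subset.refl _)

namespace PolyFun

variable {α β : Type} [Enc α] [Enc β]

attribute [fun_prop] node dataFst dataSnd isNode leaf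

theorem parse : PolyFun parse := by
  have hstep : PolyFun fun p : List Bool × List Data × Bool => parseStep p.2.1 p.2.2 := by
    unfold parseStep
    fun_prop
  have h := foldl (l := fun l : List Bool => l.reverse) (s := fun _ => ([] : List Data))
    (f := fun _ s b => parseStep s b) (by fun_prop) (by fun_prop) hstep (2 * .X + 1)
    fun a l' hl => ?_
  · unfold StackProgram.parse
    fun_prop
  · have step : ∀ s b, esize (parseStep s b) ≤ esize s + 2 := by
      intro s b
      cases b with
      | false =>
        simp only [parseStep, cond_false, esize_cons]
        have : esize Data.leaf = 1 := rfl
        omega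
      | true =>
        rcases s with _ | ⟨x, _ | ⟨y, t⟩⟩
        · simp [parseStep, StackProgram.listCases]
        · simp [parseStep, StackProgram.listCases]
        · simp [parseStep, StackProgram.listCases]
          have : esize (x.node y) = esize x + esize y + 1 := rfl
          omega
    have : ∀ (l : List Bool) s, esize (l.foldl parseStep s) ≤ esize s + 2 * l.length := by
      intro l
      induction l with
      | nil => simp
      | cons b l ih =>
        intro s
        refine (ih _).trans ?_
        have := step s b
        simp only [List.length_cons]
        omega
    change esize (l'.foldl parseStep []) ≤ _
    have h1 := this l' []
    have h2 := hl.length_le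
    have h3 := length_lt_esize a
    simp at *
    omega

theorem toList : PolyFun Data.toList := of_enc_eq Data.enc_toList

@[fun_prop]
theorem toNat : PolyFun Data.toNat := by
  have := toList
  unfold Data.toNat
  fun_prop

theorem toTable : PolyFun Data.toTable := by
  have := toList
  unfold Data.toTable
  fun_prop

@[fun_prop]
theorem lookup {T : α → Table} {d I a : α → ℕ} (hT : PolyFun T) (hd : PolyFun d)
    (hI : PolyFun I) (ha : PolyFun a) : PolyFun fun p => lookup (T p) (d p) (I p) (a p) := by
  obtain ⟨Q, hQ⟩ := hT.exists_esize_le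
  refine foldl hT (s := fun _ => (0 : ℕ)) (f := fun p s e =>
    bif Nat.beq e.1.1 (d p) && (Nat.beq e.1.2.1 (I p) && Nat.beq e.1.2.2 (a p)) then e.2 else s)
    (by fun_prop) (by fun_prop) (Q + 1) fun p l' hl => ?_
  refine lookup_induction (P := fun w => esize w ≤ _) (T := l') ?_ fun w hw => ?_
  · simp [esize_nat]
  · have h1 := esize_le_of_mem (hl.mem hw)
    have h2 := hQ p
    simp at *
    omega

end PolyFun
end StackProgram

namespace EFG

open StackProgram

/-! ### Evaluation of a game while reading its code -/

/-- An unreduced fraction `(P - M) / D`. -/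
abbrev Frac : Type := ℕ × ℕ × ℕ

/-- The fraction `x + (n / d) * y`. -/
def Frac.addMul (x : Frac) (n d : ℕ) (y : Frac) : Frac :=
  (x.1 * (d * y.2.2) + n * y.1 * x.2.2, x.2.1 * (d * y.2.2) + n * y.2.1 * x.2.2,
    x.2.2 * (d * y.2.2))

/-- The kinds of items that are being read. -/
inductive Kind : Type
  | root
  | terminal
  | chance
  | decision (i : Player)

/-- What has been read of an unfinished item: the last number (reversed), its sign, the last
fraction, the number of children, the weighted sum of their values, and the sum of the weights. -/
structure Frame : Type where
  kind : Kind
  bits : List Bool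
  neg : Bool
  num : ℕ
  den : ℕ
  act : ℕ
  acc : Frac
  wsum : ℕ

/-- The state of the evaluation: the actions that were found, with their depths, the values of the
finished items, and the unfinished items. -/
structure State : Type where
  log : List (Player × ℕ × ℕ × ℕ)
  results : List Frac
  top : Frame
  stack : List Frame

def Frame.init (k : Kind) (w : ℕ) : Frame := ⟨k, [], false, 0, 0, 0, (0, 0, 1), w⟩

def Frame.number (f : Frame) : ℕ := ofBits f.bits.reverse

/-- Used at the end marker, when the digits being read are those of the denominator and the
numerator has been put aside at the slash. -/
def Frame.fraction (f : Frame) : Frac :=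
  bif f.neg then (0, f.num, f.number) else (f.num, 0, f.number)

def State.init : State := ⟨[], [], .init .root 0, []⟩

/-- Weights of the actions of the players, indexed by depth, information set and action. -/
abbrev Weights : Type := Player → ℕ → ℕ → ℕ → ℕ

/-- Processes the value of a child of the topmost item. -/
def feed (W : Weights) (v : Frac) (s : State) : State :=
  match s.top.kind with
  | .root => { s with results := v :: s.results }
  | .terminal => s
  | .chance =>
    { s with top := { s.top with neg := false, num := 0, den := 0,
                                 acc := s.top.acc.addMul s.top.num s.top.den v } }
  | .decision i =>
    { s with
      log := (i, s.stack.length, s.top.number, s.top.act) :: s.log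
      top := { s.top with
        act := s.top.act + 1
        acc := s.top.acc.addMul (W i s.stack.length s.top.number s.top.act) 1 v
        wsum := s.top.wsum + W i s.stack.length s.top.number s.top.act } }

/-- Finishes the topmost item, which has the value `v`. -/
def popFeed (W : Weights) (v : Frac) (s : State) : State :=
  listCases s.stack s fun f t => feed W v ⟨s.log, s.results, f, t⟩

def State.push (s : State) (k : Kind) (w : ℕ) : State :=
  ⟨s.log, s.results, .init k w, s.top :: s.stack⟩

/-- Finishes a fraction. -/
def endFraction (W : Weights) (s : State) : State :=
  match s.top.kind with
  | .root => { s with results := s.top.fraction :: s.results, top := .init .root 0 }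
  | .terminal => popFeed W s.top.fraction s
  | .chance => { s with top := { s.top with den := s.top.number, bits := [] } }
  | .decision _ => s

/-- The weight sum starts at `1` for a chance item and at `0` for a decision item. So the division
by it at the closing symbol is void for the former and normalises the weights for the latter. The
digits of a decision item are never cleared: they are its information set, read before the children.
-/
def step (W : Weights) (s : State) : Sym → State
  | .zero => { s with top := { s.top with bits := false :: s.top.bits } }
  | .one => { s with top := { s.top with bits := true :: s.top.bits } }
  | .minus => { s with top := { s.top with neg := true } }
  | .slash => { s with top := { s.top with num := s.top.number, bits := [] } }
  | .semicolon => endFraction W s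
  | .terminal => s.push .terminal 0
  | .chance => s.push .chance 1
  | .maximizer => s.push (.decision .maximizer) 0
  | .minimizer => s.push (.decision .minimizer) 0
  | .close => popFeed W (s.top.acc.1, s.top.acc.2.1, s.top.acc.2.2 * s.top.wsum) s

/-- The evaluation of a string. -/
def evaluate (W : Weights) (l : List Sym) : State := l.foldl (step W) .init

/-! ### The evaluation takes polynomial time -/

theorem finite_of_forall_mem {α : Type} (l : List α) (h : ∀ a, a ∈ l) : Finite α :=
  Set.finite_univ_iff.1 (l.finite_toSet.subset fun a _ => h a)

instance : Finite Player := finite_of_forall_mem [.maximizer, .minimizer] fun i => by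
  cases i <;> simp

instance : Finite Kind := finite_of_forall_mem
    [.root, .terminal, .chance, .decision .maximizer, .decision .minimizer] fun k => by
  rcases k with _ | _ | _ | (_ | _) <;> simp

instance : Finite Sym := finite_of_forall_mem [.zero, .one, .minus, .slash, .semicolon, .terminal,
    .chance, .maximizer, .minimizer, .close] fun c => by
  cases c <;> simp

noncomputable instance : Enc Player := Enc.ofFinite Player
noncomputable instance : Enc Kind := Enc.ofFinite Kind
noncomputable instance : Enc Sym := Enc.ofFinite Sym

def Frame.toTuple (f : Frame) : Kind × List Bool × Bool × ℕ × ℕ × ℕ × Frac × ℕ :=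
  (f.kind, f.bits, f.neg, f.num, f.den, f.act, f.acc, f.wsum)

noncomputable instance : Enc Frame := ⟨fun f => Enc.enc f.toTuple⟩

def State.toTuple (s : State) :
    List (Player × ℕ × ℕ × ℕ) × List Frac × Frame × List Frame :=
  (s.log, s.results, s.top, s.stack)

noncomputable instance : Enc State := ⟨fun s => Enc.enc s.toTuple⟩

section

variable {α : Type} [Enc α]

theorem polyFun_frameToTuple : PolyFun Frame.toTuple := .of_enc_eq fun _ => rfl

theorem polyFun_stateToTuple : PolyFun State.toTuple := .of_enc_eq fun _ => rfl

@[fun_prop]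
theorem polyFun_kind : PolyFun Frame.kind :=
  PolyFun.comp (g := fun p => p.1) (by fun_prop) polyFun_frameToTuple

@[fun_prop]
theorem polyFun_bits : PolyFun Frame.bits :=
  PolyFun.comp (g := fun p => p.2.1) (by fun_prop) polyFun_frameToTuple

@[fun_prop]
theorem polyFun_neg : PolyFun Frame.neg :=
  PolyFun.comp (g := fun p => p.2.2.1) (by fun_prop) polyFun_frameToTuple

@[fun_prop]
theorem polyFun_num : PolyFun Frame.num :=
  PolyFun.comp (g := fun p => p.2.2.2.1) (by fun_prop) polyFun_frameToTuple

@[fun_prop]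
theorem polyFun_den : PolyFun Frame.den :=
  PolyFun.comp (g := fun p => p.2.2.2.2.1) (by fun_prop) polyFun_frameToTuple

@[fun_prop]
theorem polyFun_act : PolyFun Frame.act :=
  PolyFun.comp (g := fun p => p.2.2.2.2.2.1) (by fun_prop) polyFun_frameToTuple

@[fun_prop]
theorem polyFun_acc : PolyFun Frame.acc :=
  PolyFun.comp (g := fun p => p.2.2.2.2.2.2.1) (by fun_prop) polyFun_frameToTuple

@[fun_prop]
theorem polyFun_wsum : PolyFun Frame.wsum :=
  PolyFun.comp (g := fun p => p.2.2.2.2.2.2.2) (by fun_prop) polyFun_frameToTuple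

@[fun_prop]
theorem polyFun_frameMk {k : α → Kind} {b : α → List Bool} {n : α → Bool} {p q r : α → ℕ}
    {v : α → Frac} {w : α → ℕ} (hk : PolyFun k) (hb : PolyFun b) (hn : PolyFun n) (hp : PolyFun p)
    (hq : PolyFun q) (hr : PolyFun r) (hv : PolyFun v) (hw : PolyFun w) :
    PolyFun fun a => Frame.mk (k a) (b a) (n a) (p a) (q a) (r a) (v a) (w a) :=
  (hk.prodMk (hb.prodMk (hn.prodMk (hp.prodMk (hq.prodMk (hr.prodMk
    (hv.prodMk hw))))))).congr_enc fun _ => rfl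

@[fun_prop]
theorem polyFun_log : PolyFun State.log :=
  PolyFun.comp (g := fun p => p.1) (by fun_prop) polyFun_stateToTuple

@[fun_prop]
theorem polyFun_results : PolyFun State.results :=
  PolyFun.comp (g := fun p => p.2.1) (by fun_prop) polyFun_stateToTuple

@[fun_prop]
theorem polyFun_top : PolyFun State.top :=
  PolyFun.comp (g := fun p => p.2.2.1) (by fun_prop) polyFun_stateToTuple

@[fun_prop]
theorem polyFun_stack : PolyFun State.stack :=
  PolyFun.comp (g := fun p => p.2.2.2) (by fun_prop) polyFun_stateToTuple

@[fun_prop]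
theorem polyFun_stateMk {l : α → List (Player × ℕ × ℕ × ℕ)} {r : α → List Frac} {t : α → Frame}
    {s : α → List Frame} (hl : PolyFun l) (hr : PolyFun r) (ht : PolyFun t) (hs : PolyFun s) :
    PolyFun fun a => State.mk (l a) (r a) (t a) (s a) :=
  (hl.prodMk (hr.prodMk (ht.prodMk hs))).congr_enc fun _ => rfl

@[fun_prop]
theorem polyFun_number : PolyFun Frame.number := by
  unfold Frame.number
  fun_prop

@[fun_prop]
theorem polyFun_fraction : PolyFun Frame.fraction := by
  unfold Frame.fraction
  fun_prop

@[fun_prop]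
theorem polyFun_addMul {x y : α → Frac} {n d : α → ℕ} (hx : PolyFun x) (hn : PolyFun n)
    (hd : PolyFun d) (hy : PolyFun y) : PolyFun fun a => (x a).addMul (n a) (d a) (y a) := by
  unfold Frac.addMul
  fun_prop

end

section

variable {θ : Type} [Enc θ] {W : θ → Weights}

/-- With a constant in place of the kind of the top item the match reduces, and the finitely many
cases are joined by `PolyFun.finite_cases`. -/
theorem polyFun_feed
    (hW : ∀ i, PolyFun fun p : θ × ℕ × ℕ × ℕ => W p.1 i p.2.1 p.2.2.1 p.2.2.2) :
    PolyFun fun p : θ × Frac × State => feed (W p.1) p.2.1 p.2.2 := by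
  refine (PolyFun.finite_cases (Enc.injective_ofFinite Kind)
    (f := fun k (p : θ × Frac × State) => feed (W p.1) p.2.1
      { p.2.2 with top := { p.2.2.top with kind := k } }) (fun k => ?_)
    (k := fun p => p.2.2.top.kind) (by fun_prop)).congr_enc fun _ => rfl
  rcases k with _ | _ | _ | i
  · simp only [feed]; fun_prop
  · simp only [feed]; fun_prop
  · simp only [feed]; fun_prop
  · have : PolyFun fun p : θ × Frac × State =>
        W p.1 i p.2.2.stack.length p.2.2.top.number p.2.2.top.act :=
      (hW i).comp (f := fun p : θ × Frac × State =>
        (p.1, p.2.2.stack.length, p.2.2.top.number, p.2.2.top.act)) (by fun_prop)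
    simp only [feed]
    fun_prop

theorem polyFun_popFeed
    (hW : ∀ i, PolyFun fun p : θ × ℕ × ℕ × ℕ => W p.1 i p.2.1 p.2.2.1 p.2.2.2) :
    PolyFun fun p : θ × Frac × State => popFeed (W p.1) p.2.1 p.2.2 := by
  refine PolyFun.listCases (by fun_prop) (by fun_prop) ?_
  exact (polyFun_feed hW).comp (f := fun p : (θ × Frac × State) × Frame × List Frame =>
    (p.1.1, p.1.2.1, State.mk p.1.2.2.log p.1.2.2.results p.2.1 p.2.2)) (by fun_prop)

theorem polyFun_endFraction
    (hW : ∀ i, PolyFun fun p : θ × ℕ × ℕ × ℕ => W p.1 i p.2.1 p.2.2.1 p.2.2.2) :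
    PolyFun fun p : θ × State => endFraction (W p.1) p.2 := by
  refine (PolyFun.finite_cases (Enc.injective_ofFinite Kind)
    (f := fun k (p : θ × State) => endFraction (W p.1)
      { p.2 with top := { p.2.top with kind := k } }) (fun k => ?_)
    (k := fun p => p.2.top.kind) (by fun_prop)).congr_enc fun _ => rfl
  rcases k with _ | _ | _ | i
  · simp only [endFraction]; fun_prop
  · exact (polyFun_popFeed hW).comp (f := fun p : θ × State => (p.1, p.2.top.fraction,
      { p.2 with top := { p.2.top with kind := .terminal } })) (by fun_prop)
  · simp only [endFraction, Frame.number]; fun_prop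
  · simp only [endFraction]; fun_prop

theorem polyFun_step
    (hW : ∀ i, PolyFun fun p : θ × ℕ × ℕ × ℕ => W p.1 i p.2.1 p.2.2.1 p.2.2.2) :
    PolyFun fun p : θ × State × Sym => step (W p.1) p.2.1 p.2.2 := by
  refine PolyFun.finite_cases (Enc.injective_ofFinite Sym)
    (f := fun c (p : θ × State × Sym) => step (W p.1) p.2.1 c) (fun c => ?_)
    (k := fun p => p.2.2) (by fun_prop)
  cases c
  case semicolon =>
    exact (polyFun_endFraction hW).comp (f := fun p : θ × State × Sym => (p.1, p.2.1))
      (by fun_prop)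
  case close =>
    exact (polyFun_popFeed hW).comp (f := fun p : θ × State × Sym => (p.1,
      (p.2.1.top.acc.1, p.2.1.top.acc.2.1, p.2.1.top.acc.2.2 * p.2.1.top.wsum), p.2.1))
      (by fun_prop)
  all_goals
    simp only [step, State.push]
    fun_prop

end

end EFG

namespace EFG

open StackProgram

/-! ### The states of the evaluation are small -/

theorem size_ofBits_le (l : List Bool) : (ofBits l).size ≤ l.length :=
  Nat.size_le.2 (ofBits_lt l)

theorem size_le_self (n : ℕ) : n.size ≤ n := Nat.size_le.2 n.lt_two_pow_self

def Frac.size (v : Frac) : ℕ := max v.1.size (max v.2.1.size v.2.2.size)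

/-- The action counter enters by its value, since it only ever grows by one. The summand `1` makes
the height of the stack at most the total size. -/
def Frame.size (f : Frame) : ℕ :=
  f.bits.length + f.num.size + f.den.size + f.act + f.acc.size + f.wsum.size + 1

/-- The log is left out and estimated separately through `LogGrows`, because a single entry may be
as long as the numbers in the state. -/
def State.size (s : State) : ℕ :=
  s.top.size + (s.stack.map Frame.size).sum + (s.results.map fun v => v.size + 1).sum

theorem size_mul_mul_add_le (a b c d e f : ℕ) :
    (a * (b * c) + d * e * f).size ≤
      max a.size f.size + max c.size e.size + b.size + d.size + 1 := by
  have := size_add_le (a * (b * c)) (d * e * f)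
  have := size_mul_le a (b * c)
  have := size_mul_le b c
  have := size_mul_le (d * e) f
  have := size_mul_le d e
  omega

/-- This is why fractions need not be reduced. The products in the two summands of a numerator pair
a factor from `x` with one from `y`, so lengths add up, with only one extra bit for the sum. -/
theorem Frac.size_addMul_le (x : Frac) (n d : ℕ) (y : Frac) :
    (x.addMul n d y).size ≤ x.size + y.size + n.size + d.size + 1 := by
  have h1 := size_mul_mul_add_le x.1 d y.2.2 n y.1 x.2.2
  have h2 := size_mul_mul_add_le x.2.1 d y.2.2 n y.2.1 x.2.2
  have h3 := size_mul_le x.2.2 (d * y.2.2)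
  have h4 := size_mul_le d y.2.2
  simp only [Frac.size, Frac.addMul] at *
  omega

theorem Frame.size_number_le (f : Frame) : f.number.size ≤ f.bits.length :=
  (size_ofBits_le _).trans (by simp)

theorem Frame.size_fraction_le (f : Frame) : f.fraction.size ≤ f.size := by
  have := f.size_number_le
  unfold Frame.fraction Frac.size Frame.size
  cases f.neg <;> simp <;> omega

theorem size_init_le (k : Kind) {w : ℕ} (hw : w ≤ 1) : (Frame.init k w).size ≤ 3 := by
  have := size_le_self w
  simp [Frame.init, Frame.size, Frac.size]
  omega

theorem length_le_size (l : List Frame) : l.length ≤ (l.map Frame.size).sum := by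
  induction l with
  | nil => simp
  | cons f l ih => simp [Frame.size]; omega

section

variable {W : Weights} {b : ℕ} (hb : ∀ i d I a, (W i d I a).size ≤ b)

include hb

theorem size_feed_le (v : Frac) (s : State) :
    (feed W v s).size ≤ s.size + v.size + 2 * b + 5 := by
  unfold feed
  split
  · simp [State.size]; omega
  · simp only [State.size]; omega
  · have := s.top.acc.size_addMul_le s.top.num s.top.den v
    simp [State.size, Frame.size]
    omega
  · rename_i i _
    have := s.top.acc.size_addMul_le (W i s.stack.length s.top.number s.top.act) 1 v
    have := size_add_le s.top.wsum (W i s.stack.length s.top.number s.top.act)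
    have := hb i s.stack.length s.top.number s.top.act
    have : Nat.size 1 = 1 := Nat.size_one
    simp only [State.size, Frame.size]
    omega

/-- The item that is removed pays for the value that it hands to its parent; hence the hypothesis
`hv`. -/
theorem size_popFeed_le (v : Frac) (s : State) (hv : v.size ≤ s.top.size) :
    (popFeed W v s).size ≤ s.size + 2 * b + 5 := by
  unfold popFeed
  rcases h : s.stack with _ | ⟨f, t⟩
  · simp [listCases]; omega
  · have := size_feed_le hb v ⟨s.log, s.results, f, t⟩
    simp only [listCases, State.size, h, List.map_cons, List.sum_cons] at *
    omega

/-- `State.size` is a potential: a symbol raises it by at most a constant plus twice the length `b`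
of a weight, so it stays polynomial during the whole pass. -/
theorem size_step_le (s : State) (c : Sym) : (step W s c).size ≤ s.size + 2 * b + 6 := by
  cases c
  case semicolon =>
    change (endFraction W s).size ≤ _
    have h1 := s.top.size_number_le
    have h2 := s.top.size_fraction_le
    unfold endFraction
    split
    · have := size_init_le .root (w := 0) (by omega)
      simp only [State.size, List.map_cons, List.sum_cons]
      omega
    · have := size_popFeed_le hb _ s h2
      omega
    · simp only [State.size, Frame.size, List.length_nil]; omega
    · omega
  case close =>
    have := size_mul_le s.top.acc.2.2 s.top.wsum
    have := size_popFeed_le hb (s.top.acc.1, s.top.acc.2.1, s.top.acc.2.2 * s.top.wsum) s (by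
      simp only [Frac.size, Frame.size]; omega)
    simp only [step]
    omega
  case slash =>
    have h1 := s.top.size_number_le
    simp only [step, State.size, Frame.size, List.length_nil]
    omega
  case terminal | chance | maximizer | minimizer =>
    all_goals
      simp only [step, State.push, State.size, List.map_cons, List.sum_cons]
      refine (Nat.add_le_add_right (Nat.add_le_add_right (size_init_le _ (by omega)) _) _).trans ?_
      omega
  all_goals
    simp only [step, State.size, Frame.size, List.length_cons]
    omega

end

/-- The log of a state grows by at most one entry. -/
def LogGrows (N : ℕ) (s s' : State) : Prop := s'.log = s.log ∨ ∃ e, s'.log = e :: s.log ∧ esize e ≤ N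

theorem exists_esize_le_of_finite (α : Type) [Finite α] [Enc α] : ∃ c, ∀ a : α, esize a ≤ c :=
  let ⟨c, hc⟩ := (Set.finite_range fun a : α => esize a).bddAbove
  ⟨c, fun a => hc ⟨a, rfl⟩⟩

theorem exists_logGrows_feed : ∃ K, ∀ W v s, LogGrows (8 * s.size + K) s (feed W v s) := by
  obtain ⟨c, hc⟩ := exists_esize_le_of_finite Player
  refine ⟨c + 6, fun W v s => ?_⟩
  unfold feed
  split
  iterate 3 exact Or.inl rfl
  rename_i i _
  refine Or.inr ⟨_, rfl, ?_⟩
  have := hc i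
  have := esize_le_size s.stack.length
  have := esize_le_size s.top.number
  have := esize_le_size s.top.act
  have := size_le_self s.stack.length
  have := size_le_self s.top.act
  have := s.top.size_number_le
  have := length_le_size s.stack
  simp only [esize_prod, State.size, Frame.size]
  omega

theorem exists_logGrows_step : ∃ K, ∀ W s c, LogGrows (8 * s.size + K) s (step W s c) := by
  obtain ⟨K, hK⟩ := exists_logGrows_feed
  have hpop : ∀ W v s, LogGrows (8 * s.size + K) s (popFeed W v s) := by
    intro W v s
    unfold popFeed
    rcases h : s.stack with _ | ⟨f, t⟩
    · exact Or.inl rfl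
    · refine (hK W v ⟨s.log, s.results, f, t⟩).imp_right fun ⟨e, he, he'⟩ => ⟨e, he, he'.trans ?_⟩
      simp only [State.size, h, List.map_cons, List.sum_cons]
      omega
  refine ⟨K, fun W s c => ?_⟩
  cases c
  case semicolon =>
    simp only [step, endFraction]
    split
    case h_2 => exact hpop W _ s
    all_goals exact Or.inl rfl
  case close => exact hpop W _ s
  all_goals exact Or.inl rfl

theorem esize_frac_le (v : Frac) : esize v ≤ 12 * v.size + 5 := by
  have := esize_le_size v.1
  have := esize_le_size v.2.1
  have := esize_le_size v.2.2
  simp only [esize_prod, Frac.size]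
  omega

theorem exists_esize_frame_le : ∃ K, ∀ f : Frame, esize f ≤ K * f.size := by
  obtain ⟨c, hc⟩ := exists_esize_le_of_finite Kind
  refine ⟨c + 60, fun f => ?_⟩
  have h : esize f = esize f.toTuple := rfl
  have := hc f.kind
  have := esize_bits_le f.bits
  have := esize_bool_le f.neg
  have := esize_le_size f.num
  have := esize_le_size f.den
  have := esize_le_size f.act
  have := size_le_self f.act
  have := esize_frac_le f.acc
  have := esize_le_size f.wsum
  have h1 : esize f ≤ c + 12 * f.size + 40 := by
    rw [h]
    simp only [Frame.toTuple, esize_prod] at *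
    simp only [Frame.size]
    omega
  have h2 : 1 ≤ f.size := by simp [Frame.size]
  nlinarith

theorem exists_esize_state_le : ∃ K, ∀ s : State, esize s ≤ K * s.size + esize s.log + K := by
  obtain ⟨K, hK⟩ := exists_esize_frame_le
  have hstack : ∀ l : List Frame, esize l ≤ (K + 1) * (l.map Frame.size).sum + 1 := by
    intro l
    induction l with
    | nil => simp
    | cons f l ih =>
      have := hK f
      have h2 : 1 ≤ f.size := by simp [Frame.size]
      simp only [esize_cons, List.map_cons, List.sum_cons]
      nlinarith
  have hres : ∀ l : List Frac, esize l ≤ 12 * (l.map fun v => v.size + 1).sum + 1 := by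
    intro l
    induction l with
    | nil => simp
    | cons v l ih =>
      have := esize_frac_le v
      simp only [esize_cons, List.map_cons, List.sum_cons]
      omega
  refine ⟨K + 12, fun s => ?_⟩
  have h : esize s = esize s.toTuple := rfl
  have := hK s.top
  have := hstack s.stack
  have := hres s.results
  rw [h]
  have key : ∀ x y z, K * x + (K + 1) * y + 12 * z + 5 ≤ (K + 12) * (x + y + z) + (K + 12) :=
    fun x y z => by nlinarith [Nat.zero_le (K * z)]
  have := key s.top.size (s.stack.map Frame.size).sum (s.results.map fun v => v.size + 1).sum
  simp only [State.toTuple, esize_prod, State.size]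
  linarith

/-- The potential stays below `S`, each log entry is linear in the potential, and there is at most
one new entry for each symbol. This bounds every intermediate state, as the closure under folds
requires. -/
theorem polyFun_evaluate {θ : Type} [Enc θ] {W : θ → Weights}
    (hW : ∀ i, PolyFun fun p : θ × ℕ × ℕ × ℕ => W p.1 i p.2.1 p.2.2.1 p.2.2.2) (B : Polynomial ℕ)
    (hB : ∀ p i d I a, (W p i d I a).size ≤ B.eval (esize p)) :
    PolyFun fun p : θ × List Sym => evaluate (W p.1) p.2 := by
  obtain ⟨K, hK⟩ := exists_logGrows_step
  obtain ⟨K', hK'⟩ := exists_esize_state_le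
  have hstep : PolyFun fun p : (θ × List Sym) × State × Sym => step (W p.1.1) p.2.1 p.2.2 :=
    (polyFun_step hW).comp (f := fun p : (θ × List Sym) × State × Sym => (p.1.1, p.2.1, p.2.2))
      (by fun_prop)
  let S : Polynomial ℕ := 3 + .X * (2 * B + 6)
  refine PolyFun.foldl (l := fun p : θ × List Sym => p.2) (s := fun _ => State.init)
    (f := fun p s c => step (W p.1) s c) (by fun_prop) (by fun_prop) hstep
    (.C K' * S + (.X * (8 * S + .C K + 1) + 1) + .C K') fun p l' hl => ?_
  set n := esize p
  have hlen : l'.length ≤ n := by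
    have := hl.length_le
    have := length_lt_esize p.2
    simp only [n, esize_prod]
    omega
  have hb : ∀ i d I a, (W p.1 i d I a).size ≤ B.eval n := fun i d I a =>
    (hB p.1 i d I a).trans (eval_le_eval_of_le B (by simp only [n, esize_prod]; omega))
  have key : ∀ l : List Sym, l.length ≤ n →
      (l.foldl (step (W p.1)) .init).size ≤ 3 + l.length * (2 * B.eval n + 6) ∧
      esize (l.foldl (step (W p.1)) .init).log ≤ l.length * (8 * S.eval n + K + 1) + 1 := by
    intro l
    induction l using List.reverseRecOn with
    | nil =>
      intro _
      refine ⟨?_, by simp [State.init]⟩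
      have := size_init_le .root (w := 0) (by omega)
      simpa [State.init, State.size] using this
    | append_singleton l c ih =>
      intro hl
      simp only [List.length_append, List.length_singleton] at hl ⊢
      obtain ⟨h1, h2⟩ := ih (by omega)
      rw [List.foldl_append, List.foldl_cons, List.foldl_nil]
      have h3 := size_step_le hb (l.foldl (step (W p.1)) .init) c
      refine ⟨h3.trans (by linarith), ?_⟩
      have h4 : 3 + l.length * (2 * B.eval n + 6) ≤ S.eval n := by
        simp only [S, Polynomial.eval_add, Polynomial.eval_mul, Polynomial.eval_X,
          Polynomial.eval_ofNat]
        gcongr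
        omega
      rcases hK (W p.1) (l.foldl (step (W p.1)) .init) c with h | ⟨e, h, he⟩
      · rw [h]
        nlinarith
      · rw [h, esize_cons]
        nlinarith
  obtain ⟨h1, h2⟩ := key l' hlen
  refine (hK' _).trans ?_
  simp only [S, Polynomial.eval_add, Polynomial.eval_mul, Polynomial.eval_X,
    Polynomial.eval_ofNat, Polynomial.eval_C, Polynomial.eval_one] at h1 h2 ⊢
  gcongr
  · exact h1.trans (by gcongr)
  · exact h2.trans (by gcongr)

end EFG

namespace EFG

open StackProgram

/-! ### The evaluation computes the values of game trees -/

/-- A rational number as a fraction. -/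
def Frac.ofRat (q : ℚ) : Frac :=
  bif decide (q < 0) then (0, q.num.natAbs, q.den) else (q.num.natAbs, 0, q.den)

/-- The value of a game tree at depth `d`, if actions are played with probabilities proportional
to the given weights. -/
def GameTree.value (W : Weights) : GameTree → ℕ → Frac
  | .terminal u, _ => .ofRat u
  | .chance k p c, d => (List.finRange k).foldl (fun (x : Frac) (a : Fin k) =>
      x.addMul (p a).num.natAbs (p a).den ((c a).value W (d + 1))) (0, 0, 1)
  | .decision i I k c, d =>
      let x := (List.finRange k).foldl (fun (x : Frac) (a : Fin k) =>
        x.addMul (W i d I a) 1 ((c a).value W (d + 1))) (0, 0, 1)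
      (x.1, x.2.1, x.2.2 * ((List.finRange k).map fun a : Fin k => W i d I a).sum)

/-- The actions in a game tree at depth `d`, with their depths. -/
def GameTree.log : GameTree → ℕ → List (Player × ℕ × ℕ × ℕ)
  | .terminal _, _ => []
  | .chance k _ c, d => (List.finRange k).foldl (fun l (a : Fin k) => (c a).log (d + 1) ++ l) []
  | .decision i I k c, d =>
      (List.finRange k).foldl (fun l (a : Fin k) => (i, d, I, ↑a) :: ((c a).log (d + 1) ++ l)) []

section

variable {W : Weights}

theorem foldl_encodeNat (n : ℕ) (s : State) : (encodeNat n).foldl (step W) s =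
    { s with top := { s.top with bits := n.bits.reverse ++ s.top.bits } } := by
  unfold encodeNat
  generalize n.bits = l
  induction l generalizing s with
  | nil => rfl
  | cons b l ih =>
    rw [List.map_cons, List.foldl_cons, ih]
    cases b <;> simp [step]

theorem foldl_encodeRat (q : ℚ) (s : State) (hb : s.top.bits = []) (hn : s.top.neg = false) :
    (encodeRat q).foldl (step W) s = endFraction W { s with
      top := { s.top with neg := decide (q < 0), num := q.num.natAbs, bits := q.den.bits.reverse } }
    := by
  have h : ∀ s : State, s.top.bits = [] →
      (encodeNat q.num.natAbs ++ [Sym.slash] ++ encodeNat q.den ++ [Sym.semicolon]).foldl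
        (step W) s = endFraction W { s with
          top := { s.top with num := q.num.natAbs, bits := q.den.bits.reverse } } := by
    intro s hb
    simp only [List.foldl_append, foldl_encodeNat, List.foldl_cons, List.foldl_nil, step, hb,
      List.append_nil, Frame.number, List.reverse_reverse, ofBits_bits]
  unfold encodeRat
  by_cases hq : q < 0
  · simp only [hq, if_true, List.cons_append, List.nil_append, List.foldl_cons]
    rw [h _ (by simpa [step] using hb)]
    simp [step]
  · simp only [hq, if_false, List.nil_append]
    rw [h _ hb]
    simp [hn]

theorem fraction_eq_ofRat (k : Kind) (q : ℚ) (d j : ℕ) (x : Frac) (w : ℕ) :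
    Frame.fraction ⟨k, q.den.bits.reverse, decide (q < 0), q.num.natAbs, d, j, x, w⟩ = .ofRat q := by
  simp [Frame.fraction, Frame.number, Frac.ofRat]

/-- From any state, reading the code of a subtree amounts to feeding its value to the open item. In
this generality the statement passes to children, whose elder siblings are already accumulated. The
depth is the height of the stack; as the item `root` lies at the bottom, the root of a game has
depth `1`. -/
theorem foldl_encode (t : GameTree) (s : State) : t.encode.foldl (step W) s =
    feed W (t.value W (s.stack.length + 1)) { s with log := t.log (s.stack.length + 1) ++ s.log } := by
  induction t generalizing s with
  | terminal u =>
    rw [GameTree.encode, List.foldl_cons, foldl_encodeRat _ _ rfl rfl]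
    simp only [endFraction, step, State.push, Frame.init, popFeed, listCases, GameTree.value,
      GameTree.log, List.nil_append]
    rw [fraction_eq_ofRat]
  | chance k p c ih =>
    have loop : ∀ (l : List (Fin k)) (x : Frac) L r f,
        (l.flatMap fun a => encodeRat (p a) ++ (c a).encode).foldl (step W)
          ⟨L, r, ⟨.chance, [], false, 0, 0, 0, x, 1⟩, f⟩ =
        ⟨l.foldl (fun l (a : Fin k) => (c a).log (f.length + 1) ++ l) L, r, ⟨.chance, [], false, 0, 0, 0,
          l.foldl (fun (x : Frac) (a : Fin k) =>
            x.addMul (p a).num.natAbs (p a).den ((c a).value W (f.length + 1))) x, 1⟩, f⟩ := by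
      intro l
      induction l with
      | nil => intros; rfl
      | cons a l ihl =>
        intro x L r f
        rw [List.flatMap_cons, List.foldl_append, List.foldl_append, foldl_encodeRat _ _ rfl rfl]
        simp only [endFraction, Frame.number, List.reverse_reverse, ofBits_bits, ih, feed]
        exact ihl _ _ _ _
    have hlog : ∀ (l : List (Fin k)) d (L L' : List (Player × ℕ × ℕ × ℕ)),
        l.foldl (fun l (a : Fin k) => (c a).log d ++ l) (L ++ L') =
          l.foldl (fun l (a : Fin k) => (c a).log d ++ l) L ++ L' := by
      intro l d
      induction l with
      | nil => intros; rfl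
      | cons a l ihl =>
        intro L L'
        simp only [List.foldl_cons]
        rw [← ihl, List.append_assoc]
    rw [GameTree.encode, List.foldl_append, List.foldl_cons]
    simp only [step, State.push, Frame.init, loop, List.foldl_cons, List.foldl_nil, popFeed,
      listCases, mul_one]
    rw [← List.nil_append s.log, hlog]
    rfl
  | decision i I k c ih =>
    -- The second condition says that the remaining children are numbered consecutively from the
    -- action counter `j`.
    have loop : ∀ (l : List (Fin k)) (x : Frac) L r f b j w, ofBits b.reverse = I →
        l.map Fin.val = List.range' j l.length →
        (l.flatMap fun a => (c a).encode).foldl (step W)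
          ⟨L, r, ⟨.decision i, b, false, 0, 0, j, x, w⟩, f⟩ =
        ⟨l.foldl (fun l (a : Fin k) => (i, f.length, I, ↑a) :: ((c a).log (f.length + 1) ++ l)) L, r,
          ⟨.decision i, b, false, 0, 0, j + l.length, l.foldl (fun (x : Frac) (a : Fin k) =>
            x.addMul (W i f.length I a) 1 ((c a).value W (f.length + 1))) x,
            w + (l.map fun a : Fin k => W i f.length I a).sum⟩, f⟩ := by
      intro l
      induction l with
      | nil => intros; simp
      | cons a l ihl =>
        intro x L r f b j w hI hj
        rw [List.map_cons, List.length_cons, List.range'_succ, List.cons.injEq] at hj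
        rw [List.flatMap_cons, List.foldl_append, ih]
        simp only [feed, Frame.number, hI]
        rw [ihl _ _ _ _ _ _ _ hI hj.2]
        simp only [List.foldl_cons, List.map_cons, List.sum_cons, List.length_cons, hj.1,
          add_assoc, add_comm 1]
    have hlog : ∀ (l : List (Fin k)) d (L L' : List (Player × ℕ × ℕ × ℕ)),
        l.foldl (fun l (a : Fin k) => (i, d, I, ↑a) :: ((c a).log (d + 1) ++ l)) (L ++ L') =
          l.foldl (fun l (a : Fin k) => (i, d, I, ↑a) :: ((c a).log (d + 1) ++ l)) L ++ L' := by
      intro l d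
      induction l with
      | nil => intros; rfl
      | cons a l ihl =>
        intro L L'
        simp only [List.foldl_cons]
        rw [← ihl, List.cons_append, List.append_assoc]
    have hpush : ∀ s, step W s (match i with | .maximizer => .maximizer | .minimizer => .minimizer)
        = s.push (.decision i) 0 := by cases i <;> intro s <;> rfl
    have hk : (List.finRange k).map Fin.val = List.range' 0 (List.finRange k).length := by
      simp [List.range_eq_range']
    have henc : (GameTree.decision i I k c).encode =
        (match i with | .maximizer => Sym.maximizer | .minimizer => Sym.minimizer) ::
          encodeNat I ++ ((List.finRange k).flatMap fun a => (c a).encode) ++ [Sym.close] := rfl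
    rw [henc, List.foldl_append, List.foldl_append,
      List.foldl_cons (l := encodeNat I), hpush,
      foldl_encodeNat]
    simp only [State.push, Frame.init]
    rw [loop _ _ _ _ _ _ _ _ (by simp) hk]
    simp only [List.length_cons, List.foldl_cons, List.foldl_nil, step, popFeed, listCases, zero_add]
    rw [← List.nil_append s.log, hlog]
    rfl

/-- Evaluation of the code of an input. -/
theorem evaluate_encode (J : Input) : evaluate W J.encode =
    ⟨J.game.tree.log 1, [.ofRat J.ε, .ofRat J.v, J.game.tree.value W 1], .init .root 0, []⟩ := by
  have h : ∀ q L r, (encodeRat q).foldl (step W) ⟨L, r, .init .root 0, []⟩ =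
      ⟨L, .ofRat q :: r, .init .root 0, []⟩ := by
    intro q L r
    rw [foldl_encodeRat _ _ rfl rfl]
    simp only [endFraction, Frame.init]
    rw [fraction_eq_ofRat]
  rw [evaluate, Input.encode, List.foldl_append, List.foldl_append, foldl_encode]
  simp only [State.init, feed, Frame.init, List.length_nil, List.append_nil, zero_add]
  have h1 := h J.v (J.game.tree.log 1) [J.game.tree.value W 1]
  have h2 := h J.ε (J.game.tree.log 1) [.ofRat J.v, J.game.tree.value W 1]
  rw [Frame.init] at h1 h2
  rw [h1, h2]

end

end EFG

namespace EFG

open StackProgram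

/-! ### Utilities of game trees -/

/-- A property of all decision nodes of a tree at depth `d`. -/
def GameTree.Forall (P : Player → ℕ → ℕ → ℕ → Prop) : GameTree → ℕ → Prop
  | .terminal _, _ => True
  | .chance _ _ c, d => ∀ a, (c a).Forall P (d + 1)
  | .decision i I k c, d => P i d I k ∧ ∀ a, (c a).Forall P (d + 1)

/-- Nature plays probability distributions. -/
def GameTree.IsDistribution : GameTree → Prop
  | .terminal _ => True
  | .chance _ p c => ((∀ a, 0 ≤ p a) ∧ ∑ a, p a = 1) ∧ ∀ a, (c a).IsDistribution
  | .decision _ _ _ c => ∀ a, (c a).IsDistribution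

/-- Strategies of both players, indexed by depth, information set and action. -/
abbrev Strategy : Type := Player → ℕ → ℕ → ℕ → ℝ

/-- The expected payoff of a game tree at depth `d`. -/
def GameTree.utility (σ : Strategy) : GameTree → ℕ → ℝ
  | .terminal u, _ => u
  | .chance _ p c, d => ∑ a, (p a : ℝ) * (c a).utility σ (d + 1)
  | .decision i I k c, d => ∑ a : Fin k, σ i d I a * (c a).utility σ (d + 1)

/-- The strategies play probability distributions. -/
def Strategy.Proper (σ : Strategy) (i : Player) (d I k : ℕ) : Prop :=
  (∀ a < k, 0 ≤ σ i d I a) ∧ ∑ a ∈ Finset.range k, σ i d I a = 1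

section

variable {P Q : Player → ℕ → ℕ → ℕ → Prop}

theorem GameTree.Forall.mono (h : ∀ i d I k, P i d I k → Q i d I k) {t : GameTree} {d : ℕ}
    (ht : t.Forall P d) : t.Forall Q d := by
  induction t generalizing d with
  | terminal u => trivial
  | chance k p c ih => exact fun a => ih a (ht a)
  | decision i I k c ih => exact ⟨h _ _ _ _ ht.1, fun a => ih a (ht.2 a)⟩

theorem GameTree.Forall.and {t : GameTree} {d : ℕ} (hP : t.Forall P d) (hQ : t.Forall Q d) :
    t.Forall (fun i d I k => P i d I k ∧ Q i d I k) d := by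
  induction t generalizing d with
  | terminal u => trivial
  | chance k p c ih => exact fun a => ih a (hP a) (hQ a)
  | decision i I k c ih => exact ⟨⟨hP.1, hQ.1⟩, fun a => ih a (hP.2 a) (hQ.2 a)⟩

/-- A property of all decision nodes at depth at least `d` holds for subtrees at depth `d`. -/
theorem GameTree.Forall.le_depth {t : GameTree} {d : ℕ} (hP : t.Forall P d) :
    t.Forall (fun i e I k => d ≤ e ∧ P i e I k) d := by
  induction t generalizing d with
  | terminal u => trivial
  | chance k p c ih =>
    exact fun a => (ih a (hP a)).mono fun _ _ _ _ h => ⟨by omega, h.2⟩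
  | decision i I k c ih =>
    exact ⟨⟨le_rfl, hP.1⟩, fun a => (ih a (hP.2 a)).mono fun _ _ _ _ h => ⟨by omega, h.2⟩⟩

theorem GameTree.forall_of_forall (h : ∀ i d I k, P i d I k) (t : GameTree) (d : ℕ) :
    t.Forall P d := by
  induction t generalizing d with
  | terminal u => trivial
  | chance k p c ih => exact fun a => ih a _
  | decision i I k c ih => exact ⟨h _ _ _ _, fun a => ih a _⟩

/-- Translates between recursion on the tree, in which the proofs proceed, and histories, in which
games are defined. -/
theorem GameTree.forall_iff {t : GameTree} {d : ℕ} : t.Forall P d ↔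
    ∀ i I k h, t.MemInfoset i I k h → P i (d + h.path.length) I k := by
  induction t generalizing d with
  | terminal u =>
    simp [Forall, MemInfoset, histories]
  | chance k p c ih =>
    simp only [Forall, ih]
    constructor
    · rintro H i I k h ⟨hm, c', hc⟩
      simp only [histories, List.mem_cons, List.mem_flatMap, List.mem_map] at hm
      rcases hm with rfl | ⟨a, -, h, hm, rfl⟩
      · simp at hc
      · have := H a i I k h ⟨hm, c', hc⟩
        rw [List.length_cons, ← add_assoc, add_right_comm]
        exact this
    · rintro H a i I k h ⟨hm, c', hc⟩
      have := H i I k ⟨Step.chance a (p a) :: h.path, h.subtree⟩ ⟨by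
        simp only [histories, List.mem_cons, List.mem_flatMap, List.mem_map]
        exact Or.inr ⟨a, by simp, h, hm, rfl⟩, c', hc⟩
      rwa [List.length_cons, ← add_assoc, add_right_comm] at this
  | decision j J k c ih =>
    simp only [Forall, ih]
    constructor
    · rintro ⟨H0, H⟩ i I k h ⟨hm, c', hc⟩
      simp only [histories, List.mem_cons, List.mem_flatMap, List.mem_map] at hm
      rcases hm with rfl | ⟨a, -, h, hm, rfl⟩
      · simp only [GameTree.decision.injEq] at hc
        obtain ⟨rfl, rfl, rfl, -⟩ := hc
        exact H0
      · have := H a i I k h ⟨hm, c', hc⟩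
        rw [List.length_cons, ← add_assoc, add_right_comm]
        exact this
    · refine fun H => ⟨H j J k ⟨[], _⟩ ⟨by simp [histories], c, rfl⟩, ?_⟩
      rintro a i I k h ⟨hm, c', hc⟩
      have := H i I k ⟨Step.decision j J a :: h.path, h.subtree⟩ ⟨by
        simp only [histories, List.mem_cons, List.mem_flatMap, List.mem_map]
        exact Or.inr ⟨a, by simp, h, hm, rfl⟩, c', hc⟩
      rwa [List.length_cons, ← add_assoc, add_right_comm] at this

end

theorem GameTree.isDistribution_of_histories {t : GameTree} (H : ∀ h ∈ t.histories, ∀ k p c,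
    h.subtree = .chance k p c → (∀ a, 0 ≤ p a) ∧ ∑ a, p a = 1) : t.IsDistribution := by
  induction t with
  | terminal u => trivial
  | chance k p c ih =>
    refine ⟨H _ (by rw [histories]; exact List.mem_cons_self ..) k p c rfl, fun a => ih a ?_⟩
    intro h hm
    refine H ⟨Step.chance a (p a) :: h.path, h.subtree⟩ ?_
    simp only [histories, List.mem_cons, List.mem_flatMap, List.mem_map]
    exact Or.inr ⟨a, by simp, h, hm, rfl⟩
  | decision i I k c ih =>
    intro a
    refine ih a fun h hm => H ⟨Step.decision i I a :: h.path, h.subtree⟩ ?_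
    simp only [histories, List.mem_cons, List.mem_flatMap, List.mem_map]
    exact Or.inr ⟨a, by simp, h, hm, rfl⟩

theorem Game.isDistribution (G : Game) : G.tree.IsDistribution :=
  GameTree.isDistribution_of_histories G.chance_distribution

/-- Lets a single pass over the log stand for a check of all actions at all decision nodes. -/
theorem GameTree.mem_log_iff {t : GameTree} {d : ℕ} {Q : Player → ℕ → ℕ → ℕ → Prop} :
    (∀ x ∈ t.log d, Q x.1 x.2.1 x.2.2.1 x.2.2.2) ↔
      t.Forall (fun i d I k => ∀ a < k, Q i d I a) d := by
  induction t generalizing d with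
  | terminal u => simp [log, Forall]
  | chance k p c ih =>
    have : ∀ (l : List (Fin k)) x L, x ∈ l.foldl (fun l (a : Fin k) => (c a).log (d + 1) ++ l) L ↔
        x ∈ L ∨ ∃ a ∈ l, x ∈ (c a).log (d + 1) := by
      intro l
      induction l with
      | nil => simp
      | cons a l ihl =>
        intro x L
        rw [List.foldl_cons, ihl]
        simp only [List.mem_append, List.mem_cons, exists_eq_or_imp]
        tauto
    simp only [log, Forall, this, ← ih]
    simp only [List.not_mem_nil, List.mem_finRange, true_and, false_or, forall_exists_index]
    exact forall_comm
  | decision i I k c ih =>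
    have : ∀ (l : List (Fin k)) x L,
        x ∈ l.foldl (fun l (a : Fin k) => (i, d, I, (a : ℕ)) :: ((c a).log (d + 1) ++ l)) L ↔
        x ∈ L ∨ ∃ a ∈ l, x = (i, d, I, (a : ℕ)) ∨ x ∈ (c a).log (d + 1) := by
      intro l
      induction l with
      | nil => simp
      | cons a l ihl =>
        intro x L
        rw [List.foldl_cons, ihl]
        simp only [List.mem_append, List.mem_cons, exists_eq_or_imp]
        ac_nf
    simp only [log, Forall, this, ← ih]
    simp only [List.not_mem_nil, List.mem_finRange, true_and, false_or]
    constructor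
    · intro H
      exact ⟨fun a ha => H (i, d, I, a) ⟨⟨a, ha⟩, Or.inl rfl⟩, fun a x hx => H x ⟨a, Or.inr hx⟩⟩
    · rintro ⟨H1, H2⟩ x ⟨a, rfl | hx⟩
      · exact H1 a a.2
      · exact H2 a x hx

theorem GameTree.utility_congr {σ τ : Strategy} {t : GameTree} {d : ℕ}
    (h : t.Forall (fun i d I k => ∀ a < k, σ i d I a = τ i d I a) d) :
    t.utility σ d = t.utility τ d := by
  induction t generalizing d with
  | terminal u => rfl
  | chance k p c ih =>
    exact Finset.sum_congr rfl fun a _ => by rw [ih a (h a)]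
  | decision i I k c ih =>
    exact Finset.sum_congr rfl fun a _ => by rw [ih a (h.2 a), h.1 a a.2]

/-- All payoffs of the tree have absolute value at most `M`. -/
def GameTree.Bounded (M : ℝ) : GameTree → Prop
  | .terminal u => |(u : ℝ)| ≤ M
  | .chance _ _ c => ∀ a, (c a).Bounded M
  | .decision _ _ _ c => ∀ a, (c a).Bounded M

theorem abs_sum_mul_le {k : ℕ} {q v : Fin k → ℝ} {M : ℝ} (h0 : ∀ a, 0 ≤ q a) (h1 : ∑ a, q a = 1)
    (hv : ∀ a, |v a| ≤ M) : |∑ a, q a * v a| ≤ M :=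
  calc |∑ a, q a * v a| ≤ ∑ a, |q a * v a| := Finset.abs_sum_le_sum_abs _ _
    _ ≤ ∑ a, q a * M := Finset.sum_le_sum fun a _ => by
      rw [abs_mul, abs_of_nonneg (h0 a)]
      exact mul_le_mul_of_nonneg_left (hv a) (h0 a)
    _ = M := by rw [← Finset.sum_mul, h1, one_mul]

theorem GameTree.IsDistribution.cast {k : ℕ} {p : Fin k → ℚ} {c : Fin k → GameTree}
    (h : (GameTree.chance k p c).IsDistribution) :
    (∀ a, (0 : ℝ) ≤ p a) ∧ ∑ a, (p a : ℝ) = 1 :=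
  ⟨fun a => by exact_mod_cast h.1.1 a, by exact_mod_cast h.1.2⟩

theorem GameTree.abs_utility_le {M : ℝ} {σ : Strategy} {t : GameTree} {d : ℕ}
    (hM : t.Bounded M) (ht : t.IsDistribution) (hσ : t.Forall σ.Proper d) :
    |t.utility σ d| ≤ M := by
  induction t generalizing d with
  | terminal u => exact hM
  | chance k p c ih =>
    exact abs_sum_mul_le ht.cast.1 ht.cast.2 fun a => ih a (hM a) (ht.2 a) (hσ a)
  | decision i I k c ih =>
    refine abs_sum_mul_le (fun a => hσ.1.1 a a.2) ?_ fun a => ih a (hM a) (ht a) (hσ.2 a)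
    rw [← hσ.1.2, Finset.sum_range]

/-- The number of edges of the tree. -/
def GameTree.edges : GameTree → ℕ
  | .terminal _ => 0
  | .chance _ _ c => ∑ a, ((c a).edges + 1)
  | .decision _ _ _ c => ∑ a, ((c a).edges + 1)

/-- At a decision node `s * v - t * w = (s - t) * v + t * (v - w)`. The first term costs `δ * M` for
the edge, and `t ≤ 1` lets the errors of the subtrees add up. A chance node only averages the errors
of its subtrees. -/
theorem GameTree.abs_utility_sub_le {M δ : ℝ} {σ τ : Strategy} {t : GameTree} {d : ℕ}
    (hM : t.Bounded M) (hM0 : 0 ≤ M) (hδ : 0 ≤ δ) (ht : t.IsDistribution)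
    (hσ : t.Forall σ.Proper d) (hτ : t.Forall τ.Proper d)
    (h : t.Forall (fun i d I k => ∀ a < k, |σ i d I a - τ i d I a| ≤ δ) d) :
    |t.utility σ d - t.utility τ d| ≤ δ * M * t.edges := by
  induction t generalizing d with
  | terminal u => simp [utility, edges]
  | chance k p c ih =>
    simp only [utility, ← Finset.sum_sub_distrib, ← mul_sub]
    refine abs_sum_mul_le ht.cast.1 ht.cast.2 fun a =>
      (ih a (hM a) (ht.2 a) (hσ a) (hτ a) (h a)).trans ?_
    have : (c a).edges ≤ (GameTree.chance k p c).edges :=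
      (Nat.le_succ _).trans (Finset.single_le_sum (f := fun a => (c a).edges + 1)
        (fun _ _ => Nat.zero_le _) (Finset.mem_univ a))
    gcongr
  | decision i I k c ih =>
    have hle : ∀ a : Fin k, τ i d I a ≤ 1 := fun a => by
      rw [← hτ.1.2]
      exact Finset.single_le_sum (f := fun a => τ i d I a)
        (fun b hb => hτ.1.1 b (Finset.mem_range.1 hb)) (Finset.mem_range.2 a.2)
    simp only [utility, edges, Nat.cast_sum, Finset.mul_sum, ← Finset.sum_sub_distrib]
    refine (Finset.abs_sum_le_sum_abs _ _).trans (Finset.sum_le_sum fun a _ => ?_)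
    have h1 := ih a (hM a) (ht a) (hσ.2 a) (hτ.2 a) (h.2 a)
    have h2 := abs_utility_le (hM a) (ht a) (hσ.2 a)
    have h3 := h.1 a a.2
    have h4 := hτ.1.1 a a.2
    calc |σ i d I a * (c a).utility σ (d + 1) - τ i d I a * (c a).utility τ (d + 1)|
        = |(σ i d I a - τ i d I a) * (c a).utility σ (d + 1) +
            τ i d I a * ((c a).utility σ (d + 1) - (c a).utility τ (d + 1))| := by ring_nf
      _ ≤ |σ i d I a - τ i d I a| * |(c a).utility σ (d + 1)| +
            τ i d I a * |(c a).utility σ (d + 1) - (c a).utility τ (d + 1)| := by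
          refine (abs_add_le _ _).trans_eq ?_
          rw [abs_mul, abs_mul, abs_of_nonneg h4]
      _ ≤ δ * M + 1 * (δ * M * (c a).edges) := by
          gcongr
          exact hle a
      _ = δ * M * ((c a).edges + 1 : ℕ) := by push_cast; ring

/-! ### The values of fractions -/

noncomputable def Frac.toReal (v : Frac) : ℝ := ((v.1 : ℝ) - v.2.1) / v.2.2

theorem Frac.toReal_addMul {x y : Frac} {n d : ℕ} (hx : x.2.2 ≠ 0) (hd : d ≠ 0) (hy : y.2.2 ≠ 0) :
    (x.addMul n d y).toReal = x.toReal + n / d * y.toReal := by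
  have hx : (x.2.2 : ℝ) ≠ 0 := by exact_mod_cast hx
  have hd : (d : ℝ) ≠ 0 := by exact_mod_cast hd
  have hy : (y.2.2 : ℝ) ≠ 0 := by exact_mod_cast hy
  simp only [toReal, addMul]
  push_cast
  field_simp
  ring

theorem Frac.toReal_ofRat (q : ℚ) : (Frac.ofRat q).toReal = q := by
  have h : (q : ℝ) = (q.num : ℝ) / q.den := by
    exact_mod_cast congrArg (Rat.cast (K := ℝ)) (Rat.num_div_den q).symm
  rw [h, ofRat]
  by_cases hq : q < 0
  · have : ((q.num.natAbs : ℤ) : ℝ) = -q.num := by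
      rw [Int.ofNat_natAbs_of_nonpos (Rat.num_nonpos.2 hq.le)]
      push_cast
      rfl
    rw [Int.cast_natCast] at this
    simp [hq, toReal, this]
  · have : ((q.num.natAbs : ℤ) : ℝ) = q.num := by
      rw [Int.natAbs_of_nonneg (Rat.num_nonneg.2 (not_lt.1 hq))]
    rw [Int.cast_natCast] at this
    simp [hq, toReal, this]

theorem Frac.den_ofRat (q : ℚ) : (Frac.ofRat q).2.2 = q.den := by
  unfold ofRat
  cases decide (q < 0) <;> rfl

section

variable {k : ℕ} {n d : Fin k → ℕ} {y : Fin k → Frac}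

theorem Frac.den_foldl (l : List (Fin k)) (x : Frac) :
    (l.foldl (fun (x : Frac) a => x.addMul (n a) (d a) (y a)) x).2.2 ≠ 0 ↔
      x.2.2 ≠ 0 ∧ ∀ a ∈ l, d a ≠ 0 ∧ (y a).2.2 ≠ 0 := by
  induction l generalizing x with
  | nil => simp
  | cons a l ih =>
    rw [List.foldl_cons, ih]
    simp only [addMul, mul_ne_zero_iff, List.mem_cons, forall_eq_or_imp]
    tauto

theorem Frac.toReal_foldl (hd : ∀ a, d a ≠ 0) (hy : ∀ a, (y a).2.2 ≠ 0) :
    ((List.finRange k).foldl (fun (x : Frac) a => x.addMul (n a) (d a) (y a)) (0, 0, 1)).toReal =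
      ∑ a, (n a : ℝ) / d a * (y a).toReal := by
  have h : ∀ (l : List (Fin k)) (x : Frac), x.2.2 ≠ 0 →
      (l.foldl (fun (x : Frac) a => x.addMul (n a) (d a) (y a)) x).toReal =
        x.toReal + (l.map fun a => (n a : ℝ) / d a * (y a).toReal).sum := by
    intro l
    induction l with
    | nil => simp
    | cons a l ih =>
      intro x hx
      rw [List.foldl_cons, ih _ (by simp [addMul, hx, hd, hy]),
        toReal_addMul hx (hd a) (hy a)]
      simp [add_assoc]
  rw [h _ _ one_ne_zero, Fin.sum_univ_def]
  simp [toReal]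

end

/-- The denominator serves as a flag: it vanishes exactly if the weights at some decision node are
all zero. Testing it replaces any validation of the guessed tables. -/
theorem GameTree.den_value (W : Weights) (t : GameTree) (d : ℕ) : (t.value W d).2.2 ≠ 0 ↔
    t.Forall (fun i d I k => ∑ a ∈ Finset.range k, W i d I a ≠ 0) d := by
  induction t generalizing d with
  | terminal u => simp [value, Forall, Frac.den_ofRat]
  | chance k p c ih =>
    simp only [value, Frac.den_foldl, ih, Forall]
    simp
  | decision i I k c ih =>
    simp only [value, mul_ne_zero_iff, Frac.den_foldl, ih, Forall, Finset.sum_range, Fin.sum_univ_def]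
    simp
    tauto

theorem GameTree.toReal_value {W : Weights} {σ : Strategy} {t : GameTree} {d : ℕ}
    (ht : t.IsDistribution) (hW : (t.value W d).2.2 ≠ 0)
    (hσ : t.Forall (fun i d I k => ∀ a < k, σ i d I a =
      W i d I a / ∑ b ∈ Finset.range k, (W i d I b : ℝ)) d) :
    (t.value W d).toReal = t.utility σ d := by
  rw [den_value] at hW
  induction t generalizing d with
  | terminal u => exact Frac.toReal_ofRat u
  | chance k p c ih =>
    rw [value, Frac.toReal_foldl (fun a => (p a).den_ne_zero)
      fun a => ((c a).den_value W _).2 (hW a)]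
    refine Finset.sum_congr rfl fun a _ => ?_
    rw [ih a (ht.2 a) (hW a) (hσ a)]
    congr 1
    have h1 := Rat.num_nonneg.2 (ht.1.1 a)
    have h2 : (((p a).num.natAbs : ℤ) : ℝ) = (p a).num := by rw [Int.natAbs_of_nonneg h1]
    rw [Int.cast_natCast] at h2
    rw [h2]
    exact_mod_cast congrArg (Rat.cast (K := ℝ)) (Rat.num_div_den (p a))
  | decision i I k c ih =>
    have h1 : ((List.finRange k).map fun a : Fin k => W i d I a).sum =
        ∑ b ∈ Finset.range k, W i d I b := by rw [Finset.sum_range, Fin.sum_univ_def]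
    have h2 : ∀ (x : Frac) (w : ℕ), Frac.toReal (x.1, x.2.1, x.2.2 * w) = x.toReal / w := by
      intro x w
      simp only [Frac.toReal, Nat.cast_mul, div_mul_eq_div_div]
    simp only [value, h1]
    rw [h2, Frac.toReal_foldl (fun _ => one_ne_zero) fun a => ((c a).den_value W _).2 (hW.2 a),
      utility, Finset.sum_div]
    refine Finset.sum_congr rfl fun a _ => ?_
    rw [ih a (ht a) (hW.2 a) (hσ.2 a), hσ.1 a a.2]
    push_cast
    ring

end EFG

namespace EFG

open StackProgram

/-! ### The max-min value in terms of utilities -/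

/-- The pair of a strategy of the maximizer and a strategy of the minimizer. -/
def Strategy.mk (x y : ℕ → ℕ → ℕ → ℝ) : Strategy
  | .maximizer => x
  | .minimizer => y

theorem GameTree.terminals_chance (k : ℕ) (p : Fin k → ℚ) (c : Fin k → GameTree) :
    (GameTree.chance k p c).terminals = (List.finRange k).flatMap fun a =>
      (c a).terminals.map fun z => (Step.chance a (p a) :: z.1, z.2) := by
  simp only [terminals, histories, List.filterMap_cons, List.filterMap_flatMap,
    List.filterMap_map, List.map_filterMap]
  congr! 3 with a h
  cases h with
  | mk path t => cases t <;> rfl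

theorem GameTree.terminals_decision (i : Player) (I k : ℕ) (c : Fin k → GameTree) :
    (GameTree.decision i I k c).terminals = (List.finRange k).flatMap fun a =>
      (c a).terminals.map fun z => (Step.decision i I a :: z.1, z.2) := by
  simp only [terminals, histories, List.filterMap_cons, List.filterMap_flatMap,
    List.filterMap_map, List.map_filterMap]
  congr! 3 with a h
  cases h with
  | mk path t => cases t <;> rfl

theorem sum_flatMap_finRange {α : Type} {k : ℕ} (f : Fin k → List α) (g : α → ℝ) :
    (((List.finRange k).flatMap f).map g).sum = ∑ a, ((f a).map g).sum := by
  rw [Fin.sum_univ_def, List.map_flatMap, List.flatMap_def, List.sum_flatten, List.map_map]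
  rfl

/-- The first step of a path gives a factor common to all terminal nodes below it, so the sum over
paths obeys the recursion. The depth is arbitrary because these strategies ignore it. -/
theorem GameTree.sum_terminals (x y : ℕ → ℕ → ℝ) (t : GameTree) (d : ℕ) :
    (t.terminals.map fun z => (z.2 : ℝ) * (chanceProb z.1 : ℝ) * realization .maximizer x z.1 *
      realization .minimizer y z.1).sum =
    t.utility (.mk (fun _ => x) fun _ => y) d := by
  induction t generalizing d with
  | terminal u =>
    simp [terminals, histories, utility, chanceProb, realization, sequence]
  | chance k p c ih =>
    rw [terminals_chance, sum_flatMap_finRange, utility]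
    refine Finset.sum_congr rfl fun a _ => ?_
    rw [← ih, ← List.sum_map_mul_left, List.map_map]
    refine congrArg List.sum (List.map_congr_left fun z _ => ?_)
    simp [chanceProb, realization, sequence]
    ring
  | decision i I k c ih =>
    rw [terminals_decision, sum_flatMap_finRange, utility]
    refine Finset.sum_congr rfl fun a _ => ?_
    rw [← ih, ← List.sum_map_mul_left, List.map_map]
    refine congrArg List.sum (List.map_congr_left fun z _ => ?_)
    cases i <;> simp [chanceProb, realization, sequence, Strategy.mk] <;> ring

theorem Game.expectedUtility_eq (G : Game) (x : G.Behavioral .maximizer)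
    (y : G.Behavioral .minimizer) :
    G.expectedUtility x y = G.tree.utility (.mk (fun _ => x.1) fun _ => y.1) 1 :=
  G.tree.sum_terminals x.1 y.1 1

/-! ### Sizes of numbers in the code of a tree -/

theorem length_encodeNat (n : ℕ) : (encodeNat n).length = n.size := by
  rw [encodeNat, List.length_map, Nat.size_eq_bits_len]

theorem length_encodeRat (q : ℚ) :
    q.num.natAbs.size + q.den.size + 2 ≤ (encodeRat q).length := by
  simp only [encodeRat, List.length_append, length_encodeNat, List.length_singleton]
  omega

theorem Rat.abs_le_natAbs_num (q : ℚ) : |(q : ℝ)| ≤ q.num.natAbs := by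
  have h2 : (1 : ℝ) ≤ q.den := by exact_mod_cast q.den_pos
  rw [Rat.cast_def, abs_div, Nat.abs_cast, Nat.cast_natAbs, Int.cast_abs]
  exact div_le_self (abs_nonneg _) h2

theorem le_sum_finRange {k : ℕ} (f : Fin k → ℕ) (a : Fin k) :
    f a ≤ ((List.finRange k).map f).sum := by
  rw [← Fin.sum_univ_def]
  exact Finset.single_le_sum (fun _ _ => Nat.zero_le _) (Finset.mem_univ a)

namespace GameTree

theorem length_encode_chance_lt {k : ℕ} {p : Fin k → ℚ} {c : Fin k → GameTree} (a : Fin k) :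
    (c a).encode.length < (chance k p c).encode.length := by
  have := le_sum_finRange (fun a => (encodeRat (p a) ++ (c a).encode).length) a
  simp only [encode, List.length_append, List.length_cons, List.length_flatMap] at *
  omega

theorem length_encode_decision {i : Player} {I k : ℕ} {c : Fin k → GameTree} :
    ∑ a, (c a).encode.length + 2 ≤ (decision i I k c).encode.length := by
  simp only [encode, List.length_append, List.length_cons, List.length_flatMap, Fin.sum_univ_def]
  omega

theorem length_encode_decision_lt {i : Player} {I k : ℕ} {c : Fin k → GameTree} (a : Fin k) :
    (c a).encode.length < (decision i I k c).encode.length := by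
  have := length_encode_decision (i := i) (I := I) (c := c)
  have := Finset.single_le_sum (f := fun a => (c a).encode.length)
    (fun _ _ => Nat.zero_le _) (Finset.mem_univ a)
  omega

theorem edges_lt (t : GameTree) : t.edges < t.encode.length := by
  induction t with
  | terminal u => simp [edges, encode]
  | chance k p c ih =>
    have : ∑ a, ((c a).edges + 1) ≤
        ((List.finRange k).map fun a => (encodeRat (p a) ++ (c a).encode).length).sum := by
      rw [← Fin.sum_univ_def]
      refine Finset.sum_le_sum fun a _ => ?_
      have := ih a
      simp only [List.length_append]
      omega
    simp only [List.length_append] at this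
    simp only [edges, encode, List.length_append, List.length_cons, List.length_flatMap]
    omega
  | decision i I k c ih =>
    have h1 : ∑ a, ((c a).edges + 1) ≤ ∑ a, (c a).encode.length :=
      Finset.sum_le_sum fun a _ => ih a
    have h2 := length_encode_decision (i := i) (I := I) (c := c)
    rw [edges]
    omega

theorem bounded_two_pow {t : GameTree} {n : ℕ} (hn : t.encode.length ≤ n) :
    t.Bounded (2 ^ n : ℝ) := by
  induction t with
  | terminal u =>
    refine (Rat.abs_le_natAbs_num u).trans ?_
    have h1 := length_encodeRat u
    have h2 : u.num.natAbs < 2 ^ n := Nat.size_le.1 (by simp [encode] at hn; omega)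
    exact_mod_cast h2.le
  | chance k p c ih => exact fun a => ih a ((length_encode_chance_lt a).le.trans hn)
  | decision i I k c ih => exact fun a => ih a ((length_encode_decision_lt a).le.trans hn)

theorem forall_le_length {t : GameTree} {n d : ℕ} (hn : t.encode.length ≤ n) :
    t.Forall (fun _ _ _ k => k ≤ n) d := by
  induction t generalizing d with
  | terminal u => trivial
  | chance k p c ih => exact fun a => ih a ((length_encode_chance_lt a).le.trans hn)
  | decision i I k c ih =>
    refine ⟨?_, fun a => ih a ((length_encode_decision_lt a).le.trans hn)⟩
    have h1 := length_encode_decision (i := i) (I := I) (c := c)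
    have h2 : ∑ _a : Fin k, 1 ≤ ∑ a, (c a).encode.length :=
      Finset.sum_le_sum fun a _ => (Nat.zero_le _).trans_lt (edges_lt (c a))
    simp at h2
    omega

end GameTree

/-- A positive fraction is at least the inverse of its denominator, and the digits of the
denominator are part of the input. -/
theorem Input.two_pow_neg_le (J : Input) : (2 ^ J.encode.length : ℝ)⁻¹ ≤ J.ε := by
  have h1 := length_encodeRat J.ε
  have h2 : J.ε.den < 2 ^ J.encode.length :=
    Nat.size_le.1 (by simp only [Input.encode, List.length_append]; omega)
  have h3 : (0 : ℝ) < J.ε.den := by exact_mod_cast J.ε.den_pos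
  have h4 : ((J.ε.den : ℝ))⁻¹ ≤ J.ε := by
    have h5 : (1 : ℝ) ≤ J.ε.num := by exact_mod_cast Int.add_one_le_iff.2 (Rat.num_pos.2 J.ε_pos)
    rw [Rat.cast_def, inv_eq_one_div]
    gcongr
  refine le_trans ?_ h4
  gcongr
  exact_mod_cast h2.le

/-! ### Behavioral strategies and strategies indexed by depth -/

namespace Game

variable (G : Game)

theorem exists_numActions : ∃ κ : Player → ℕ → ℕ, (∀ i I, 0 < κ i I) ∧
    G.tree.Forall (fun i _ I k => κ i I = k) 1 := by
  have : ∀ i I, ∃ K, 0 < K ∧ ∀ k h, G.tree.MemInfoset i I k h → K = k := fun i I => by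
    by_cases H : ∃ k h, G.tree.MemInfoset i I k h
    · obtain ⟨k, h, H⟩ := H
      exact ⟨k, G.actions_nonempty _ _ _ _ H, fun k' h' H' => G.infoset_actions _ _ _ _ _ _ H H'⟩
    -- An index that names no information set is given one action, so that `κ` is positive
    -- everywhere.
    · exact ⟨1, one_pos, fun k h H' => absurd ⟨k, h, H'⟩ H⟩
  choose κ hκ0 hκ using this
  exact ⟨κ, hκ0, GameTree.forall_iff.2 fun i I k h H => hκ i I k h H⟩

variable {G}

theorem Timeable.exists_depth (hG : G.Timeable) : ∃ D : Player → ℕ → ℕ,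
    G.tree.Forall (fun i d I _ => D i I = d) 1 := by
  have : ∀ i I, ∃ D, ∀ k h, G.tree.MemInfoset i I k h → D = 1 + h.path.length := fun i I => by
    by_cases H : ∃ k h, G.tree.MemInfoset i I k h
    · obtain ⟨k, h, H⟩ := H
      exact ⟨1 + h.path.length, fun k' h' H' => by rw [hG _ _ _ _ _ _ H H']⟩
    · exact ⟨0, fun k h H' => absurd ⟨k, h, H'⟩ H⟩
  choose D hD using this
  exact ⟨D, GameTree.forall_iff.2 fun i I k h H => hD i I k h H⟩

/-- A strategy that is a probability distribution at all decision nodes. -/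
def Proper (G : Game) (σ : Strategy) : Prop := G.tree.Forall σ.Proper 1

theorem proper_mk (x : G.Behavioral .maximizer) (y : G.Behavioral .minimizer) :
    G.Proper (.mk (fun _ => x.1) fun _ => y.1) :=
  GameTree.forall_iff.2 fun i I k h H => by
    cases i with
    | maximizer => exact x.2 I k h H
    | minimizer => exact y.2 I k h H

/-- In a timeable game the depth is determined by the information set, so the additional index gives
the players no more freedom. It makes it possible to modify a strategy at one depth only. -/
theorem Timeable.exists_behavioral (hG : G.Timeable) {σ : Strategy} (hσ : G.Proper σ) :
    ∃ x : G.Behavioral .maximizer, ∃ y : G.Behavioral .minimizer,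
      G.tree.Forall (fun i d I _ => σ i d I = match i with
        | .maximizer => x.1 I
        | .minimizer => y.1 I) 1 := by
  obtain ⟨D, hD⟩ := hG.exists_depth
  have h := GameTree.forall_iff.1 (hσ.and hD)
  refine ⟨⟨fun I => σ .maximizer (D .maximizer I) I, fun I k h' H => ?_⟩,
    ⟨fun I => σ .minimizer (D .minimizer I) I, fun I k h' H => ?_⟩, hD.mono fun i d I k h => ?_⟩
  · obtain ⟨h1, h2⟩ := h _ _ _ _ H
    simpa only [h2, Strategy.Proper] using h1
  · obtain ⟨h1, h2⟩ := h _ _ _ _ H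
    simpa only [h2, Strategy.Proper] using h1
  · cases i <;> simp [h]

instance (i : Player) : Nonempty (G.Behavioral i) := by
  obtain ⟨κ, h0, hκ⟩ := G.exists_numActions
  refine ⟨⟨fun I _ => (κ i I : ℝ)⁻¹, fun I k h H => ?_⟩⟩
  have h1 := GameTree.forall_iff.1 hκ _ _ _ _ H
  have h2 : 0 < k := h1 ▸ h0 i I
  refine ⟨fun a _ => by positivity, ?_⟩
  have : (k : ℝ) ≠ 0 := by exact_mod_cast h2.ne'
  simp [h1, this]

theorem abs_expectedUtility_le (x : G.Behavioral .maximizer) (y : G.Behavioral .minimizer) :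
    |G.expectedUtility x y| ≤ 2 ^ G.tree.encode.length := by
  rw [expectedUtility_eq]
  exact GameTree.abs_utility_le (GameTree.bounded_two_pow le_rfl) G.isDistribution (proper_mk x y)

theorem bddBelow_expectedUtility (x : G.Behavioral .maximizer) :
    BddBelow (Set.range fun y : G.Behavioral .minimizer => G.expectedUtility x y) :=
  ⟨-2 ^ G.tree.encode.length, by
    rintro _ ⟨y, rfl⟩
    exact (abs_le.1 (abs_expectedUtility_le x y)).1⟩

/-- Only strict inequalities are taken from the supremum and, in the next statement, from the
infimum. Attainment of the extrema is not needed, since the promise gap absorbs the difference. -/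
theorem Timeable.exists_forall_lt_utility (hG : G.Timeable) {c : ℝ}
    (hc : c < G.behavioralMaxMinValue) : ∃ σ, G.Proper σ ∧ ∀ τ, G.Proper τ →
      τ .maximizer = σ .maximizer → c < G.tree.utility τ 1 := by
  obtain ⟨x, hx⟩ := exists_lt_of_lt_ciSup hc
  refine ⟨_, proper_mk x (Classical.arbitrary _), fun τ hτ h => ?_⟩
  obtain ⟨x', y, hy⟩ := hG.exists_behavioral hτ
  refine (hx.trans_le (ciInf_le (bddBelow_expectedUtility x) y)).trans_eq ?_
  rw [expectedUtility_eq]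
  refine GameTree.utility_congr (hy.mono fun i d I k H a _ => ?_)
  cases i with
  | maximizer => rw [h]; rfl
  | minimizer => rw [H]; rfl

theorem Timeable.exists_utility_lt (hG : G.Timeable) {c : ℝ}
    (hc : G.behavioralMaxMinValue < c) {σ : Strategy} (hσ : G.Proper σ) :
    ∃ τ, G.Proper τ ∧ τ .maximizer = σ .maximizer ∧ G.tree.utility τ 1 < c := by
  obtain ⟨x, y₀, hx⟩ := hG.exists_behavioral hσ
  have hb : BddAbove (Set.range fun x : G.Behavioral .maximizer =>
      ⨅ y : G.Behavioral .minimizer, G.expectedUtility x y) := ⟨2 ^ G.tree.encode.length, by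
    rintro _ ⟨x, rfl⟩
    exact (ciInf_le (bddBelow_expectedUtility x) y₀).trans
      (abs_le.1 (abs_expectedUtility_le x y₀)).2⟩
  obtain ⟨y, hy⟩ := exists_lt_of_ciInf_lt ((le_ciSup hb x).trans_lt hc)
  refine ⟨.mk (σ .maximizer) fun _ => y.1, ?_, rfl, ?_⟩
  · refine GameTree.forall_iff.2 fun i I k h H => ?_
    cases i with
    | maximizer => exact GameTree.forall_iff.1 hσ _ _ _ _ H
    | minimizer => exact y.2 I k h H
  · rw [expectedUtility_eq] at hy
    refine (GameTree.utility_congr (hx.mono fun i d I k H a _ => ?_)).trans_lt hy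
    cases i with
    | maximizer => simp [Strategy.mk, H]
    | minimizer => rfl

end Game

/-! ### Rounding -/

/-- The strategy that plays actions with probabilities proportional to weights, where `κ` is the
number of actions. -/
noncomputable def Weights.normalize (W : Weights) (κ : Player → ℕ → ℕ) : Strategy := fun i d I a =>
  W i d I a / ∑ b ∈ Finset.range (κ i I), (W i d I b : ℝ)

theorem Weights.proper_normalize {W : Weights} {κ : Player → ℕ → ℕ} {i : Player} {d I k : ℕ}
    (hκ : κ i I = k) (hW : ∑ a ∈ Finset.range k, W i d I a ≠ 0) :
    (W.normalize κ).Proper i d I k := by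
  subst hκ
  refine ⟨fun a _ => by unfold normalize; positivity, ?_⟩
  have : ∑ a ∈ Finset.range (κ i I), (W i d I a : ℝ) ≠ 0 := by exact_mod_cast hW
  simp only [normalize, ← Finset.sum_div, div_self this]

/-- Each numerator `n` lies between `2 ^ m * p a` and that number plus one, so their sum `S` lies
between `2 ^ m` and `2 ^ m + k`. Hence `n - S * p a` is at most `k` in absolute value, and `S ≥ 2 ^
m` remains to divide by. Adding one to the floors keeps all weights positive. -/
theorem abs_round_sub_le {k m : ℕ} {p : ℕ → ℝ} (h0 : ∀ a < k, 0 ≤ p a)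
    (h1 : ∑ a ∈ Finset.range k, p a = 1) {a : ℕ} (ha : a < k) :
    |((⌊2 ^ m * p a⌋₊ + 1 : ℕ) : ℝ) / ∑ b ∈ Finset.range k, ((⌊2 ^ m * p b⌋₊ + 1 : ℕ) : ℝ) - p a| ≤
      k / 2 ^ m := by
  set S := ∑ b ∈ Finset.range k, ((⌊2 ^ m * p b⌋₊ + 1 : ℕ) : ℝ)
  have hN : (0 : ℝ) < 2 ^ m := by positivity
  have hS : (2 : ℝ) ^ m ≤ S := by
    calc (2 : ℝ) ^ m = ∑ b ∈ Finset.range k, 2 ^ m * p b := by rw [← Finset.mul_sum, h1, mul_one]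
      _ ≤ S := Finset.sum_le_sum fun b _ => by
        push_cast
        exact (Nat.lt_floor_add_one _).le
  have hS' : S ≤ 2 ^ m + k := by
    calc S ≤ ∑ b ∈ Finset.range k, (2 ^ m * p b + 1) := Finset.sum_le_sum fun b hb => by
          push_cast
          gcongr
          exact Nat.floor_le (mul_nonneg hN.le (h0 b (Finset.mem_range.1 hb)))
      _ = 2 ^ m + k := by rw [Finset.sum_add_distrib, ← Finset.mul_sum, h1]; simp
  have hn1 : 2 ^ m * p a ≤ ((⌊2 ^ m * p a⌋₊ + 1 : ℕ) : ℝ) := by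
    push_cast
    exact (Nat.lt_floor_add_one _).le
  have hn2 : ((⌊2 ^ m * p a⌋₊ + 1 : ℕ) : ℝ) ≤ 2 ^ m * p a + 1 := by
    push_cast
    gcongr
    exact Nat.floor_le (mul_nonneg hN.le (h0 a ha))
  have hp1 : p a ≤ 1 := by
    rw [← h1]
    exact Finset.single_le_sum (f := p) (fun b hb => h0 b (Finset.mem_range.1 hb))
      (Finset.mem_range.2 ha)
  have hp0 := h0 a ha
  have hk : (1 : ℝ) ≤ k := by exact_mod_cast (by omega : 1 ≤ k)
  have hSpos : 0 < S := hN.trans_le hS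
  generalize ((⌊2 ^ m * p a⌋₊ + 1 : ℕ) : ℝ) = n at *
  rw [div_sub' hSpos.ne', abs_div, abs_of_pos hSpos, div_le_div_iff₀ hSpos hN]
  have : |n - S * p a| ≤ k := by
    rw [abs_le]
    constructor
    · nlinarith
    · nlinarith
  calc |n - S * p a| * 2 ^ m ≤ k * S := by gcongr
    _ = _ := rfl

/-- Rounded weights. -/
noncomputable def Strategy.round (σ : Strategy) (m : ℕ) (i : Player) (d I a : ℕ) : ℕ :=
  ⌊2 ^ m * σ i d I a⌋₊

/-- The precision `4 * n + 2` is chosen so that the error `n / 2 ^ (4 * n + 2)` per probability,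
times the bounds `2 ^ n` for the payoffs and `2 ^ n` for the edges, is at most `2 ^ (-n) / 4`, hence
at most `ε / 4`. The alternative at each node allows only one player to be rounded. -/
theorem Game.abs_utility_round_sub_le {J : Input} {κ : Player → ℕ → ℕ}
    (hκ : J.game.tree.Forall (fun i _ I k => κ i I = k) 1) {σ τ : Strategy}
    (hσ : J.game.Proper σ) (hτ : J.game.Proper τ)
    (h : J.game.tree.Forall (fun i d I k => (∀ a < k, τ i d I a = σ i d I a) ∨
      ∀ a < k, τ i d I a = Weights.normalize (fun i d I a =>
        σ.round (4 * J.encode.length + 2) i d I a + 1) κ i d I a) 1) :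
    |J.game.tree.utility τ 1 - J.game.tree.utility σ 1| ≤ J.ε / 4 := by
  set n := J.encode.length
  have hn : J.game.tree.encode.length ≤ n := by simp [n, Input.encode]
  have hδ : J.game.tree.Forall (fun i d I k => ∀ a < k, |τ i d I a - σ i d I a| ≤
      n / 2 ^ (4 * n + 2)) 1 := by
    refine (((hκ.and h).and (GameTree.forall_le_length hn)).and hσ).mono ?_
    rintro i d I k ⟨⟨⟨rfl, h | h⟩, hk⟩, h0, h1⟩ a ha
    · rw [h a ha, sub_self, abs_zero]
      positivity
    · rw [h a ha]
      refine (abs_round_sub_le h0 h1 ha).trans ?_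
      gcongr
  refine (GameTree.abs_utility_sub_le (GameTree.bounded_two_pow hn) (by positivity)
    (by positivity) J.game.isDistribution hτ hσ hδ).trans ?_
  have h1 : (J.game.tree.edges : ℝ) ≤ 2 ^ n := by
    exact_mod_cast (J.game.tree.edges_lt.le.trans hn).trans n.lt_two_pow_self.le
  have h2 : (n : ℝ) ≤ 2 ^ n := by exact_mod_cast n.lt_two_pow_self.le
  have h3 := J.two_pow_neg_le
  calc (n : ℝ) / 2 ^ (4 * n + 2) * 2 ^ n * J.game.tree.edges
      ≤ 2 ^ n / 2 ^ (4 * n + 2) * 2 ^ n * 2 ^ n := by gcongr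
    _ = (2 ^ n)⁻¹ / 4 := by
      have : (2 : ℝ) ^ n ≠ 0 := by positivity
      rw [pow_add, mul_comm 4 n, pow_mul]
      field_simp
      norm_num
    _ ≤ J.ε / 4 := by gcongr

end EFG

namespace EFG

/-! ### Counterfactual values -/

/-- The sum over all nodes at depth `e` in the information set `I` of the minimizer of the
probability that the node is reached times the payoff after playing `a` there. -/
def GameTree.counterfactual (σ : Strategy) (e I a : ℕ) : GameTree → ℕ → ℝ
  | .terminal _, _ => 0
  | .chance _ p c, d => ∑ b, (p b : ℝ) * (c b).counterfactual σ e I a (d + 1)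
  | .decision i J k c, d =>
      if d = e then
        if h : i = .minimizer ∧ J = I ∧ a < k then (c ⟨a, h.2.2⟩).utility σ (d + 1) else 0
      else ∑ b : Fin k, σ i d J b * (c b).counterfactual σ e I a (d + 1)

/-- The strategies agree, except possibly for the minimizer at depth `e`. -/
def Strategy.AgreeOff (e : ℕ) (σ τ : Strategy) : Prop :=
  ∀ i d, i ≠ .minimizer ∨ d ≠ e → σ i d = τ i d

namespace GameTree

theorem counterfactual_eq_zero {σ : Strategy} {e I a : ℕ} {t : GameTree} {d : ℕ}
    (h : t.Forall (fun i d J _ => ¬(i = .minimizer ∧ d = e ∧ J = I)) d) :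
    t.counterfactual σ e I a d = 0 := by
  induction t generalizing d with
  | terminal u => rfl
  | chance k p c ih =>
    exact Finset.sum_eq_zero fun b _ => by rw [ih b (h b), mul_zero]
  | decision i J k c ih =>
    rw [counterfactual]
    split
    · rename_i hd
      rw [dif_neg]
      rintro ⟨rfl, rfl, -⟩
      exact h.1 ⟨rfl, hd, rfl⟩
    · exact Finset.sum_eq_zero fun b _ => by rw [ih b (h.2 b), mul_zero]

theorem counterfactual_eq_zero_of_lt {σ : Strategy} {e I a : ℕ} {t : GameTree} {d : ℕ}
    (h : e < d) : t.counterfactual σ e I a d = 0 := by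
  refine counterfactual_eq_zero ?_
  refine (forall_of_forall (P := fun _ _ _ _ => True) (fun _ _ _ _ => trivial) t d).le_depth.mono ?_
  rintro i d' J k ⟨h1, -⟩ ⟨-, h2, -⟩
  omega

theorem utility_eq_of_agreeOff {e : ℕ} {σ τ : Strategy} (h : σ.AgreeOff e τ) (t : GameTree) {d : ℕ}
    (hd : e < d) : t.utility σ d = t.utility τ d := by
  refine utility_congr ?_
  refine (forall_of_forall (P := fun _ _ _ _ => True) (fun _ _ _ _ => trivial) t d).le_depth.mono ?_
  rintro i d' J k ⟨h1, -⟩ a -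
  rw [h i d' (Or.inr (by omega))]

/-- The recursion stops at depth `e` with the action `a` prescribed, so the behavior of the
minimizer at that depth does not enter. -/
theorem counterfactual_congr {e : ℕ} {σ τ : Strategy} (h : σ.AgreeOff e τ) (I a : ℕ)
    (t : GameTree) (d : ℕ) : t.counterfactual σ e I a d = t.counterfactual τ e I a d := by
  induction t generalizing d with
  | terminal u => rfl
  | chance k p c ih =>
    exact Finset.sum_congr rfl fun b _ => by rw [ih b]
  | decision i J k c ih =>
    simp only [counterfactual]
    split
    · rename_i hd
      split
      · exact utility_eq_of_agreeOff h _ (by omega)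
      · rfl
    · rename_i hd
      exact Finset.sum_congr rfl fun b _ => by rw [ih b, h i d (Or.inr hd)]

theorem exists_forall_lt (t : GameTree) (d : ℕ) :
    ∃ N, t.Forall (fun _ e I _ => e < N ∧ I < N) d := by
  induction t generalizing d with
  | terminal u => exact ⟨0, trivial⟩
  | chance k p c ih =>
    choose N hN using fun a => ih a (d + 1)
    refine ⟨∑ a, N a, fun a => (hN a).mono fun _ e I _ h => ?_⟩
    have := Finset.single_le_sum (f := N) (fun _ _ => Nat.zero_le _) (Finset.mem_univ a)
    omega
  | decision i J k c ih =>
    choose N hN using fun a => ih a (d + 1)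
    refine ⟨∑ a, N a + d + J + 1, by omega, fun a => (hN a).mono fun _ e I _ h => ?_⟩
    have := Finset.single_le_sum (f := N) (fun _ _ => Nat.zero_le _) (Finset.mem_univ a)
    omega

/-- The effect of changing the strategy of the minimizer at one depth. -/
theorem utility_sub_utility {κ : Player → ℕ → ℕ} {N e : ℕ} {σ τ : Strategy} (h : σ.AgreeOff e τ)
    {t : GameTree} {d : ℕ} (hκ : t.Forall (fun i _ I k => κ i I = k) d)
    (hN : t.Forall (fun _ _ I _ => I < N) d) :
    t.utility τ d - t.utility σ d = ∑ I ∈ Finset.range N, ∑ a ∈ Finset.range (κ .minimizer I),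
      (τ .minimizer e I a - σ .minimizer e I a) * t.counterfactual σ e I a d := by
  induction t generalizing d with
  | terminal u => simp [utility, counterfactual]
  | chance k p c ih =>
    simp only [utility, counterfactual, ← Finset.sum_sub_distrib, ← mul_sub]
    rw [Finset.sum_congr rfl fun a _ => by rw [ih a (hκ a) (hN a)]]
    simp only [Finset.mul_sum]
    rw [Finset.sum_comm]
    refine Finset.sum_congr rfl fun I _ => ?_
    rw [Finset.sum_comm]
    refine Finset.sum_congr rfl fun a _ => Finset.sum_congr rfl fun b _ => ?_
    ring
  | decision i J k c ih =>
    -- A path meets depth `e` at most once, so the payoff is affine in the strategy at that depth.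
    -- At a node there, the payoffs below are unchanged and only the information set of the node
    -- contributes.
    by_cases hd : d = e
    · have hu : ∀ a, (c a).utility τ (d + 1) = (c a).utility σ (d + 1) := fun a =>
        (utility_eq_of_agreeOff h _ (by omega)).symm
      simp only [utility, counterfactual, if_pos hd, hu, ← Finset.sum_sub_distrib, ← sub_mul]
      obtain ⟨rfl, -⟩ := hκ
      cases i with
      | maximizer => simp [h .maximizer d (Or.inl (by simp))]
      | minimizer =>
        subst hd
        rw [Finset.sum_eq_single_of_mem J (Finset.mem_range.2 hN.1)]
        · rw [Finset.sum_range]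
          refine Finset.sum_congr rfl fun a _ => ?_
          simp
        · intro I _ hI
          refine Finset.sum_eq_zero fun a _ => ?_
          rw [dif_neg (fun H => hI H.2.1.symm), mul_zero]
    · have hs : τ i d = σ i d := (h i d (Or.inr hd)).symm
      simp only [utility, counterfactual, if_neg hd, hs, ← Finset.sum_sub_distrib, ← mul_sub]
      rw [Finset.sum_congr rfl fun a _ => by rw [ih a (hκ.2 a) (hN.2 a)]]
      simp only [Finset.mul_sum]
      rw [Finset.sum_comm]
      refine Finset.sum_congr rfl fun I _ => ?_
      rw [Finset.sum_comm]
      refine Finset.sum_congr rfl fun a _ => Finset.sum_congr rfl fun b _ => ?_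
      ring

theorem MemInfoset.chance {k : ℕ} {p : Fin k → ℚ} {c : Fin k → GameTree} {a : Fin k} {i : Player}
    {I k' : ℕ} {h : History} (H : (c a).MemInfoset i I k' h) : (GameTree.chance k p c).MemInfoset
      i I k' ⟨Step.chance a (p a) :: h.path, h.subtree⟩ := by
  refine ⟨?_, H.2⟩
  simp only [histories, List.mem_cons, List.mem_flatMap, List.mem_map]
  exact Or.inr ⟨a, by simp, h, H.1, rfl⟩

theorem MemInfoset.decision {j : Player} {J k : ℕ} {c : Fin k → GameTree} {a : Fin k} {i : Player}
    {I k' : ℕ} {h : History} (H : (c a).MemInfoset i I k' h) :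
    (GameTree.decision j J k c).MemInfoset i I k'
      ⟨Step.decision j J a :: h.path, h.subtree⟩ := by
  refine ⟨?_, H.2⟩
  simp only [histories, List.mem_cons, List.mem_flatMap, List.mem_map]
  exact Or.inr ⟨a, by simp, h, H.1, rfl⟩

/-- Under perfect recall, the minimizer contributes the same factor to the reach probabilities of
all nodes of an information set. -/
theorem counterfactual_eq_prod_mul {D : Player → ℕ → ℕ} {e I a : ℕ} {σ ρ : Strategy}
    (hmax : ρ .maximizer = σ .maximizer) (hlt : ∀ d < e, ∀ J b, ρ .minimizer d J b = 1)
    (hgt : ∀ d, e < d → ρ .minimizer d = σ .minimizer d) {t : GameTree} {d : ℕ} {L : List (ℕ × ℕ)}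
    (hD : t.Forall (fun i d I _ => D i I = d) d)
    (hL : ∀ k h, t.MemInfoset .minimizer I k h → d + h.path.length = e →
      sequence .minimizer h.path = L) :
    t.counterfactual σ e I a d =
      (L.map fun s => σ .minimizer (D .minimizer s.1) s.1 s.2).prod *
        t.counterfactual ρ e I a d := by
  induction t generalizing d L with
  | terminal u => simp [counterfactual]
  | chance k p c ih =>
    simp only [counterfactual, Finset.mul_sum]
    refine Finset.sum_congr rfl fun b _ => ?_
    rw [ih b (L := L) (hD b)]
    · ring
    · intro k' h H hd
      have := hL k' _ (H.chance (p := p)) (by simp only [List.length_cons]; omega)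
      simpa [sequence] using this
  | decision i J k c ih =>
    by_cases hde : e < d
    · rw [counterfactual_eq_zero_of_lt hde, counterfactual_eq_zero_of_lt hde, mul_zero]
    simp only [counterfactual]
    by_cases hd : d = e
    · simp only [if_pos hd]
      split
      · rename_i H
        obtain ⟨rfl, rfl, ha⟩ := H
        have : L = [] := by
          rw [← hL k ⟨[], _⟩ ⟨by rw [histories]; exact List.mem_cons_self .., c, rfl⟩ (by simpa)]
          rfl
        rw [this, List.map_nil, List.prod_nil, one_mul]
        refine utility_congr ?_
        refine (forall_of_forall (P := fun _ _ _ _ => True) (fun _ _ _ _ => trivial)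
          (c ⟨a, ha⟩) (d + 1)).le_depth.mono ?_
        rintro i d' J' k' ⟨h1, -⟩ b -
        cases i with
        | maximizer => rw [hmax]
        | minimizer => rw [hgt d' (by omega)]
      · rw [mul_zero]
    · simp only [if_neg hd, Finset.mul_sum]
      refine Finset.sum_congr rfl fun b _ => ?_
      cases i with
      | maximizer =>
        rw [ih b (L := L) (hD.2 b), hmax]
        · ring
        · intro k' h H hd
          have := hL k' _ H.decision (by simp only [List.length_cons]; omega)
          simpa [sequence] using this
      | minimizer =>
        have hc : ∀ k' h, (c b).MemInfoset .minimizer I k' h → d + 1 + h.path.length = e →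
            (J, (b : ℕ)) :: sequence .minimizer h.path = L := by
          intro k' h H hd
          rw [← hL k' _ H.decision (by simp only [List.length_cons]; omega)]
          simp [sequence]
        rw [hlt d (by omega), one_mul]
        -- If the common sequence `L` of the nodes of `I` does not start with this action, no node
        -- of `I` at depth `e` lies below it, and both sides vanish.
        by_cases hLc : ∃ L', L = (J, (b : ℕ)) :: L'
        · obtain ⟨L', rfl⟩ := hLc
          rw [ih b (L := L') (hD.2 b) fun k' h H hd => (List.cons.inj (hc k' h H hd)).2]
          have hJ : D .minimizer J = d := hD.1
          simp only [List.map_cons, List.prod_cons, hJ]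
          ring
        · have h0 : (c b).Forall (fun i d J _ => ¬(i = .minimizer ∧ d = e ∧ J = I)) (d + 1) := by
            rw [forall_iff]
            rintro i J' k' h H ⟨rfl, h1, rfl⟩
            exact hLc ⟨_, (hc k' h H h1).symm⟩
          rw [counterfactual_eq_zero h0, counterfactual_eq_zero h0, mul_zero, mul_zero]

/-- Guarantees that every factor contributed by the minimizer on the way to an information set
belongs to a smaller depth, where the hybrid strategies follow the competitor and the restarted ones
play uniformly. -/
theorem depth_lt_of_mem_sequence {D : Player → ℕ → ℕ} {t : GameTree} {d : ℕ}
    (hD : t.Forall (fun i d I _ => D i I = d) d) {h : History} (hh : h ∈ t.histories) (i : Player) :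
    ∀ s ∈ sequence i h.path, D i s.1 < d + h.path.length := by
  induction t generalizing d h with
  | terminal u =>
    simp only [histories, List.mem_singleton] at hh
    subst hh
    simp [sequence]
  | chance k p c ih =>
    simp only [histories, List.mem_cons, List.mem_flatMap, List.mem_map] at hh
    rcases hh with rfl | ⟨a, -, h, hh, rfl⟩
    · simp [sequence]
    · intro s hs
      have := ih a (hD a) hh s (by simpa [sequence] using hs)
      simp only [List.length_cons]
      omega
  | decision j J k c ih =>
    simp only [histories, List.mem_cons, List.mem_flatMap, List.mem_map] at hh
    rcases hh with rfl | ⟨a, -, h, hh, rfl⟩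
    · simp [sequence]
    · intro s hs
      simp only [List.length_cons]
      by_cases hj : j = i
      · subst hj
        have hs : s = (J, (a : ℕ)) ∨ s ∈ sequence j h.path := by simpa [sequence] using hs
        rcases hs with rfl | hs
        · have := hD.1
          simp only at this ⊢
          omega
        · have := ih a (hD.2 a) hh s hs
          omega
      · have := ih a (hD.2 a) hh s (by simpa [sequence, hj] using hs)
        omega

end GameTree

/-! ### Local optimality -/

/-- The minimizer plays uniformly before depth `e`. -/
noncomputable def Strategy.restart (κ : Player → ℕ → ℕ) (e : ℕ) (σ : Strategy) : Strategy :=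
  .mk (σ .maximizer) fun d I a =>
    if d < e then (κ .minimizer I : ℝ)⁻¹ else σ .minimizer d I a

/-- The minimizer deviates to the action `a` at depth `e` in the information set `I`. -/
noncomputable def Strategy.deviate (e I a : ℕ) (σ : Strategy) : Strategy :=
  .mk (σ .maximizer) fun d J b =>
    if d = e ∧ J = I then if b = a then 1 else 0 else σ .minimizer d J b

theorem Strategy.agreeOff_deviate (e I a : ℕ) (σ : Strategy) :
    σ.AgreeOff e (σ.deviate e I a) := by
  intro i d h
  cases i with
  | maximizer => rfl
  | minimizer =>
    have hd : d ≠ e := h.resolve_left (by simp)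
    funext J b
    simp [deviate, mk, hd]

/-- The verifier can only compare payoffs of whole games; this turns such a comparison into one of
counterfactual values at a single information set. -/
theorem GameTree.utility_deviate_sub {κ : Player → ℕ → ℕ} {e I a : ℕ} {σ : Strategy}
    {t : GameTree} {d : ℕ} (hκ : t.Forall (fun i _ I k => κ i I = k) d) (ha : a < κ .minimizer I) :
    t.utility (σ.deviate e I a) d - t.utility σ d = t.counterfactual σ e I a d -
      ∑ b ∈ Finset.range (κ .minimizer I), σ .minimizer e I b * t.counterfactual σ e I b d := by
  obtain ⟨N, hN⟩ := t.exists_forall_lt d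
  rw [utility_sub_utility (N := N + I + 1) (σ.agreeOff_deviate e I a) hκ
    (hN.mono fun _ _ _ _ h => by omega),
    Finset.sum_eq_single_of_mem I (Finset.mem_range.2 (by omega))]
  · simp only [sub_mul, Finset.sum_sub_distrib]
    congr 1
    rw [Finset.sum_eq_single_of_mem a (Finset.mem_range.2 ha)]
    · simp [Strategy.deviate, Strategy.mk]
    · intro b _ hb
      simp [Strategy.deviate, Strategy.mk, hb]
  · intro J _ hJ
    refine Finset.sum_eq_zero fun b _ => ?_
    simp [Strategy.deviate, Strategy.mk, hJ]

/-- Under perfect recall, a locally optimal strategy of the minimizer is optimal. -/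
theorem Game.utility_le_of_locally_optimal {G : Game} (hG : G.Timeable)
    (hR : G.PerfectRecall .minimizer) {κ : Player → ℕ → ℕ} (hκ0 : ∀ i I, 0 < κ i I)
    (hκ : G.tree.Forall (fun i _ I k => κ i I = k) 1) {σ τ : Strategy} (hσ : G.Proper σ)
    (h : G.tree.Forall (fun i d I k => i = .minimizer → ∀ a < k,
      G.tree.utility (σ.restart κ d) 1 ≤ G.tree.utility ((σ.restart κ d).deviate d I a) 1) 1)
    (hτ : G.Proper τ) (hmax : τ .maximizer = σ .maximizer) :
    G.tree.utility σ 1 ≤ G.tree.utility τ 1 := by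
  obtain ⟨D, hD⟩ := hG.exists_depth
  obtain ⟨N, hN⟩ := G.tree.exists_forall_lt 1
  -- Hybrids that follow `τ` before depth `j` and `σ` from there on, leading from `σ` to `τ`. The
  -- maximum with `0` changes nothing at available actions, and makes products of these values
  -- nonnegative without checking availability.
  let H : ℕ → Strategy := fun j => .mk (σ .maximizer) fun d I a =>
    if d < j then max (τ .minimizer d I a) 0 else σ .minimizer d I a
  have hstep : ∀ j, G.tree.utility (H j) 1 ≤ G.tree.utility (H (j + 1)) 1 := by
    intro j
    have hoff : (H j).AgreeOff j (H (j + 1)) := by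
      intro i d hd
      cases i with
      | maximizer => rfl
      | minimizer =>
        have hd : d ≠ j := hd.resolve_left (by simp)
        funext I a
        have : d < j ↔ d < j + 1 := by omega
        simp [H, Strategy.mk, this]
    rw [← sub_nonneg, GameTree.utility_sub_utility hoff hκ (hN.mono fun _ _ _ _ h => h.2)]
    refine Finset.sum_nonneg fun I _ => ?_
    by_cases hI : ∃ k h, G.tree.MemInfoset .minimizer I k h ∧ 1 + h.path.length = j
    swap
    · refine (Finset.sum_eq_zero fun a _ => ?_).ge
      rw [GameTree.counterfactual_eq_zero, mul_zero]
      rw [GameTree.forall_iff]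
      rintro i J k h' H' ⟨rfl, h1, rfl⟩
      exact hI ⟨k, h', H', h1⟩
    obtain ⟨k, h₀, hh, hj⟩ := hI
    have hk : κ .minimizer I = k := GameTree.forall_iff.1 hκ _ _ _ _ hh
    have hσI := GameTree.forall_iff.1 hσ _ _ _ _ hh
    have hτI := GameTree.forall_iff.1 hτ _ _ _ _ hh
    have hopt := GameTree.forall_iff.1 h _ _ _ _ hh rfl
    rw [hj] at hσI hτI hopt
    -- Not a strategy: the factor `1` before depth `j` removes the contribution of the minimizer
    -- from the reach probabilities.
    let ρ : Strategy := .mk (σ .maximizer) fun d I a => if d < j then 1 else σ .minimizer d I a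
    have hcf : ∀ a (χ : Strategy), χ .maximizer = σ .maximizer →
        (∀ d, j < d → χ .minimizer d = σ .minimizer d) → G.tree.counterfactual χ j I a 1 =
        ((sequence .minimizer h₀.path).map fun s =>
          χ .minimizer (D .minimizer s.1) s.1 s.2).prod * G.tree.counterfactual ρ j I a 1 := by
      intro a χ h1 h2
      refine GameTree.counterfactual_eq_prod_mul (by rw [h1]; rfl) ?_ ?_ hD
        fun k' h' H' _ => hR _ _ _ _ _ H' hh
      · intro d hd J b
        simp [ρ, Strategy.mk, hd]
      · intro d hd
        rw [h2 d hd]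
        funext J b
        simp [ρ, Strategy.mk, hd.not_gt]
    have hdepth := GameTree.depth_lt_of_mem_sequence hD hh.1 .minimizer
    rw [hj] at hdepth
    have h1 := fun a => hcf a (H j) rfl fun d hd => by
      funext J b
      simp [H, Strategy.mk, hd.not_gt]
    have h2 := fun a => hcf a (σ.restart κ j) rfl fun d hd => by
      funext J b
      simp [Strategy.restart, Strategy.mk, hd.not_gt]
    -- For the hybrid a nonnegative factor is enough, since the inequality is only multiplied by it.
    have h3 : 0 ≤ ((sequence .minimizer h₀.path).map fun s =>
        H j .minimizer (D .minimizer s.1) s.1 s.2).prod := by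
      refine List.prod_nonneg fun x hx => ?_
      obtain ⟨s, hs, rfl⟩ := List.mem_map.1 hx
      simp [H, Strategy.mk, hdepth s hs]
    -- For the restarted strategy the factor has to be cancelled. Uniform play at the smaller depths
    -- makes it positive, which is the purpose of restarting.
    have h4 : 0 < ((sequence .minimizer h₀.path).map fun s =>
        σ.restart κ j .minimizer (D .minimizer s.1) s.1 s.2).prod := by
      refine List.prod_pos fun x hx => ?_
      obtain ⟨s, hs, rfl⟩ := List.mem_map.1 hx
      simp [Strategy.restart, Strategy.mk, hdepth s hs, hκ0]
    set V := ∑ b ∈ Finset.range k, σ .minimizer j I b * G.tree.counterfactual ρ j I b 1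
    have hV : ∀ a < k, V ≤ G.tree.counterfactual ρ j I a 1 := by
      intro a ha
      have h5 := sub_nonneg.2 (hopt a ha)
      rw [GameTree.utility_deviate_sub hκ (hk ▸ ha)] at h5
      have h6 : ∀ b, σ.restart κ j .minimizer j I b = σ .minimizer j I b := fun b => by
        simp [Strategy.restart, Strategy.mk]
      rw [h2 a, Finset.sum_congr rfl fun b _ => by rw [h6, h2, mul_left_comm], ← Finset.mul_sum,
        ← mul_sub, hk] at h5
      exact sub_nonneg.1 (nonneg_of_mul_nonneg_right h5 h4)
    have h7 : ∀ b < k, H (j + 1) .minimizer j I b - H j .minimizer j I b =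
        τ .minimizer j I b - σ .minimizer j I b := fun b hb => by
      simp [H, Strategy.mk, hτI.1 b hb]
    rw [hk, Finset.sum_congr rfl fun b hb => by rw [h7 b (Finset.mem_range.1 hb), h1, mul_left_comm],
      ← Finset.mul_sum]
    refine mul_nonneg h3 ?_
    simp only [sub_mul, Finset.sum_sub_distrib]
    rw [sub_nonneg]
    -- No action has a counterfactual value below the average `V` under `σ`, so the average under
    -- `τ` is not below it either.
    calc V = ∑ b ∈ Finset.range k, τ .minimizer j I b * V := by
          rw [← Finset.sum_mul, hτI.2, one_mul]
      _ ≤ _ := Finset.sum_le_sum fun b hb => by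
          have hb := Finset.mem_range.1 hb
          exact mul_le_mul_of_nonneg_left (hV b hb) (hτI.1 b hb)
  have h0 : G.tree.utility σ 1 = G.tree.utility (H 0) 1 := by
    congr 1
    funext i
    cases i with
    | maximizer => rfl
    | minimizer => simp [H, Strategy.mk]
  have hNτ : G.tree.utility (H N) 1 = G.tree.utility τ 1 := by
    refine GameTree.utility_congr ((hN.and hτ).mono ?_)
    rintro i d I k ⟨⟨hd, -⟩, hp, -⟩ a ha
    cases i with
    | maximizer => rw [hmax]; rfl
    | minimizer => simp [H, Strategy.mk, hd, hp a ha]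
  rw [h0, ← hNτ]
  exact monotone_nat_of_le_succ hstep (Nat.zero_le N)

/-- There is a locally optimal pure strategy of the minimizer. -/
theorem GameTree.exists_locally_optimal (t : GameTree) {κ : Player → ℕ → ℕ}
    (hκ0 : ∀ i I, 0 < κ i I) (hκ : t.Forall (fun i _ I k => κ i I = k) 1)
    (x : ℕ → ℕ → ℕ → ℝ) : ∃ y : ℕ → ℕ → ℕ, (∀ d I, y d I < κ .minimizer I) ∧
      ∀ σ : Strategy, σ = .mk x (fun d I a => if a = y d I then 1 else 0) →
      ∀ d I, ∀ a < κ .minimizer I, t.utility (σ.restart κ d) 1 ≤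
        t.utility ((σ.restart κ d).deviate d I a) 1 := by
  obtain ⟨N, hN⟩ := t.exists_forall_lt 1
  let S : (ℕ → ℕ → ℕ) → Strategy := fun y => .mk x (fun d I a => if a = y d I then 1 else 0)
  -- With uniform play before depth `e`, and the play at `e` irrelevant, the counterfactual values
  -- at `e` depend on `y` at larger depths only. This makes backward induction possible.
  have hS : ∀ (y y' : ℕ → ℕ → ℕ) e I a, (∀ d, e < d → y d = y' d) →
      t.counterfactual ((S y).restart κ e) e I a 1 =
        t.counterfactual ((S y').restart κ e) e I a 1 := by
    intro y y' e I a h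
    refine counterfactual_congr (fun i d hd => ?_) _ _ _ _
    cases i with
    | maximizer => rfl
    | minimizer =>
      have hd : d ≠ e := hd.resolve_left (by simp)
      funext J b
      by_cases hlt : d < e
      · simp [Strategy.restart, Strategy.mk, hlt]
      · simp [Strategy.restart, Strategy.mk, hlt, S, h d (by omega)]
  -- After `n` rounds the choices are optimal at all depths from `N - n` on. No node has depth `N`
  -- or more, so any choice will do at the start; each further round redefines `y` at a single
  -- depth.
  have key : ∀ n, ∃ y : ℕ → ℕ → ℕ, (∀ d I, y d I < κ .minimizer I) ∧ ∀ d, N ≤ d + n → ∀ I,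
      ∀ a < κ .minimizer I, t.counterfactual ((S y).restart κ d) d I (y d I) 1 ≤
        t.counterfactual ((S y).restart κ d) d I a 1 := by
    intro n
    induction n with
    | zero =>
      refine ⟨fun _ _ => 0, fun _ I => hκ0 _ I, fun d hd I a _ => ?_⟩
      have h0 : t.Forall (fun i d' J _ => ¬(i = .minimizer ∧ d' = d ∧ J = I)) 1 := by
        refine hN.mono ?_
        rintro i d' J k ⟨h1, -⟩ ⟨-, h2, -⟩
        omega
      rw [counterfactual_eq_zero h0, counterfactual_eq_zero h0]
    | succ n ih =>
      obtain ⟨y, hy0, hy⟩ := ih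
      have hmin := fun d I => Finset.exists_min_image (Finset.range (κ .minimizer I))
        (fun a => t.counterfactual ((S y).restart κ d) d I a 1) ⟨0, Finset.mem_range.2 (hκ0 _ I)⟩
      choose z hz0 hz using hmin
      refine ⟨fun d I => if d + (n + 1) = N then z d I else y d I, fun d I => ?_,
        fun d hd I a ha => ?_⟩
      · dsimp only
        split
        · exact Finset.mem_range.1 (hz0 d I)
        · exact hy0 d I
      · have hoff : ∀ d', d < d' → (fun I => if d' + (n + 1) = N then z d' I else y d' I) = y d' := by
          intro d' hd'
          funext J
          rw [if_neg (by omega)]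
        rw [hS _ y d _ _ hoff, hS _ y d _ _ hoff]
        dsimp only
        split
        · exact hz d I a (Finset.mem_range.2 ha)
        · exact hy d (by omega) I a ha
  obtain ⟨y, hy0, hy⟩ := key N
  refine ⟨y, hy0, ?_⟩
  rintro _ rfl d I a ha
  rw [← sub_nonneg, utility_deviate_sub hκ ha, sub_nonneg]
  -- For a pure strategy the average of the counterfactual values is the value of the chosen action.
  refine le_trans (le_of_eq ?_) (hy d (by omega) I a ha)
  rw [Finset.sum_eq_single_of_mem (y d I) (Finset.mem_range.2 (hy0 d I))]
  · simp [Strategy.restart, Strategy.mk, S]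
  · intro b _ hb
    simp [Strategy.restart, Strategy.mk, hb]

end EFG

namespace EFG

open StackProgram

/-! ### Verifiers -/

/-- Comparison of fractions with nonzero denominators. -/
def Frac.le (x y : Frac) : Bool :=
  Nat.ble (x.1 * y.2.2 + y.2.1 * x.2.2) (y.1 * x.2.2 + x.2.1 * y.2.2)

theorem Frac.le_iff {x y : Frac} (hx : x.2.2 ≠ 0) (hy : y.2.2 ≠ 0) :
    x.le y = true ↔ x.toReal ≤ y.toReal := by
  have hx : (0 : ℝ) < x.2.2 := by exact_mod_cast Nat.pos_of_ne_zero hx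
  have hy : (0 : ℝ) < y.2.2 := by exact_mod_cast Nat.pos_of_ne_zero hy
  rw [le, Nat.ble_eq, toReal, toReal, div_le_div_iff₀ hx hy, ← Nat.cast_le (α := ℝ)]
  push_cast
  constructor <;> intro h <;> linarith

@[fun_prop]
theorem polyFun_le {α : Type} [Enc α] {x y : α → Frac} (hx : PolyFun x) (hy : PolyFun y) :
    PolyFun fun a => (x a).le (y a) := by
  unfold Frac.le
  fun_prop

/-- The value of the game in a final state of the evaluation. -/
def State.value (s : State) : Frac :=
  listCases s.results (0, 0, 0) fun _ r => listCases r (0, 0, 0) fun _ r =>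
    listCases r (0, 0, 0) fun x _ => x

/-- The value of the game is well-defined, and at least the threshold minus half of the error. -/
def State.accepts (s : State) : Bool :=
  listCases s.results false fun e r => listCases r false fun v r =>
    listCases r false fun x _ => !(Nat.beq x.2.2 0) && v.le (x.addMul 1 2 e)

@[fun_prop]
theorem polyFun_value : PolyFun State.value := by
  unfold State.value
  fun_prop

@[fun_prop]
theorem polyFun_accepts : PolyFun State.accepts := by
  unfold State.accepts
  fun_prop

theorem value_evaluate (W : Weights) (J : Input) :
    (evaluate W J.encode).value = J.game.tree.value W 1 := by
  rw [evaluate_encode]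
  rfl

theorem accepts_evaluate (W : Weights) (J : Input) : (evaluate W J.encode).accepts = true ↔
    (J.game.tree.value W 1).2.2 ≠ 0 ∧
      (J.v : ℝ) - J.ε / 2 ≤ (J.game.tree.value W 1).toReal := by
  rw [evaluate_encode]
  have h : (State.mk (J.game.tree.log 1) [.ofRat J.ε, .ofRat J.v, J.game.tree.value W 1]
      (.init .root 0) []).accepts = (!(Nat.beq (J.game.tree.value W 1).2.2 0) &&
        (Frac.ofRat J.v).le ((J.game.tree.value W 1).addMul 1 2 (.ofRat J.ε))) := rfl
  have hd : ∀ q : ℚ, (Frac.ofRat q).2.2 ≠ 0 := fun q => by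
    rw [Frac.den_ofRat]
    exact q.den_ne_zero
  rw [h, Bool.and_eq_true]
  have h0 : (!(Nat.beq (J.game.tree.value W 1).2.2 0)) = true ↔
      (J.game.tree.value W 1).2.2 ≠ 0 := by
    rw [Bool.not_eq_true', ← Bool.not_eq_true, Nat.beq_eq]
  rw [h0]
  refine and_congr_right fun hW => ?_
  rw [Frac.le_iff (hd _) (mul_ne_zero hW (mul_ne_zero two_ne_zero (hd _))),
    Frac.toReal_addMul hW two_ne_zero (hd _), Frac.toReal_ofRat, Frac.toReal_ofRat]
  push_cast
  constructor <;> intro h <;> linarith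

/-- Positive weights for both players from two tables. -/
def positiveWeights (θ : Table × Table) : Weights
  | .maximizer, d, I, a => lookup θ.1 d I a + 1
  | .minimizer, d, I, a => lookup θ.2 d I a + 1

/-- Positive weights for the maximizer and arbitrary weights for the minimizer. -/
def tableWeights (θ : Table × Table) : Weights
  | .maximizer, d, I, a => lookup θ.1 d I a + 1
  | .minimizer, d, I, a => lookup θ.2 d I a

/-- The minimizer plays uniformly before depth `e`. -/
def restartWeights (θ : (Table × Table) × ℕ) : Weights
  | .maximizer, d, I, a => lookup θ.1.1 d I a + 1
  | .minimizer, d, I, a => bif Nat.ble θ.2 d then lookup θ.1.2 d I a else 1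

/-- The minimizer plays uniformly before depth `e`, and deviates there. -/
def deviateWeights (θ : ((Table × Table) × ℕ) × ℕ × ℕ) : Weights
  | .maximizer, d, I, a => lookup θ.1.1.1 d I a + 1
  | .minimizer, d, I, a => bif Nat.beq d θ.1.2 && Nat.beq I θ.2.1 then bif Nat.beq a θ.2.2 then 1 else 0
      else bif Nat.ble θ.1.2 d then lookup θ.1.1.2 d I a else 1

theorem polyFun_evaluate_of_le {θ : Type} [Enc θ] {W : θ → Weights}
    (hW : ∀ i, PolyFun fun p : θ × ℕ × ℕ × ℕ => W p.1 i p.2.1 p.2.2.1 p.2.2.2)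
    (hB : ∀ p i d I a, (W p i d I a).size ≤ esize p) :
    PolyFun fun p : θ × List Sym => evaluate (W p.1) p.2 :=
  polyFun_evaluate hW .X fun p i d I a => by simpa using hB p i d I a

theorem size_lookup_lt (T : Table) (d I a : ℕ) : (lookup T d I a).size + 1 < esize T + 1 := by
  refine lookup_induction (P := fun w => w.size + 1 < esize T + 1) ?_ fun w hw => ?_
  · have := esize_pos T
    simpa using this
  · have h1 := esize_le_of_mem hw
    have h2 := size_lt_esize w
    simp only [esize_prod] at h1
    omega

theorem polyFun_evaluate_positiveWeights :
    PolyFun fun p : (Table × Table) × List Sym => evaluate (positiveWeights p.1) p.2 := by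
  refine polyFun_evaluate_of_le (fun i => ?_) fun p i d I a => ?_
  · cases i <;> simp only [positiveWeights] <;> fun_prop
  · have := esize_prod p
    cases i
    · have := size_add_le (lookup p.1 d I a) 1
      have := size_lookup_lt p.1 d I a
      have := Nat.size_one
      simp only [positiveWeights]
      omega
    · have := size_add_le (lookup p.2 d I a) 1
      have := size_lookup_lt p.2 d I a
      have := Nat.size_one
      simp only [positiveWeights]
      omega

theorem polyFun_evaluate_tableWeights :
    PolyFun fun p : (Table × Table) × List Sym => evaluate (tableWeights p.1) p.2 := by
  refine polyFun_evaluate_of_le (fun i => ?_) fun p i d I a => ?_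
  · cases i <;> simp only [tableWeights] <;> fun_prop
  · have := esize_prod p
    cases i
    · have := size_add_le (lookup p.1 d I a) 1
      have := size_lookup_lt p.1 d I a
      have := Nat.size_one
      simp only [tableWeights]
      omega
    · have := size_lookup_lt p.2 d I a
      simp only [tableWeights]
      omega

theorem polyFun_evaluate_restartWeights :
    PolyFun fun p : ((Table × Table) × ℕ) × List Sym => evaluate (restartWeights p.1) p.2 := by
  refine polyFun_evaluate_of_le (fun i => ?_) fun p i d I a => ?_
  · cases i <;> simp only [restartWeights] <;> fun_prop
  · have := esize_prod p
    have := esize_prod p.1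
    have := Nat.size_one
    cases i
    · have := size_add_le (lookup p.1.1 d I a) 1
      have := size_lookup_lt p.1.1 d I a
      simp only [restartWeights]
      omega
    · have := size_lookup_lt p.1.2 d I a
      simp only [restartWeights]
      cases Nat.ble p.2 d <;> simp only [cond_true, cond_false] <;> omega

theorem polyFun_evaluate_deviateWeights :
    PolyFun fun p : (((Table × Table) × ℕ) × ℕ × ℕ) × List Sym =>
      evaluate (deviateWeights p.1) p.2 := by
  refine polyFun_evaluate_of_le (fun i => ?_) fun p i d I a => ?_
  · cases i <;> simp only [deviateWeights] <;> fun_prop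
  · have := esize_prod p
    have := esize_prod p.1
    have := esize_prod p.1.1
    have := Nat.size_one
    have := Nat.size_zero
    cases i
    · have := size_add_le (lookup p.1.1.1 d I a) 1
      have := size_lookup_lt p.1.1.1 d I a
      simp only [deviateWeights]
      omega
    · have := size_lookup_lt p.1.1.2 d I a
      simp only [deviateWeights]
      cases Nat.beq d p.1.2 && Nat.beq I p.2.1 <;> cases Nat.beq a p.2.2 <;>
        cases Nat.ble p.1.2 d <;> simp only [cond_true, cond_false] <;> omega

/-- The verifier for games without perfect recall. -/
def verify (p : List Sym × List Bool × List Bool) : Bool :=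
  (evaluate (positiveWeights ((parse p.2.1).toTable, (parse p.2.2).toTable)) p.1).accepts

/-- The tables of a certificate for games with perfect recall. -/
def certificateTables (w : List Bool) : Table × Table :=
  ((parse w).fst.toTable, (parse w).snd.toTable)

/-- The verifier for games in which the minimizer has perfect recall. -/
def verifyRecall (p : List Sym × List Bool) : Bool :=
  (evaluate (tableWeights (certificateTables p.2)) p.1).accepts &&
    (evaluate (tableWeights (certificateTables p.2)) p.1).log.all fun x =>
      decide (x.1 = .maximizer) ||
      (evaluate (restartWeights (certificateTables p.2, x.2.1)) p.1).value.le
        (evaluate (deviateWeights ((certificateTables p.2, x.2.1), x.2.2)) p.1).value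

theorem polyFun_verify : PolyFun verify := by
  have h1 := PolyFun.parse
  have h2 := PolyFun.toTable
  have h3 := h2.comp h1
  have h4 : PolyFun fun p : List Sym × List Bool × List Bool =>
      (((parse p.2.1).toTable, (parse p.2.2).toTable), p.1) :=
    ((h3.comp (f := fun p : List Sym × List Bool × List Bool => p.2.1) (by fun_prop)).prodMk
      (h3.comp (f := fun p : List Sym × List Bool × List Bool => p.2.2) (by fun_prop))).prodMk
      (by fun_prop)
  have h5 := polyFun_evaluate_positiveWeights.comp h4
  unfold verify
  exact polyFun_accepts.comp h5

theorem polyFun_verifyRecall : PolyFun verifyRecall := by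
  have h1 := PolyFun.parse
  have h2 := PolyFun.toTable
  have h3 : PolyFun certificateTables :=
    (h2.comp (PolyFun.dataFst.comp h1)).prodMk (h2.comp (PolyFun.dataSnd.comp h1))
  have h4 : PolyFun fun p : List Sym × List Bool => evaluate (tableWeights (certificateTables p.2)) p.1 :=
    polyFun_evaluate_tableWeights.comp (f := fun p : List Sym × List Bool =>
      (certificateTables p.2, p.1)) ((h3.comp (f := fun p : List Sym × List Bool => p.2)
        (by fun_prop)).prodMk (by fun_prop))
  have h5 : PolyFun fun p : (List Sym × List Bool) × Player × ℕ × ℕ × ℕ =>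
      certificateTables p.1.2 :=
    h3.comp (f := fun p : (List Sym × List Bool) × Player × ℕ × ℕ × ℕ => p.1.2) (by fun_prop)
  have h6 : PolyFun fun p : (List Sym × List Bool) × Player × ℕ × ℕ × ℕ =>
      evaluate (restartWeights (certificateTables p.1.2, p.2.2.1)) p.1.1 :=
    polyFun_evaluate_restartWeights.comp
      (f := fun p : (List Sym × List Bool) × Player × ℕ × ℕ × ℕ =>
        ((certificateTables p.1.2, p.2.2.1), p.1.1)) ((h5.prodMk (by fun_prop)).prodMk (by fun_prop))
  have h7 : PolyFun fun p : (List Sym × List Bool) × Player × ℕ × ℕ × ℕ =>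
      evaluate (deviateWeights ((certificateTables p.1.2, p.2.2.1), p.2.2.2)) p.1.1 :=
    polyFun_evaluate_deviateWeights.comp
      (f := fun p : (List Sym × List Bool) × Player × ℕ × ℕ × ℕ =>
        (((certificateTables p.1.2, p.2.2.1), p.2.2.2), p.1.1)) (((h5.prodMk (by fun_prop)).prodMk (by fun_prop)).prodMk (by fun_prop))
  have h8 : PolyFun fun i : Player => decide (i = .maximizer) :=
    PolyFun.of_finite (Enc.injective_ofFinite Player) _
  have h9 : PolyFun fun p : (List Sym × List Bool) × Player × ℕ × ℕ × ℕ =>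
      decide (p.2.1 = .maximizer) := h8.comp (f := fun p : _ × Player × ℕ × ℕ × ℕ => p.2.1)
        (by fun_prop)
  unfold verifyRecall
  have h10 := polyFun_le (polyFun_value.comp h6) (polyFun_value.comp h7)
  exact PolyFun.and (polyFun_accepts.comp h4) (PolyFun.all (polyFun_log.comp h4) (PolyFun.or h9 h10))

-- Paired strings use disjoint parts of the alphabet, so each component is recovered by filtering.
-- The same holds for the next verifier.
open Complexity in
theorem polyTimeDecidable_verify :
    PolyTimeDecidable (fun a : List Sym × List Bool × List Bool => pair (pair a.1 a.2.1) a.2.2)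
      verify := by
  let := Fintype.ofFinite ((Sym ⊕ Bool) ⊕ Bool)
  let : Inhabited ((Sym ⊕ Bool) ⊕ Bool) := ⟨.inr true⟩
  let := Enc.ofFinite ((Sym ⊕ Bool) ⊕ Bool)
  have hfin : ∀ {β : Type} [Enc β] (f : (Sym ⊕ Bool) ⊕ Bool → β), PolyFun f := fun f =>
    PolyFun.of_finite (Enc.injective_ofFinite _) f
  have hmap : ∀ {β : Type} [Enc β] (f : (Sym ⊕ Bool) ⊕ Bool → Option β),
      PolyFun fun l : List ((Sym ⊕ Bool) ⊕ Bool) => l.filterMap f := fun f =>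
    PolyFun.filterMap (f := fun _ x => f x) (by fun_prop)
      ((hfin f).comp (f := fun p : List _ × _ => p.2) (by fun_prop))
  refine polyTimeDecidable_of_polyFun (polyFun_verify.comp
    ((hmap fun x => match x with | .inl (.inl c) => some c | _ => none).prodMk
      ((hmap fun x => match x with | .inl (.inr c) => some c | _ => none).prodMk
        (hmap fun x => match x with | .inr c => some c | _ => none)))) ?_
  rintro ⟨s, w, u⟩
  simp only [pair, List.map_append, List.map_map, List.filterMap_append, List.filterMap_map]
  congr <;> simp [Function.comp_def]

open Complexity in
theorem polyTimeDecidable_verifyRecall :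
    PolyTimeDecidable (fun a : List Sym × List Bool => pair a.1 a.2) verifyRecall := by
  let := Fintype.ofFinite (Sym ⊕ Bool)
  let : Inhabited (Sym ⊕ Bool) := ⟨.inr true⟩
  let := Enc.ofFinite (Sym ⊕ Bool)
  have hfin : ∀ {β : Type} [Enc β] (f : Sym ⊕ Bool → β), PolyFun f := fun f =>
    PolyFun.of_finite (Enc.injective_ofFinite _) f
  have hmap : ∀ {β : Type} [Enc β] (f : Sym ⊕ Bool → Option β),
      PolyFun fun l : List (Sym ⊕ Bool) => l.filterMap f := fun f =>
    PolyFun.filterMap (f := fun _ x => f x) (by fun_prop)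
      ((hfin f).comp (f := fun p : List _ × _ => p.2) (by fun_prop))
  refine polyTimeDecidable_of_polyFun (polyFun_verifyRecall.comp
    ((hmap fun x => match x with | .inl c => some c | _ => none).prodMk
        (hmap fun x => match x with | .inr c => some c | _ => none))) ?_
  rintro ⟨s, w⟩
  simp only [pair, List.filterMap_append, List.filterMap_map]
  congr <;> simp

end EFG

namespace EFG

open StackProgram

/-! ### Certificates -/

/-- The table of the weights of the actions in a log. -/
def weightTable (l : List (Player × ℕ × ℕ × ℕ)) (w : ℕ → ℕ → ℕ → ℕ) : Table :=
  l.map fun x => ((x.2.1, x.2.2.1, x.2.2.2), w x.2.1 x.2.2.1 x.2.2.2)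

/-- The log contains every action at every decision node, and the weight is a function of the key,
so repeated keys are harmless. -/
theorem lookup_weightTable (t : GameTree) (w : ℕ → ℕ → ℕ → ℕ) : t.Forall (fun _ d I k =>
    ∀ a < k, lookup (weightTable (t.log 1) w) d I a = w d I a) 1 := by
  refine GameTree.mem_log_iff (Q := fun _ d I a => lookup _ d I a = _).1 fun x hx => ?_
  have h := exists_mem_lookup (T := weightTable (t.log 1) w)
    (List.mem_map.2 ⟨x, hx, rfl⟩)
  obtain ⟨y, -, hy⟩ := List.mem_map.1 h
  simp only [Prod.mk.injEq] at hy
  obtain ⟨⟨h1, h2, h3⟩, h4⟩ := hy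
  rw [← h4, h1, h2, h3]

/-- The log is part of the result of a polynomial-time evaluation, here with empty tables, so its
size is already polynomially bounded. The weights add a linear number of bits to each entry. -/
theorem exists_esize_weightTable_le : ∃ q : Polynomial ℕ, ∀ (J : Input) w,
    (∀ d I a, w d I a ≤ 2 ^ (4 * J.encode.length + 2)) →
    esize (weightTable (J.game.tree.log 1) w) ≤ q.eval J.encode.length := by
  obtain ⟨R, hR⟩ := polyFun_evaluate_positiveWeights.exists_esize_le
  obtain ⟨R', hR'⟩ := polyFun_log.exists_esize_le
  obtain ⟨c, hc⟩ := exists_esize_le_of_finite Sym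
  let Q : Polynomial ℕ := R'.comp (R.comp (.X * (.C c + 1) + 5))
  refine ⟨Q * (Q + 16 * .X + 14) + 1, fun J w hw => ?_⟩
  set n := J.encode.length
  have hlog : esize (J.game.tree.log 1) ≤ Q.eval n := by
    have h1 := hR (([], []), J.encode)
    have h2 := hR' (evaluate (positiveWeights ([], [])) J.encode)
    have h3 : esize J.encode ≤ n * (c + 1) + 1 := esize_list_le fun a _ => hc a
    rw [evaluate_encode] at h2
    refine h2.trans ?_
    simp only [Q, Polynomial.eval_comp, Polynomial.eval_add, Polynomial.eval_mul, Polynomial.eval_X,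
      Polynomial.eval_C, Polynomial.eval_one, Polynomial.eval_ofNat]
    rw [evaluate_encode] at h1
    refine eval_le_eval_of_le R' (h1.trans (eval_le_eval_of_le R ?_))
    simp only [esize_prod, esize_nil]
    omega
  refine (esize_list_le (N := Q.eval n + 16 * n + 13) fun e he => ?_).trans ?_
  · obtain ⟨x, hx, rfl⟩ := List.mem_map.1 he
    have h1 := esize_le_of_mem hx
    have h2 := esize_le_size (w x.2.1 x.2.2.1 x.2.2.2)
    have h3 : (w x.2.1 x.2.2.1 x.2.2.2).size ≤ 4 * n + 3 :=
      Nat.size_le.2 ((hw _ _ _).trans_lt (Nat.pow_lt_pow_right (by norm_num) (by omega)))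
    simp only [esize_prod] at h1 ⊢
    omega
  · have h1 := (length_lt_esize (J.game.tree.log 1)).le.trans hlog
    simp only [weightTable, List.length_map, Polynomial.eval_add, Polynomial.eval_mul,
      Polynomial.eval_X, Polynomial.eval_one, Polynomial.eval_ofNat]
    exact Nat.add_le_add_right (Nat.mul_le_mul h1 (by omega)) 1

/-- Rounded probabilities, as weights. -/
noncomputable def roundedWeights (J : Input) (σ : Strategy) (i : Player) (d I a : ℕ) : ℕ :=
  min (σ.round (4 * J.encode.length + 2) i d I a) (2 ^ (4 * J.encode.length + 2))

/-- The table of the rounded probabilities of a player. -/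
noncomputable def roundedTable (J : Input) (σ : Strategy) (i : Player) : Table :=
  weightTable (J.game.tree.log 1) (roundedWeights J σ i)

/-- The table also lists actions of the opponent, at whose keys `σ i` need not be a probability; the
cap in `roundedWeights` is there to keep such entries short. At the nodes of the player itself
probabilities are at most `1` and the cap is void. -/
theorem lookup_roundedTable {J : Input} {σ : Strategy} (i : Player)
    (hσ : J.game.Proper σ) : J.game.tree.Forall (fun j d I k => j = i → ∀ a < k,
      lookup (roundedTable J σ i) d I a = σ.round (4 * J.encode.length + 2) i d I a) 1 := by
  refine ((lookup_weightTable _ (roundedWeights J σ i)).and hσ).mono ?_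
  rintro j d I k ⟨h, h0, h1⟩ rfl a ha
  rw [roundedTable, h a ha, roundedWeights, min_eq_left]
  have : σ j d I a ≤ 1 := by
    rw [← h1]
    exact Finset.single_le_sum (f := fun a => σ j d I a)
      (fun b hb => h0 b (Finset.mem_range.1 hb)) (Finset.mem_range.2 ha)
  refine Nat.floor_le_of_le ?_
  push_cast
  exact mul_le_of_le_one_right (by positivity) this

namespace Game

theorem normalize_eq {κ : Player → ℕ → ℕ} {V W : Weights} {i : Player} {d I : ℕ}
    (h : ∀ a < κ i I, V i d I a = W i d I a) :
    ∀ a < κ i I, V.normalize κ i d I a = W.normalize κ i d I a := by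
  intro a ha
  unfold Weights.normalize
  rw [h a ha, Finset.sum_congr rfl fun b hb => by rw [h b (Finset.mem_range.1 hb)]]

theorem toReal_value_normalize {G : Game} {κ : Player → ℕ → ℕ}
    (hκ : G.tree.Forall (fun i _ I k => κ i I = k) 1) {W : Weights}
    (hW : (G.tree.value W 1).2.2 ≠ 0) :
    (G.tree.value W 1).toReal = G.tree.utility (W.normalize κ) 1 := by
  refine GameTree.toReal_value G.isDistribution hW (hκ.mono ?_)
  rintro i d I _ rfl a _
  rfl

theorem proper_normalize {G : Game} {κ : Player → ℕ → ℕ}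
    (hκ : G.tree.Forall (fun i _ I k => κ i I = k) 1) {W : Weights}
    (hW : (G.tree.value W 1).2.2 ≠ 0) : G.Proper (W.normalize κ) := by
  rw [GameTree.den_value] at hW
  exact (hκ.and hW).mono fun _ _ _ _ h => Weights.proper_normalize h.1 h.2

theorem den_value_ne_zero {G : Game} {W : Weights}
    (h : G.tree.Forall (fun i d I k => ∃ a < k, W i d I a ≠ 0) 1) :
    (G.tree.value W 1).2.2 ≠ 0 := by
  rw [GameTree.den_value]
  refine h.mono ?_
  rintro i d I k ⟨a, ha, h⟩ h'
  exact h (Finset.sum_eq_zero_iff.1 h' a (Finset.mem_range.2 ha))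

theorem den_value_positiveWeights (G : Game) (θ : Table × Table) :
    (G.tree.value (positiveWeights θ) 1).2.2 ≠ 0 := by
  obtain ⟨κ, hκ0, hκ⟩ := G.exists_numActions
  refine den_value_ne_zero (hκ.mono ?_)
  rintro i d I _ rfl
  exact ⟨0, hκ0 i I, by cases i <;> simp [positiveWeights]⟩

/-- Replacing the strategy of a player by rounded probabilities changes the utility by little. -/
theorem abs_utility_positiveWeights_sub_le {J : Input} {κ : Player → ℕ → ℕ}
    (hκ : J.game.tree.Forall (fun i _ I k => κ i I = k) 1) {σ τ : Strategy} {i : Player}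
    (hσ : J.game.Proper σ) (hτ : J.game.Proper τ) {W : Weights}
    (hi : ∀ d I a, W i d I a = lookup (roundedTable J σ i) d I a + 1)
    (hτi : τ i = W.normalize κ i) (hne : ∀ j, j ≠ i → τ j = σ j) :
    |J.game.tree.utility τ 1 - J.game.tree.utility σ 1| ≤ J.ε / 4 := by
  refine abs_utility_round_sub_le hκ hσ hτ ((hκ.and (lookup_roundedTable i hσ)).mono ?_)
  rintro j d I _ ⟨rfl, h⟩
  by_cases hj : j = i
  · subst hj
    right
    rw [hτi]
    exact normalize_eq fun a ha => by rw [hi, h rfl a ha]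
  · left
    intro a _
    rw [hne j hj]

end Game

theorem length_code_enc {α : Type} [Enc α] (a : α) : (Enc.enc a).code.length = esize a :=
  Data.length_code _

/-! ### Strategies of weights from tables -/

theorem normalize_restartWeights {κ : Player → ℕ → ℕ} (θ : Table × Table) (e : ℕ) :
    (restartWeights (θ, e)).normalize κ = ((tableWeights θ).normalize κ).restart κ e := by
  funext i d I a
  cases i with
  | maximizer => rfl
  | minimizer =>
    by_cases h : d < e
    · have : Nat.ble e d = false := by
        rw [← Bool.not_eq_true, Nat.ble_eq]
        omega
      simp [Weights.normalize, restartWeights, Strategy.restart, Strategy.mk, h, this]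
    · have : Nat.ble e d = true := by
        rw [Nat.ble_eq]
        omega
      simp [Weights.normalize, restartWeights, tableWeights, Strategy.restart, Strategy.mk, h, this]

theorem normalize_deviateWeights {κ : Player → ℕ → ℕ} (θ : Table × Table) {e I a : ℕ}
    (ha : a < κ .minimizer I) : (deviateWeights ((θ, e), I, a)).normalize κ =
      (((tableWeights θ).normalize κ).restart κ e).deviate e I a := by
  rw [← normalize_restartWeights]
  funext i d J b
  cases i with
  | maximizer => rfl
  | minimizer =>
    by_cases h : d = e ∧ J = I
    · obtain ⟨rfl, rfl⟩ := h
      have h1 : ∀ b, deviateWeights ((θ, d), J, a) .minimizer d J b = if b = a then 1 else 0 := by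
        intro b
        by_cases hb : b = a
        · simp [deviateWeights, hb]
        · have : Nat.beq b a = false := by rwa [← Bool.not_eq_true, Nat.beq_eq]
          simp [deviateWeights, hb, this]
      simp only [Weights.normalize, h1, Strategy.deviate, Strategy.mk]
      simp [ha]
    · have h1 : (Nat.beq d e && Nat.beq J I) = false := by
        rw [← Bool.not_eq_true, Bool.and_eq_true, Nat.beq_eq, Nat.beq_eq]
        exact h
      simp only [Weights.normalize, deviateWeights, h1, cond_false, Strategy.deviate, Strategy.mk,
        if_neg h, restartWeights]

theorem den_value_restartWeights {G : Game} {κ : Player → ℕ → ℕ} (hκ0 : ∀ i I, 0 < κ i I)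
    (hκ : G.tree.Forall (fun i _ I k => κ i I = k) 1) {θ : Table × Table}
    (h : (G.tree.value (tableWeights θ) 1).2.2 ≠ 0) (e : ℕ) :
    (G.tree.value (restartWeights (θ, e)) 1).2.2 ≠ 0 := by
  rw [GameTree.den_value] at h ⊢
  refine (hκ.and h).mono ?_
  rintro i d I _ ⟨rfl, h⟩
  cases i with
  | maximizer => exact h
  | minimizer =>
    cases hd : Nat.ble e d with
    | true => simpa only [restartWeights, tableWeights, hd, cond_true] using h
    | false => simp [restartWeights, hd, (hκ0 _ I).ne']

theorem den_value_deviateWeights {G : Game} {κ : Player → ℕ → ℕ} (hκ0 : ∀ i I, 0 < κ i I)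
    (hκ : G.tree.Forall (fun i _ I k => κ i I = k) 1) {θ : Table × Table}
    (h : (G.tree.value (tableWeights θ) 1).2.2 ≠ 0) (e I : ℕ) {a : ℕ} (ha : a < κ .minimizer I) :
    (G.tree.value (deviateWeights ((θ, e), I, a)) 1).2.2 ≠ 0 := by
  have h := den_value_restartWeights hκ0 hκ h e
  rw [GameTree.den_value] at h ⊢
  refine (hκ.and h).mono ?_
  rintro i d J _ ⟨rfl, h⟩
  cases i with
  | maximizer => exact h
  | minimizer =>
    cases hd : Nat.beq d e && Nat.beq J I with
    | false => simpa only [deviateWeights, restartWeights, hd, cond_false] using h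
    | true =>
      have hJ : J = I := by
        rw [Bool.and_eq_true, Nat.beq_eq, Nat.beq_eq] at hd
        exact hd.2
      subst hJ
      intro h0
      have := Finset.sum_eq_zero_iff.1 h0 a (Finset.mem_range.2 ha)
      simp only [deviateWeights] at this
      rw [hd] at this
      simp at this

/-- The first conjunct, that denominators do not vanish for the guessed weights, makes the restarted
and deviating evaluations well-defined too. All comparisons of fractions are then comparisons of
payoffs. -/
theorem verifyRecall_iff {J : Input} {κ : Player → ℕ → ℕ} (hκ0 : ∀ i I, 0 < κ i I)
    (hκ : J.game.tree.Forall (fun i _ I k => κ i I = k) 1) {w : List Bool} {σ : Strategy}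
    (hσ : σ = (tableWeights (certificateTables w)).normalize κ) :
    verifyRecall (J.encode, w) = true ↔
      (J.game.tree.value (tableWeights (certificateTables w)) 1).2.2 ≠ 0 ∧
      (J.v : ℝ) - J.ε / 2 ≤ J.game.tree.utility σ 1 ∧
      J.game.tree.Forall (fun i d I k => i = .minimizer → ∀ a < k,
        J.game.tree.utility (σ.restart κ d) 1 ≤
          J.game.tree.utility ((σ.restart κ d).deviate d I a) 1) 1 := by
  subst hσ
  simp only [verifyRecall, value_evaluate]
  rw [Bool.and_eq_true, accepts_evaluate, and_assoc]
  refine and_congr_right fun h => ?_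
  rw [Game.toReal_value_normalize hκ h, List.all_eq_true, evaluate_encode]
  refine and_congr_right fun _ => ?_
  have hlog := GameTree.mem_log_iff (t := J.game.tree) (d := 1) (Q := fun i d I a =>
    (decide (i = .maximizer) ||
      (J.game.tree.value (restartWeights (certificateTables w, d)) 1).le
        (J.game.tree.value (deviateWeights ((certificateTables w, d), I, a)) 1)) = true)
  refine hlog.trans ?_
  have hiff : ∀ d I a, a < κ .minimizer I →
      (((J.game.tree.value (restartWeights (certificateTables w, d)) 1).le
        (J.game.tree.value (deviateWeights ((certificateTables w, d), I, a)) 1)) = true ↔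
      J.game.tree.utility (((tableWeights (certificateTables w)).normalize κ).restart κ d) 1 ≤
        J.game.tree.utility
          ((((tableWeights (certificateTables w)).normalize κ).restart κ d).deviate d I a) 1) := by
    intro d I a ha
    have h1 := den_value_restartWeights hκ0 hκ h d
    have h2 := den_value_deviateWeights hκ0 hκ h d I ha
    rw [Frac.le_iff h1 h2, Game.toReal_value_normalize hκ h1, Game.toReal_value_normalize hκ h2,
      normalize_restartWeights, normalize_deviateWeights _ ha]
  constructor <;> intro H <;> refine (hκ.and H).mono ?_
  · rintro _ d I _ ⟨rfl, H⟩ rfl a ha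
    have := H a ha
    simp only [reduceCtorEq, decide_false, Bool.false_or] at this
    exact (hiff d I a ha).1 this
  · rintro i d I _ ⟨rfl, H⟩ a ha
    cases i with
    | maximizer => rfl
    | minimizer => simpa using (hiff d I a ha).2 (H rfl a ha)

/-! ### The main theorem -/

theorem verify_iff {J : Input} {κ : Player → ℕ → ℕ}
    (hκ : J.game.tree.Forall (fun i _ I k => κ i I = k) 1) (w u : List Bool) :
    verify (J.encode, w, u) = true ↔ (J.v : ℝ) - J.ε / 2 ≤ J.game.tree.utility
      ((positiveWeights ((parse w).toTable, (parse u).toTable)).normalize κ) 1 := by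
  have h := J.game.den_value_positiveWeights ((parse w).toTable, (parse u).toTable)
  rw [verify, accepts_evaluate, Game.toReal_value_normalize hκ h]
  exact and_iff_right h

open Complexity in
theorem isIn_sigma2P : (behavioralMaxMin fun _ => True).IsIn (Sigma2P Sym) := by
  obtain ⟨q, hq⟩ := exists_esize_weightTable_le
  have hround : ∀ (J : Input) σ i, esize (roundedTable J σ i) ≤ q.eval J.encode.length :=
    fun J σ i => hq J _ fun d I a => min_le_right _ _
  refine ⟨{s | ∃ w : List Bool, w.length ≤ q.eval s.length ∧ ∀ u : List Bool,
    u.length ≤ q.eval s.length → verify (s, w, u) = true},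
    ⟨q, verify, polyTimeDecidable_verify, fun s => Iff.rfl⟩, ?_, ?_⟩
  · rintro _ ⟨J, -, rfl, hJ⟩
    obtain ⟨κ, hκ0, hκ⟩ := J.game.exists_numActions
    have hε : (0 : ℝ) < J.ε := by exact_mod_cast J.ε_pos
    -- One quarter of `ε` is given up for a strategy that nearly attains the supremum and another
    -- quarter for rounding it, which leaves the accepted bound `v - ε / 2`.
    obtain ⟨σ, hσ, hval⟩ := J.timeable.exists_forall_lt_utility (c := J.v - J.ε / 4) (by linarith)
    refine ⟨(Enc.enc (roundedTable J σ .maximizer)).code, ?_, fun u _ => ?_⟩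
    · rw [length_code_enc]
      exact hround J σ _
    · rw [verify_iff hκ, parse_code, Data.toTable_enc]
      set W := positiveWeights (roundedTable J σ .maximizer, (parse u).toTable)
      have hW : J.game.Proper (W.normalize κ) :=
        Game.proper_normalize hκ (J.game.den_value_positiveWeights _)
      -- The exact strategy of the maximizer against the opponent read from `u`; the evaluated
      -- profile differs from it by the rounding of the maximizer only.
      let τ : Strategy := .mk (σ .maximizer) (W.normalize κ .minimizer)
      have hτ : J.game.Proper τ := (GameTree.Forall.and hσ hW).mono fun i d I k h => by
        cases i with
        | maximizer => exact h.1
        | minimizer => exact h.2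
      have hT : roundedTable J σ .maximizer = roundedTable J τ .maximizer := rfl
      have h1 := Game.abs_utility_positiveWeights_sub_le (i := .maximizer) (W := W) hκ hτ hW
        (fun d I a => by rw [← hT]; rfl) rfl (fun j hj => by
          cases j with
          | maximizer => exact absurd rfl hj
          | minimizer => rfl)
      have h2 := hval τ hτ rfl
      have h3 := (abs_le.1 h1).1
      linarith
  · rintro _ ⟨J, -, rfl, hJ⟩ ⟨w, -, hw⟩
    obtain ⟨κ, hκ0, hκ⟩ := J.game.exists_numActions
    have hε : (0 : ℝ) < J.ε := by exact_mod_cast J.ε_pos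
    have hprop : ∀ θ, J.game.Proper ((positiveWeights θ).normalize κ) := fun θ =>
      Game.proper_normalize hκ (J.game.den_value_positiveWeights _)
    -- A response to the guessed strategy with payoff below `v - ε`; the second table is immaterial.
    -- Rounding the response raises the payoff by at most `ε / 4`, which stays below `v - ε / 2`.
    obtain ⟨τ, hτ, hmax, hlt⟩ := J.timeable.exists_utility_lt hJ (hprop ((parse w).toTable, []))
    have h := hw (Enc.enc (roundedTable J τ .minimizer)).code (by
      rw [length_code_enc]
      exact hround J τ _)
    rw [verify_iff hκ, parse_code, Data.toTable_enc] at h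
    have h1 := Game.abs_utility_positiveWeights_sub_le (i := .minimizer)
      (W := positiveWeights ((parse w).toTable, roundedTable J τ .minimizer)) hκ hτ
      (hprop _) (fun d I a => rfl) rfl (fun j hj => by
        cases j with
        | maximizer => rw [hmax]; rfl
        | minimizer => exact absurd rfl hj)
    have h3 := (abs_le.1 h1).2
    linarith

open Complexity in
theorem isIn_NP : (behavioralMaxMin fun G => G.PerfectRecall .minimizer).IsIn (NP Sym) := by
  obtain ⟨q, hq⟩ := exists_esize_weightTable_le
  -- Two tables, and one node that pairs them.
  refine ⟨{s | ∃ w : List Bool, w.length ≤ (2 * q + 1).eval s.length ∧ verifyRecall (s, w) = true},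
    ⟨2 * q + 1, verifyRecall, polyTimeDecidable_verifyRecall, fun s => Iff.rfl⟩, ?_, ?_⟩
  · rintro _ ⟨J, -, rfl, hJ⟩
    obtain ⟨κ, hκ0, hκ⟩ := J.game.exists_numActions
    have hε : (0 : ℝ) < J.ε := by exact_mod_cast J.ε_pos
    obtain ⟨σ, hσ, hval⟩ := J.timeable.exists_forall_lt_utility (c := J.v - J.ε / 4) (by linarith)
    let X := roundedTable J σ .maximizer
    -- The answer is optimal against the rounded strategy that the verifier uses, not against `σ`.
    -- Being pure, it has exact weights `0` and `1` and needs no rounding.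
    obtain ⟨y, hy0, hy⟩ := J.game.tree.exists_locally_optimal hκ0 hκ
      ((tableWeights (X, [])).normalize κ .maximizer)
    let Y : Table := weightTable (J.game.tree.log 1) fun d I a => if a = y d I then 1 else 0
    have hY := (hκ.and (lookup_weightTable J.game.tree fun d I a => if a = y d I then 1 else 0))
    refine ⟨(Enc.enc (X, Y)).code, ?_, ?_⟩
    · have h1 : esize X ≤ _ := hq J _ fun d I a => min_le_right _ _
      have h2 : esize Y ≤ _ := hq J (fun d I a => if a = y d I then 1 else 0) fun d I a => by
        split
        · exact Nat.one_le_two_pow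
        · exact Nat.zero_le _
      rw [length_code_enc, esize_prod]
      simp only [Polynomial.eval_add, Polynomial.eval_mul, Polynomial.eval_ofNat,
        Polynomial.eval_one]
      omega
    have hXY : certificateTables (Enc.enc (X, Y)).code = (X, Y) := by
      rw [certificateTables, parse_code]
      exact Prod.ext (Data.toTable_enc X) (Data.toTable_enc Y)
    set W := tableWeights (X, Y) with hW
    have hD : (J.game.tree.value W 1).2.2 ≠ 0 := by
      refine Game.den_value_ne_zero (hY.mono ?_)
      rintro i d I _ ⟨rfl, h⟩
      cases i with
      | maximizer => exact ⟨0, hκ0 _ I, Nat.succ_ne_zero _⟩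
      | minimizer =>
        refine ⟨y d I, hy0 d I, ?_⟩
        have := h _ (hy0 d I)
        simp only [if_true] at this
        simp [W, tableWeights, Y, this]
    have hprop := Game.proper_normalize hκ hD
    rw [verifyRecall_iff hκ0 hκ rfl, hXY]
    refine ⟨hD, ?_, ?_⟩
    · let τ : Strategy := .mk (σ .maximizer) (W.normalize κ .minimizer)
      have hτ : J.game.Proper τ := (GameTree.Forall.and hσ hprop).mono fun i d I k h => by
        cases i with
        | maximizer => exact h.1
        | minimizer => exact h.2
      have h1 := Game.abs_utility_positiveWeights_sub_le (i := .maximizer) (W := W) hκ hτ hprop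
        (fun d I a => rfl) rfl (fun j hj => by
          cases j with
          | maximizer => exact absurd rfl hj
          | minimizer => rfl)
      have h2 := hval τ hτ rfl
      have h3 := (abs_le.1 h1).1
      linarith
    -- The decoded strategy agrees with the pure answer only at actions available in the tree. This
    -- suffices, since payoffs depend on nothing else.
    · have hS : J.game.tree.Forall (fun i d I k => ∀ a < k, W.normalize κ i d I a =
          Strategy.mk ((tableWeights (X, [])).normalize κ .maximizer)
            (fun d I a => if a = y d I then 1 else 0) i d I a) 1 := by
        refine hY.mono ?_
        rintro i d I _ ⟨rfl, h⟩ a ha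
        cases i with
        | maximizer => rfl
        | minimizer =>
          have h1 : ∀ b < κ .minimizer I, W .minimizer d I b = if b = y d I then 1 else 0 := h
          have h2 : ∑ b ∈ Finset.range (κ .minimizer I), (W .minimizer d I b : ℝ) = 1 := by
            rw [Finset.sum_congr rfl fun b hb => by rw [h1 b (Finset.mem_range.1 hb)]]
            simp [hy0 d I]
          simp [Weights.normalize, h2, h1 a ha, Strategy.mk]
      refine hκ.mono ?_
      rintro _ d I _ rfl rfl a ha
      refine le_of_eq_of_le (GameTree.utility_congr (hS.mono fun i e _ k h b hb => ?_))
        ((hy _ rfl d I a ha).trans_eq (GameTree.utility_congr (hS.mono fun i e _ k h b hb => ?_)))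
      · cases i with
        | maximizer => rfl
        | minimizer =>
          have h1 := h b hb
          simp only [Strategy.mk] at h1
          simp only [Strategy.restart, Strategy.mk, ← hW, h1]
      · cases i with
        | maximizer => rfl
        | minimizer =>
          have h1 := h b hb
          simp only [Strategy.mk] at h1
          simp only [Strategy.deviate, Strategy.restart, Strategy.mk, ← hW, h1]
  · rintro _ ⟨J, hR, rfl, hJ⟩ ⟨w, -, hw⟩
    obtain ⟨κ, hκ0, hκ⟩ := J.game.exists_numActions
    have hε : (0 : ℝ) < J.ε := by exact_mod_cast J.ε_pos
    obtain ⟨hD, hv, hopt⟩ := (verifyRecall_iff hκ0 hκ rfl).1 hw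
    have hσ := Game.proper_normalize hκ hD
    obtain ⟨τ, hτ, hmax, hlt⟩ := J.timeable.exists_utility_lt hJ hσ
    -- An accepted answer is a best response with payoff at least `v - ε / 2`, so no `τ` can push
    -- the payoff below `v - ε`.
    have := Game.utility_le_of_locally_optimal J.timeable hR hκ0 hκ hσ hopt hτ hmax
    linarith

end EFG

theorem mainTheorem9 :
    (EFG.behavioralMaxMin fun _ => True).IsIn (Complexity.Sigma2P EFG.Sym) ∧
    (EFG.behavioralMaxMin fun G => G.PerfectRecall EFG.Player.minimizer).IsIn
      (Complexity.NP EFG.Sym) :=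
  ⟨EFG.isIn_sigma2P, EFG.isIn_NP⟩
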